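/- **Setting.** Two fluids are labelled by $\pm$ ($+$ upper, $-$ lower). The pressure laws $P_\pm\in C^\infty((0,\infty))$ are positive and strictly increasing with $1/P_\pm'\in L^\infty_{loc}((0,\infty))$. The viscosities $\varepsilon_\pm,\delta_\pm\in C^\infty((0,\infty))$ satisfy $\varepsilon_\pm>0$ and $\delta_\pm\ge 0$. Let $g>0$, $\sigma\ge 0$, $m,\ell>0$. Let $\rho_0^->0$ satisfy $P_-(\rho_0^-)>P_+(\rho_0^-)$ and $P_-(\rho_0^-)\in P_+((0,\infty))$, and put $\rho_0^+=P_+^{-1}(P_-(\rho_0^-))$, so that $[\![\rho_0]\!]:=\rho_0^+-\rho_0^->0$. With $h_\pm(z)=\int_1^z P_\pm'(r)/r\,dr$ assume $h_-(\rho_0^-)+gm\in h_-((0,\infty))$ and $h_+(\rho_0^+)-g\ell\in h_+((0,\infty))$. The steady density is $\rho_0(x_3)=h_\pm^{-1}(h_\pm(\rho_0^\pm)-gx_3)$, with $-$ on $(-m,0)$ and $+$ on $(0,\ell)$. Write $\varepsilon_0=\varepsilon(\rho_0)$, $\delta_0=\delta(\rho_0)$ and $P'(\rho_0)$, each with the functions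 of the fluid at height $x_3$. Write $[\![f]\!]$ for the trace of $f$ at $x_3=0$ from above minus the trace from below. **Growth rate and normal modes.** For $r>0$, $s>0$ and $\varphi,\psi\in H^1_0((-m,\ell))$ let $$E_r(\varphi,\psi;s)=\tfrac{\sigma r^2}{2}\psi(0)^2+\tfrac12\int_{-m}^{\ell}\Big[(s\delta_0+P'(\rho_0)\rho_0)(\psi'+r\varphi)^2-2g\rho_0 r\varphi\psi\Big]+\tfrac12\int_{-m}^{\ell}s\varepsilon_0\Big[(\varphi'-r\psi)^2+(\psi'-r\varphi)^2+\tfrac13(\psi'+r\varphi)^2\Big],$$ $$\mathcal A=\Big\{(\varphi,\psi)\in H_0^1\times H_0^1:\ \tfrac12\int_{-m}^{\ell}\rho_0(\varphi^2+\psi^2)=1\Big\},\qquad \mu_r(s)=\inf_{\mathcal A}E_r(\cdot,\cdot;s).$$ Let $|\xi|_c=\sqrt{g[\![\rho_0]\!]/\sigma}$ ($=\infty$ if $\sigma=0$). For $0<r<|\xi|_c$ let $\lambda(r)$ be the $s>0$ with $\mu_r(s)<0$ and $s=\sqrt{-\mu_r(s)}$, and let $(\varphi_r,\psi_r)\in\mathcal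 A$ be a minimizer of $E_r(\cdot,\cdot;\lambda(r))$ over $\mathcal A$. For $\xi\in\mathbb R^2$ with $0<|\xi|<|\xi|_c$ put $$\varphi(\xi,x_3)=\tfrac{e_1\cdot\xi}{|\xi|}\varphi_{|\xi|}(x_3),\quad \theta(\xi,x_3)=\tfrac{e_2\cdot\xi}{|\xi|}\varphi_{|\xi|}(x_3),\quad \psi(\xi,x_3)=\psi_{|\xi|}(x_3),$$ $$\hat w(\xi,x_3)=-i\varphi(\xi,x_3)e_1-i\theta(\xi,x_3)e_2+\psi(\xi,x_3)e_3 .$$ **Linearized problem.** On the layers $\Omega_-=(2\pi L\mathbb T)^2\times(-m,0)$ and $\Omega_+=(2\pi L\mathbb T)^2\times(0,\ell)$, for $t\ge 0$: $$\partial_t\eta=v,\qquad \partial_t q+\rho_0\operatorname{div}v=0,$$ $$\rho_0\partial_t v+\nabla(P'(\rho_0)q)+gqe_3+g\rho_0\nabla\eta_3=\operatorname{div}\Big(\varepsilon_0\big(Dv+Dv^T-\tfrac23(\operatorname{div}v)I\big)+\delta_0(\operatorname{div}v)I\Big),$$ with $[\![\eta]\!]=[\![v]\!]=0$, $$[\![P'(\rho_0)qI-\varepsilon_0(Dv+Dv^T)-(\delta_0-\tfrac23\varepsilon_0)(\operatorname{div}v)I]\!]e_3=\sigma\Delta_{x_1,x_2}\eta_3\,e_3,$$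 and $v=0$ at $x_3=-m$ and at $x_3=\ell$. **Sobolev spaces.** $H^k(\Omega)$ is the piecewise Sobolev space of those $f$ with $f|_{\Omega_\pm}\in H^k(\Omega_\pm)$, with norm $\|f\|_{H^k}^2=\|f\|_{H^k(\Omega_+)}^2+\|f\|_{H^k(\Omega_-)}^2$, where $$\|f\|^2_{H^k(\Omega_\pm)}=\sum_{j=0}^k\ \sum_{\xi\in(L^{-1}\mathbb Z)^2}(1+|\xi|^2)^{k-j}\,\|\partial_{x_3}^j\hat f(\xi,\cdot)\|^2_{L^2(I_\pm)},\qquad \hat f(\xi,x_3)=\int_{(0,2\pi L)^2}f(x',x_3)e^{-ix'\cdot\xi}\,dx',$$ $I_-=(-m,0)$, $I_+=(0,\ell)$; for vector-valued $f$ the squared norms of the components are added. **Theorem.** Let $L>\sqrt{\sigma/(g[\![\rho_0]\!])}$. 1. For every $0<r<|\xi|_c$ the number $\lambda(r)$ exists and is unique, and minimizers $(\varphi_r,\psi_r)$ exist. The number $$\Lambda_L:=\sup\{\lambda(|\xi|):\ \xi\in(L^{-1}\mathbb Z)^2,\ 0<|\xi|<|\xi|_c\}$$ is positive, finite, and attained.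 2. Let $(\varphi_r,\psi_r)_{0<r<|\xi|_c}$ be any choice of minimizers, and let $\xi_1,\xi_2\in(L^{-1}\mathbb Z)^2$ satisfy $0<|\xi_j|<|\xi|_c$, $\xi_1=-\xi_2$ and $\lambda(|\xi_j|)=\Lambda_L$. Define $$\eta(x,t)=e^{\Lambda_Lt}\sum_{j=1}^2\hat w(\xi_j,x_3)e^{ix'\cdot\xi_j},\qquad v(x,t)=\Lambda_Le^{\Lambda_Lt}\sum_{j=1}^2\hat w(\xi_j,x_3)e^{ix'\cdot\xi_j},$$ $$q(x,t)=-e^{\Lambda_Lt}\rho_0(x_3)\sum_{j=1}^2\big(e_1\cdot\xi_j\,\varphi(\xi_j,x_3)+e_2\cdot\xi_j\,\theta(\xi_j,x_3)+\partial_3\psi(\xi_j,x_3)\big)e^{ix'\cdot\xi_j}.$$ Then $\psi(\xi_j,0)\ne 0$, and $\eta,v,q$ are real-valued, $2\pi L$-periodic in $x_1,x_2$, smooth in each layer, and solve the linearized problem with its jump and boundary conditions. For every $t\ge 0$ and every integer $k\ge 0$ we have $\eta(t),v(t),q(t)\in H^k(\Omega)$ and $$\|\eta(t)\|_{H^k}=e^{t\Lambda_L}\|\eta(0)\|_{H^k},\qquad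 \|v(t)\|_{H^k}=e^{t\Lambda_L}\|v(0)\|_{H^k},\qquad \|q(t)\|_{H^k}=e^{t\Lambda_L}\|q(0)\|_{H^k}.$$ -/

import Mathlib

open Set Filter Topology MeasureTheory
open scoped ContDiff ENNReal

noncomputable section

namespace RayleighTaylor

/-! ### The two fluids and the steady state -/

/-- The lower fluid (below the interface `x₃ = 0`) and the upper fluid (above it). -/
inductive Phase
  | lower
  | upper

/-- The data: the pressure laws, shear viscosities and bulk viscosities of the two fluids as
functions of the density, gravity `g`, surface tension `σ`, the depth `m` of the lower layer, the
height `ℓ` of the upper layer, and the density `ρ₀⁻` of the lower fluid at the interface. -/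
structure FluidData where
  P : Phase → ℝ → ℝ
  eps : Phase → ℝ → ℝ
  del : Phase → ℝ → ℝ
  g : ℝ
  σ : ℝ
  m : ℝ
  ℓ : ℝ
  rhoMinus : ℝ

namespace FluidData

variable (D : FluidData)

/-- The enthalpy `h(z) = ∫_1^z P'(r) / r dr` of one fluid. -/
def enthalpy (a : Phase) (z : ℝ) : ℝ := ∫ r in (1 : ℝ)..z, deriv (D.P a) r / r

/-- `ρ₀⁺ = P₊⁻¹(P₋(ρ₀⁻))`. -/
def rhoPlus : ℝ := Function.invFunOn (D.P .upper) (Ioi 0) (D.P .lower D.rhoMinus)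

/-- The jump of the steady density across the interface, `⟦ρ₀⟧ = ρ₀⁺ - ρ₀⁻`. -/
def jumpRho : ℝ := D.rhoPlus - D.rhoMinus

/-- The steady density profile: `ρ₀ = h₋⁻¹(h₋(ρ₀⁻) - g x₃)` below the interface and
`ρ₀ = h₊⁻¹(h₊(ρ₀⁺) - g x₃)` above it. -/
def rho0 (x₃ : ℝ) : ℝ :=
  if x₃ < 0 then
    Function.invFunOn (D.enthalpy .lower) (Ioi 0) (D.enthalpy .lower D.rhoMinus - D.g * x₃)
  else
    Function.invFunOn (D.enthalpy .upper) (Ioi 0) (D.enthalpy .upper D.rhoPlus - D.g * x₃)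

/-- The fluid that occupies the height `x₃`. -/
def phaseAt (x₃ : ℝ) : Phase := if x₃ < 0 then .lower else .upper

/-- `P'(ρ₀)` -/
def dP0 (x₃ : ℝ) : ℝ := deriv (D.P (phaseAt x₃)) (D.rho0 x₃)

/-- `ε₀ = ε(ρ₀)` -/
def eps0 (x₃ : ℝ) : ℝ := D.eps (phaseAt x₃) (D.rho0 x₃)

/-- `δ₀ = δ(ρ₀)` -/
def del0 (x₃ : ℝ) : ℝ := D.del (phaseAt x₃) (D.rho0 x₃)

/-- The standing assumptions on the two fluids. -/
structure Admissible : Prop where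
  P_smooth : ∀ a, ContDiffOn ℝ ∞ (D.P a) (Ioi 0)
  P_pos : ∀ a, ∀ z > 0, 0 < D.P a z
  P_strictMono : ∀ a, StrictMonoOn (D.P a) (Ioi 0)
  /-- For a smooth increasing `P` this says that `1 / P'` is locally bounded on `(0, ∞)`. -/
  P_deriv_pos : ∀ a, ∀ z > 0, 0 < deriv (D.P a) z
  eps_smooth : ∀ a, ContDiffOn ℝ ∞ (D.eps a) (Ioi 0)
  eps_pos : ∀ a, ∀ z > 0, 0 < D.eps a z
  del_smooth : ∀ a, ContDiffOn ℝ ∞ (D.del a) (Ioi 0)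
  del_nonneg : ∀ a, ∀ z > 0, 0 ≤ D.del a z
  g_pos : 0 < D.g
  σ_nonneg : 0 ≤ D.σ
  m_pos : 0 < D.m
  ℓ_pos : 0 < D.ℓ
  rhoMinus_pos : 0 < D.rhoMinus
  rhoMinus_unstable : D.P .upper D.rhoMinus < D.P .lower D.rhoMinus
  rhoMinus_mem : D.P .lower D.rhoMinus ∈ D.P .upper '' Ioi 0
  m_range : D.enthalpy .lower D.rhoMinus + D.g * D.m ∈ D.enthalpy .lower '' Ioi 0
  ℓ_range : D.enthalpy .upper D.rhoPlus - D.g * D.ℓ ∈ D.enthalpy .upper '' Ioi 0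

/-! ### The modified variational problem and the growth rate -/

/-- Membership in `H¹₀((-m, ℓ))`, through the absolutely continuous representative. -/
def MemH01 (f : ℝ → ℝ) : Prop :=
  AbsolutelyContinuousOnInterval f (-D.m) D.ℓ ∧
    MemLp (deriv f) 2 (volume.restrict (Ioo (-D.m) D.ℓ)) ∧ f (-D.m) = 0 ∧ f D.ℓ = 0

/-- The energy `E(φ, ψ; s)` at frequency modulus `r = |ξ|`, with the modified viscosities
`s ε₀` and `s δ₀`. -/
def energy (r s : ℝ) (φ ψ : ℝ → ℝ) : ℝ :=
  D.σ * r ^ 2 / 2 * ψ 0 ^ 2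
    + 1 / 2 * (∫ x in (-D.m)..D.ℓ,
        ((s * D.del0 x + D.dP0 x * D.rho0 x) * (deriv ψ x + r * φ x) ^ 2
          - 2 * D.g * D.rho0 x * r * φ x * ψ x))
    + 1 / 2 * (∫ x in (-D.m)..D.ℓ,
        s * D.eps0 x * ((deriv φ x - r * ψ x) ^ 2 + (deriv ψ x - r * φ x) ^ 2
          + 1 / 3 * (deriv ψ x + r * φ x) ^ 2))

/-- The constraint functional `J(φ, ψ)`. -/
def constraintJ (φ ψ : ℝ → ℝ) : ℝ :=
  1 / 2 * ∫ x in (-D.m)..D.ℓ, D.rho0 x * (φ x ^ 2 + ψ x ^ 2)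

/-- The constraint set `𝒜`. -/
def constraintSet : Set ((ℝ → ℝ) × (ℝ → ℝ)) :=
  {p | D.MemH01 p.1 ∧ D.MemH01 p.2 ∧ D.constraintJ p.1 p.2 = 1}

/-- `μ(s) = inf_𝒜 E(·, ·; s)` at frequency modulus `r`. -/
def mu (r s : ℝ) : ℝ := sInf ((fun p => D.energy r s p.1 p.2) '' D.constraintSet)

/-- `0 < r < |ξ|_c`, where `|ξ|_c = √(g ⟦ρ₀⟧ / σ)`, and `|ξ|_c = ∞` if `σ = 0`. -/
def IsUnstable (r : ℝ) : Prop := 0 < r ∧ D.σ * r ^ 2 < D.g * D.jumpRho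

/-- `s > 0` satisfies `μ(s) < 0` and `s = λ(r, s) = √(-μ(s))`. -/
def IsFixedRate (r s : ℝ) : Prop := 0 < s ∧ D.mu r s < 0 ∧ s = √(-D.mu r s)

/-- The growth rate `λ(r)`: the `s` with `IsFixedRate r s` (the theorem asserts that there is
exactly one, if `0 < r < |ξ|_c`). -/
def growthRate (r : ℝ) : ℝ := sSup {s | D.IsFixedRate r s}

/-- A choice, for every `0 < r < |ξ|_c`, of a minimizer `(φ_s(r, ·), ψ_s(r, ·)) ∈ 𝒜` of `E(·, ·; s)`
at `s = λ(r)`. -/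
def IsModeFamily (Φ Ψ : ℝ → ℝ → ℝ) : Prop :=
  ∀ r, D.IsUnstable r → (Φ r, Ψ r) ∈ D.constraintSet ∧
    D.energy r (D.growthRate r) (Φ r) (Ψ r) = D.mu r (D.growthRate r)

end FluidData

/-! ### Horizontal frequencies and the largest growth rate -/

/-- `ξ ∈ (L⁻¹ ℤ)²`. -/
def IsLattice (L : ℝ) (ξ : EuclideanSpace ℝ (Fin 2)) : Prop :=
  ∃ n : Fin 2 → ℤ, ∀ i, ξ i = n i / L

namespace FluidData

variable (D : FluidData)

/-- `{λ(|ξ|) : ξ ∈ (L⁻¹ ℤ)², 0 < |ξ| < |ξ|_c}`. -/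
def latticeRates (L : ℝ) : Set ℝ :=
  {a | ∃ ξ, IsLattice L ξ ∧ D.IsUnstable ‖ξ‖ ∧ a = D.growthRate ‖ξ‖}

/-- `Λ_L`. -/
def maxRate (L : ℝ) : ℝ := sSup (D.latticeRates L)

end FluidData

/-! ### The normal modes -/

/-- `φ(ξ, x₃)`: the first component of `R⁻¹(φ_s(|ξ|, x₃), 0)`, where `R ξ = (|ξ|, 0)`. -/
def phi (Φ : ℝ → ℝ → ℝ) (ξ : EuclideanSpace ℝ (Fin 2)) (x₃ : ℝ) : ℝ := ξ 0 / ‖ξ‖ * Φ ‖ξ‖ x₃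

/-- `θ(ξ, x₃)`: the second component of `R⁻¹(φ_s(|ξ|, x₃), 0)`, where `R ξ = (|ξ|, 0)`. -/
def theta (Φ : ℝ → ℝ → ℝ) (ξ : EuclideanSpace ℝ (Fin 2)) (x₃ : ℝ) : ℝ := ξ 1 / ‖ξ‖ * Φ ‖ξ‖ x₃

/-- `ψ(ξ, x₃)`. -/
def psi (Ψ : ℝ → ℝ → ℝ) (ξ : EuclideanSpace ℝ (Fin 2)) (x₃ : ℝ) : ℝ := Ψ ‖ξ‖ x₃

/-- `ŵ(ξ, x₃) = -i φ e₁ - i θ e₂ + ψ e₃`. -/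
def wHat (Φ Ψ : ℝ → ℝ → ℝ) (ξ : EuclideanSpace ℝ (Fin 2)) (x₃ : ℝ) : Fin 3 → ℂ :=
  ![-Complex.I * (phi Φ ξ x₃ : ℂ), -Complex.I * (theta Φ ξ x₃ : ℂ), (psi Ψ ξ x₃ : ℂ)]

/-- The horizontal wave `e^{i x' · ξ}`. -/
def wave (ξ : EuclideanSpace ℝ (Fin 2)) (x : Fin 3 → ℝ) : ℂ :=
  Complex.exp (Complex.I * ((x 0 * ξ 0 + x 1 * ξ 1 : ℝ) : ℂ))

/-- The displacement `η(x, t)` built from the frequencies `ξ₁, ξ₂` and the rate `Λ`. -/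
def etaField (Φ Ψ : ℝ → ℝ → ℝ) (Λ : ℝ) (ξ : Fin 2 → EuclideanSpace ℝ (Fin 2))
    (t : ℝ) (x : Fin 3 → ℝ) (i : Fin 3) : ℂ :=
  (Real.exp (Λ * t) : ℂ) * ∑ j, wHat Φ Ψ (ξ j) (x 2) i * wave (ξ j) x

/-- The velocity `v(x, t)`. -/
def vField (Φ Ψ : ℝ → ℝ → ℝ) (Λ : ℝ) (ξ : Fin 2 → EuclideanSpace ℝ (Fin 2))
    (t : ℝ) (x : Fin 3 → ℝ) (i : Fin 3) : ℂ :=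
  (Λ : ℂ) * (Real.exp (Λ * t) : ℂ) * ∑ j, wHat Φ Ψ (ξ j) (x 2) i * wave (ξ j) x

/-- The density perturbation `q(x, t)`. -/
def qField (D : FluidData) (Φ Ψ : ℝ → ℝ → ℝ) (Λ : ℝ) (ξ : Fin 2 → EuclideanSpace ℝ (Fin 2))
    (t : ℝ) (x : Fin 3 → ℝ) : ℂ :=
  -(Real.exp (Λ * t) : ℂ) * (D.rho0 (x 2) : ℂ) *
    ∑ j, ((ξ j 0 * phi Φ (ξ j) (x 2) + ξ j 1 * theta Φ (ξ j) (x 2)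
      + deriv (psi Ψ (ξ j)) (x 2) : ℝ) : ℂ) * wave (ξ j) x

/-! ### The linearized problem -/

/-- Spatial partial derivative `∂_j`. -/
def pd (j : Fin 3) (f : (Fin 3 → ℝ) → ℂ) (x : Fin 3 → ℝ) : ℂ := lineDeriv ℝ f x (Pi.single j 1)

/-- Time derivative on `[0, ∞)`, one-sided at `t = 0`. -/
def dt (f : ℝ → ℂ) (t : ℝ) : ℂ := derivWithin f (Ici 0) t

/-- Divergence. -/
def diverge (v : (Fin 3 → ℝ) → Fin 3 → ℂ) (x : Fin 3 → ℝ) : ℂ := ∑ j, pd j (fun y => v y j) x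

/-- Kronecker delta. -/
def kron (i j : Fin 3) : ℂ := if i = j then 1 else 0

namespace FluidData

variable (D : FluidData)

/-- The lower layer `Ω₋ = {-m < x₃ < 0}`. -/
def domainLower : Set (Fin 3 → ℝ) := {x | x 2 ∈ Ioo (-D.m) 0}

/-- The upper layer `Ω₊ = {0 < x₃ < ℓ}`. -/
def domainUpper : Set (Fin 3 → ℝ) := {x | x 2 ∈ Ioo 0 D.ℓ}

/-- The closed slab `{-m ≤ x₃ ≤ ℓ}`. -/
def closedSlab : Set (Fin 3 → ℝ) := {x | x 2 ∈ Icc (-D.m) D.ℓ}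

/-- The viscous stress `ε₀ (Dv + Dvᵀ - (2/3) (div v) I) + δ₀ (div v) I`, entry `(i, j)`. -/
def viscousStress (v : (Fin 3 → ℝ) → Fin 3 → ℂ) (i j : Fin 3) (x : Fin 3 → ℝ) : ℂ :=
  (D.eps0 (x 2) : ℂ) *
      (pd j (fun y => v y i) x + pd i (fun y => v y j) x - 2 / 3 * diverge v x * kron i j)
    + (D.del0 (x 2) : ℂ) * diverge v x * kron i j

/-- `⟦f⟧ = c` at the interface point `(x₁, x₂, 0)`: the traces of `f` from the two layers exist
and their difference, upper minus lower, is `c`. -/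
def HasJump (f : (Fin 3 → ℝ) → ℂ) (x₁ x₂ : ℝ) (c : ℂ) : Prop :=
  ∃ a b : ℂ, Tendsto f (𝓝[D.domainUpper] ![x₁, x₂, 0]) (𝓝 a) ∧
    Tendsto f (𝓝[D.domainLower] ![x₁, x₂, 0]) (𝓝 b) ∧ a - b = c

/-- `(η, v, q)` is a classical solution for `t ≥ 0`, `2πL`-periodic in `x₁` and `x₂`, of the
linearized equations, with the jump conditions at the interface and the no-slip condition at the
rigid boundaries. -/
structure IsLinearSolution (L : ℝ) (η v : ℝ → (Fin 3 → ℝ) → Fin 3 → ℂ)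
    (q : ℝ → (Fin 3 → ℝ) → ℂ) : Prop where
  /-- horizontal periodicity -/
  periodic : ∀ t ≥ 0, ∀ x : Fin 3 → ℝ, ∀ j : Fin 3, j ≠ 2 →
    η t (x + Pi.single j (2 * Real.pi * L)) = η t x ∧
    v t (x + Pi.single j (2 * Real.pi * L)) = v t x ∧
    q t (x + Pi.single j (2 * Real.pi * L)) = q t x
  /-- smoothness in each layer -/
  smooth_η : ∀ i, ContDiffOn ℝ ∞ (fun p : ℝ × (Fin 3 → ℝ) => η p.1 p.2 i)
    (Ici 0 ×ˢ (D.domainLower ∪ D.domainUpper))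
  smooth_v : ∀ i, ContDiffOn ℝ ∞ (fun p : ℝ × (Fin 3 → ℝ) => v p.1 p.2 i)
    (Ici 0 ×ˢ (D.domainLower ∪ D.domainUpper))
  smooth_q : ContDiffOn ℝ ∞ (fun p : ℝ × (Fin 3 → ℝ) => q p.1 p.2)
    (Ici 0 ×ˢ (D.domainLower ∪ D.domainUpper))
  /-- continuity up to and across the horizontal boundaries -/
  continuous_η : ∀ i, ContinuousOn (fun p : ℝ × (Fin 3 → ℝ) => η p.1 p.2 i)
    (Ici 0 ×ˢ D.closedSlab)
  continuous_v : ∀ i, ContinuousOn (fun p : ℝ × (Fin 3 → ℝ) => v p.1 p.2 i)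
    (Ici 0 ×ˢ D.closedSlab)
  /-- smoothness of `η₃` along the interface -/
  smooth_interface : ∀ t ≥ 0, ContDiff ℝ ∞ (fun y : Fin 2 → ℝ => η t ![y 0, y 1, 0] 2)
  /-- `∂ₜ η = v` -/
  eq_η : ∀ t ≥ 0, ∀ x ∈ D.domainLower ∪ D.domainUpper, ∀ i,
    dt (fun τ => η τ x i) t = v t x i
  /-- `∂ₜ q + ρ₀ div v = 0` -/
  eq_q : ∀ t ≥ 0, ∀ x ∈ D.domainLower ∪ D.domainUpper,
    dt (fun τ => q τ x) t + (D.rho0 (x 2) : ℂ) * diverge (v t) x = 0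
  /-- `ρ₀ ∂ₜ v + ∇(P'(ρ₀) q) + g q e₃ + g ρ₀ ∇η₃ = div (viscous stress)` -/
  eq_v : ∀ t ≥ 0, ∀ x ∈ D.domainLower ∪ D.domainUpper, ∀ i,
    (D.rho0 (x 2) : ℂ) * dt (fun τ => v τ x i) t
        + pd i (fun y => (D.dP0 (y 2) : ℂ) * q t y) x
        + (D.g : ℂ) * q t x * kron i 2
        + (D.g : ℂ) * (D.rho0 (x 2) : ℂ) * pd i (fun y => η t y 2) x
      = ∑ j, pd j (D.viscousStress (v t) i j) x
  /-- `⟦η⟧ = 0` -/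
  jump_η : ∀ t ≥ 0, ∀ x₁ x₂ : ℝ, ∀ i, D.HasJump (fun x => η t x i) x₁ x₂ 0
  /-- `⟦v⟧ = 0` -/
  jump_v : ∀ t ≥ 0, ∀ x₁ x₂ : ℝ, ∀ i, D.HasJump (fun x => v t x i) x₁ x₂ 0
  /-- `⟦P'(ρ₀) q I - ε₀ (Dv + Dvᵀ) - (δ₀ - 2ε₀/3) (div v) I⟧ e₃ = σ Δ_{x₁,x₂} η₃ e₃` -/
  jump_stress : ∀ t ≥ 0, ∀ x₁ x₂ : ℝ, ∀ i,
    D.HasJump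
      (fun x => (D.dP0 (x 2) : ℂ) * q t x * kron i 2 - D.viscousStress (v t) i 2 x) x₁ x₂
      ((D.σ : ℂ) *
        (pd 0 (pd 0 (fun y => η t y 2)) ![x₁, x₂, 0] + pd 1 (pd 1 (fun y => η t y 2)) ![x₁, x₂, 0])
        * kron i 2)
  /-- `v = 0` at `x₃ = -m` and at `x₃ = ℓ` -/
  no_slip : ∀ t ≥ 0, ∀ x₁ x₂ : ℝ, v t ![x₁, x₂, -D.m] = 0 ∧ v t ![x₁, x₂, D.ℓ] = 0

end FluidData

/-! ### Piecewise Sobolev spaces of periodic functions -/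

/-- The horizontal Fourier coefficient
`f̂(ξ, x₃) = ∫_{(0, 2πL)²} f(x', x₃) e^{-i x' · ξ} dx'` of a horizontally `2πL`-periodic function. -/
def horizFourier (L : ℝ) (f : (Fin 3 → ℝ) → ℂ) (ξ : EuclideanSpace ℝ (Fin 2)) (x₃ : ℝ) : ℂ :=
  ∫ x₁ in (0 : ℝ)..(2 * Real.pi * L), ∫ x₂ in (0 : ℝ)..(2 * Real.pi * L),
    f ![x₁, x₂, x₃] * Complex.exp (-Complex.I * ((x₁ * ξ 0 + x₂ * ξ 1 : ℝ) : ℂ))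

/-- `w` is the `j`-th weak derivative of `u` on the open interval `S`. -/
def IsWeakDeriv (j : ℕ) (S : Set ℝ) (u w : ℝ → ℂ) : Prop :=
  LocallyIntegrableOn u S ∧ LocallyIntegrableOn w S ∧
    ∀ χ : ℝ → ℝ, ContDiff ℝ ∞ χ → HasCompactSupport χ → tsupport χ ⊆ S →
      ∫ x in S, ((iteratedDeriv j χ x : ℝ) : ℂ) * u x = (-1) ^ j * ∫ x in S, (χ x : ℂ) * w x

/-- `‖∂^j u‖²_{L²(S)}`. The weak derivative is unique up to null sets, so that the infimum is over
equal numbers; it is `∞` if there is no `j`-th weak derivative. -/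
def weakDerivNormSq (j : ℕ) (S : Set ℝ) (u : ℝ → ℂ) : ℝ≥0∞ :=
  ⨅ (w : ℝ → ℂ) (_ : IsWeakDeriv j S u w), ∫⁻ x in S, ‖w x‖ₑ ^ 2

/-- The point `n / L` of `(L⁻¹ ℤ)²`. -/
def latticePoint (L : ℝ) (n : Fin 2 → ℤ) : EuclideanSpace ℝ (Fin 2) :=
  WithLp.toLp 2 (fun i => (n i : ℝ) / L)

/-- The squared `H^k` norm on the layer `(2πL𝕋)² × S`,
`∑_{j ≤ k} ∑_{ξ ∈ (L⁻¹ℤ)²} (1 + |ξ|²)^(k - j) ‖∂₃^j f̂(ξ, ·)‖²_{L²(S)}`. -/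
def layerNormSq (L : ℝ) (k : ℕ) (S : Set ℝ) (f : (Fin 3 → ℝ) → ℂ) : ℝ≥0∞ :=
  ∑ j ∈ Finset.range (k + 1), ∑' n : Fin 2 → ℤ,
    ENNReal.ofReal ((1 + ‖latticePoint L n‖ ^ 2) ^ (k - j)) *
      weakDerivNormSq j S (horizFourier L f (latticePoint L n))

namespace FluidData

variable (D : FluidData)

/-- The squared piecewise `H^k` norm: the sum over the two layers. -/
def sobolevNormSq (L : ℝ) (k : ℕ) (f : (Fin 3 → ℝ) → ℂ) : ℝ≥0∞ :=
  layerNormSq L k (Ioo 0 D.ℓ) f + layerNormSq L k (Ioo (-D.m) 0) f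

/-- One period cell of the slab. -/
def periodCell (L : ℝ) : Set (Fin 3 → ℝ) :=
  {x | x 0 ∈ Ioo 0 (2 * Real.pi * L) ∧ x 1 ∈ Ioo 0 (2 * Real.pi * L) ∧ x 2 ∈ Ioo (-D.m) D.ℓ}

/-- Membership of a vector-valued function, given by its components, in the piecewise Sobolev space
`H^k(Ω)`. -/
def MemHk {d : ℕ} (L : ℝ) (k : ℕ) (f : (Fin 3 → ℝ) → Fin d → ℂ) : Prop :=
  ∀ i, MemLp (fun x => f x i) 2 (volume.restrict (D.periodCell L)) ∧
    D.sobolevNormSq L k (fun x => f x i) < ⊤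

/-- The piecewise `H^k` norm of a vector-valued function. -/
def hkNorm {d : ℕ} (L : ℝ) (k : ℕ) (f : (Fin 3 → ℝ) → Fin d → ℂ) : ℝ :=
  √(∑ i, (D.sobolevNormSq L k (fun x => f x i)).toReal)

end FluidData

end RayleighTaylor

end

open RayleighTaylor

namespace RayleighTaylor

/-! ### The space `H¹₀((a, b))` -/

/-! A mode `e^{st} ŵ(x₃) e^{ix'·ξ}` reduces the linearized problem to a system of ODEs in `x₃` in
which the viscosities carry a factor `s`. Because of that factor the growth rate is not directly an
eigenvalue. If `s` is frozen in the viscosities, however, the system is the Euler–Lagrange equation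
of `E_r(·; s)` under the mass constraint, with multiplier `μ_r(s)`. The true modes sit where `μ_r(s)
= -s²`.

Minimizers. Up to the exact derivative `-2r(φψ)'`, the shear terms dominate the `H¹` norm, and
gravity is controlled by the mass (`le_B`). Hence `B - μM` is a nonnegative form that controls the
Dirichlet integral modulo mass. The parallelogram identity and Rellich's theorem make a minimizing
sequence Cauchy in `H¹₀` (`exists_minimizer`). A null vector of a nonnegative form lies in its
radical by Cauchy–Schwarz, which is the weak Euler–Lagrange equation (`weak_euler_lagrange`).

The rate. As an infimum of nondecreasing affine functions of `s`, `μ_r` is nondecreasing and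
concave, hence continuous. A divergence-free pair concentrated at the interface makes `μ_r` negative
for small `s`, because `g⟦ρ₀⟧ > σr²` (`exists_test_pair`). Since `μ_r ≥ -gr`, the strictly
increasing function `s² + μ_r(s)` has exactly one zero (`existsUnique_isFixedRate`). Coercivity
improves the bound to `μ_r(s) ≥ c r² - gr` with `c > 0` depending on `s`, so fast rates cannot occur
at large `r`. Only finitely many lattice points then compete for `Λ_L` (`isGreatest_maxRate`).

The interface. Hydrostatic balance and completion of a square give `B(u,u) ≥ (σr² - g⟦ρ₀⟧) ψ(0)²`
(`interface_le_B`), so a minimizer with negative energy has `ψ(0) ≠ 0`.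

Regularity. By du Bois-Reymond the fluxes have continuous representatives, apart from a jump
`σr²ψ(0)` of the vertical one. In each layer `(φ, ψ, f₁, f₂)` solves a first-order system with
smooth coefficients and is smooth up to the boundary (`layerSolution_of_integral`,
`isNormalMode_of_minimizer`).

The solution. The fluxes are, up to the pressure, the tangential and normal stresses of the mode, so
the flux equations become the momentum equation and the flux jump becomes the surface tension
condition (`isLinearSolution`). Opposite frequencies make the fields real. All fields are `e^{Λt}`
times a fixed profile with finitely many Fourier modes, so homogeneity of the norms gives the exact
growth (`memHk_and_hkNorm_eq`). -/

/-- Lebesgue measure on the open interval `(a, b)`. -/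
noncomputable abbrev ivol (a b : ℝ) : Measure ℝ := volume.restrict (Ioo a b)

lemma intervalIntegral_eq_ivol {a b : ℝ} (hab : a ≤ b) (f : ℝ → ℝ) :
    ∫ x in a..b, f x = ∫ x, f x ∂ivol a b := by
  rw [intervalIntegral.integral_of_le hab, integral_Ioc_eq_integral_Ioo]

lemma intervalIntegrable_iff_ivol {a b : ℝ} (hab : a ≤ b) (f : ℝ → ℝ) :
    IntervalIntegrable f volume a b ↔ Integrable f (ivol a b) := by
  rw [intervalIntegrable_iff_integrableOn_Ioo_of_le hab, IntegrableOn]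

lemma ae_ivol_of_ae_uIcc {a b : ℝ} (hab : a ≤ b) {p : ℝ → Prop}
    (h : ∀ᵐ x, x ∈ uIcc a b → p x) : ∀ᵐ x ∂ivol a b, p x := by
  rw [ae_restrict_iff' measurableSet_Ioo]
  filter_upwards [h] with x hx hx'
  exact hx (by rw [uIcc_of_le hab]; exact Ioo_subset_Icc_self hx')

/-- Cauchy–Schwarz for real integrals. -/
lemma sq_integral_mul_le {α : Type*} [MeasurableSpace α] {μ : Measure α} {f g : α → ℝ}
    (hf : MemLp f 2 μ) (hg : MemLp g 2 μ) :
    (∫ x, f x * g x ∂μ) ^ 2 ≤ (∫ x, f x ^ 2 ∂μ) * ∫ x, g x ^ 2 ∂μ := by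
  have hfg : Integrable (fun x => f x * g x) μ := hf.integrable_mul hg
  -- The quadratic `t ↦ ∫ (f + tg)²` is nonnegative, so its discriminant is nonpositive.
  have key : ∀ t : ℝ, 0 ≤ (∫ x, g x ^ 2 ∂μ) * (t * t) + (2 * ∫ x, f x * g x ∂μ) * t
      + ∫ x, f x ^ 2 ∂μ := by
    intro t
    have h1 : ∫ x, (f x + t * g x) ^ 2 ∂μ = (∫ x, g x ^ 2 ∂μ) * (t * t)
        + (2 * ∫ x, f x * g x ∂μ) * t + ∫ x, f x ^ 2 ∂μ := by
      have : ∀ x, (f x + t * g x) ^ 2 = (t * t) * g x ^ 2 + (2 * t) * (f x * g x) + f x ^ 2 := by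
        intro x; ring
      simp_rw [this]
      have hi : Integrable (fun x => (t * t) * g x ^ 2 + (2 * t) * (f x * g x)) μ :=
        (hg.integrable_sq.const_mul _).add (hfg.const_mul _)
      rw [integral_add hi hf.integrable_sq, integral_add (hg.integrable_sq.const_mul _) (hfg.const_mul _), integral_const_mul,
        integral_const_mul]
      ring
    rw [← h1]
    exact integral_nonneg fun x => sq_nonneg _
  have := discrim_le_zero key
  rw [discrim] at this
  nlinarith

lemma deriv_add_ae {a b : ℝ} (hab : a ≤ b) {f g : ℝ → ℝ}
    (hf : AbsolutelyContinuousOnInterval f a b) (hg : AbsolutelyContinuousOnInterval g a b) :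
    deriv (f + g) =ᵐ[ivol a b] deriv f + deriv g := by
  filter_upwards [ae_ivol_of_ae_uIcc hab hf.ae_differentiableAt,
    ae_ivol_of_ae_uIcc hab hg.ae_differentiableAt] with x hx hx'
  exact deriv_add hx hx'

lemma deriv_smul_ae {a b : ℝ} (hab : a ≤ b) (c : ℝ) {f : ℝ → ℝ}
    (hf : AbsolutelyContinuousOnInterval f a b) :
    deriv (c • f) =ᵐ[ivol a b] c • deriv f := by
  filter_upwards [ae_ivol_of_ae_uIcc hab hf.ae_differentiableAt] with x hx
  exact deriv_const_smul c hx

/-- The space `H¹₀((a, b))`, through absolutely continuous representatives. -/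
def H10 (a b : ℝ) (hab : a < b) : Submodule ℝ (ℝ → ℝ) where
  carrier := {f | AbsolutelyContinuousOnInterval f a b ∧
    MemLp (deriv f) 2 (volume.restrict (Ioo a b)) ∧ f a = 0 ∧ f b = 0}
  add_mem' := by
    rintro f g ⟨h1, h2, h3, h4⟩ ⟨k1, k2, k3, k4⟩
    refine ⟨h1.add k1, (h2.add k2).ae_eq (deriv_add_ae hab.le h1 k1).symm, ?_, ?_⟩ <;>
      simp [h3, h4, k3, k4]
  zero_mem' := by
    refine ⟨?_, ?_, rfl, rfl⟩
    · exact (contDiff_zero_fun (𝕜 := ℝ) (n := 1)).contDiffOn.absolutelyContinuousOnInterval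
    · have : deriv (0 : ℝ → ℝ) = 0 := by ext x; simp
      rw [this]
      exact MemLp.zero
  smul_mem' := by
    rintro c f ⟨h1, h2, h3, h4⟩
    refine ⟨h1.const_smul c, (h2.const_smul c).ae_eq (deriv_smul_ae hab.le c h1).symm, ?_, ?_⟩ <;>
      simp [h3, h4]

section H10

variable {a b : ℝ} {hab : a < b}

lemma H10.ac {f : ℝ → ℝ} (hf : f ∈ H10 a b hab) : AbsolutelyContinuousOnInterval f a b := hf.1

lemma H10.memLp_deriv {f : ℝ → ℝ} (hf : f ∈ H10 a b hab) : MemLp (deriv f) 2 (ivol a b) := hf.2.1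

lemma H10.left {f : ℝ → ℝ} (hf : f ∈ H10 a b hab) : f a = 0 := hf.2.2.1

lemma H10.right {f : ℝ → ℝ} (hf : f ∈ H10 a b hab) : f b = 0 := hf.2.2.2

lemma H10.continuousOn {f : ℝ → ℝ} (hf : f ∈ H10 a b hab) : ContinuousOn f (Icc a b) := by
  have := hf.1.continuousOn
  rwa [uIcc_of_le hab.le] at this

lemma _root_.ContinuousOn.memLp_ivol {f : ℝ → ℝ} (hf : ContinuousOn f (Icc a b)) (p : ℝ≥0∞) :
    MemLp f p (ivol a b) := by
  obtain ⟨C, hC⟩ := isCompact_Icc.exists_bound_of_continuousOn hf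
  refine MemLp.of_bound ((hf.mono Ioo_subset_Icc_self).aestronglyMeasurable measurableSet_Ioo) C ?_
  exact (ae_restrict_iff' measurableSet_Ioo).2 (ae_of_all _ fun x hx =>
    hC x (Ioo_subset_Icc_self hx))

lemma H10.memLp {f : ℝ → ℝ} (hf : f ∈ H10 a b hab) : MemLp f 2 (ivol a b) :=
  (H10.continuousOn hf).memLp_ivol 2

lemma H10.integral_deriv {f : ℝ → ℝ} (hf : f ∈ H10 a b hab) {x y : ℝ} (hx : x ∈ Icc a b)
    (hy : y ∈ Icc a b) : ∫ t in x..y, deriv f t = f y - f x := by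
  refine (hf.1.mono ?_).integral_deriv_eq_sub
  rw [uIcc_of_le hab.le]
  exact uIcc_subset_Icc hx hy

/-- The Dirichlet integral `∫ f'²`. -/
noncomputable def dirichlet (a b : ℝ) (f : ℝ → ℝ) : ℝ := ∫ x, deriv f x ^ 2 ∂ivol a b

lemma dirichlet_nonneg (f : ℝ → ℝ) : 0 ≤ dirichlet a b f := integral_nonneg fun _ => sq_nonneg _

/-- Cauchy–Schwarz applied to `f y - f x = ∫ f' · 1`. This Hölder-½ bound supplies both the sup
bound and the equicontinuity in Rellich's theorem. -/
lemma H10.sq_sub_le {f : ℝ → ℝ} (hf : f ∈ H10 a b hab) {x y : ℝ} (hx : x ∈ Icc a b)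
    (hy : y ∈ Icc a b) : (f y - f x) ^ 2 ≤ |y - x| * dirichlet a b f := by
  wlog hxy : x ≤ y generalizing x y
  · have := this hy hx (le_of_not_ge hxy)
    rw [abs_sub_comm]
    nlinarith
  have hsub : Ioo x y ⊆ Ioo a b := Ioo_subset_Ioo hx.1 hy.2
  have hm : MemLp (deriv f) 2 (ivol x y) :=
    (H10.memLp_deriv hf).mono_measure (Measure.restrict_mono hsub le_rfl)
  have h1 : f y - f x = ∫ t, deriv f t * 1 ∂ivol x y := by
    rw [← H10.integral_deriv hf hx hy, intervalIntegral_eq_ivol hxy]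
    simp
  have h2 := sq_integral_mul_le hm (memLp_const (μ := ivol x y) (p := 2) (1 : ℝ))
  rw [← h1] at h2
  have h3 : ∫ t, (1 : ℝ) ^ 2 ∂ivol x y = |y - x| := by
    simp [Real.volume_real_Ioo_of_le hxy, abs_of_nonneg (sub_nonneg.2 hxy)]
  rw [h3] at h2
  have h4 : ∫ t, deriv f t ^ 2 ∂ivol x y ≤ dirichlet a b f :=
    setIntegral_mono_set (H10.memLp_deriv hf).integrable_sq
      (ae_of_all _ fun _ => sq_nonneg _) hsub.eventuallyLE
  nlinarith [abs_nonneg (y - x)]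

lemma H10.sq_le {f : ℝ → ℝ} (hf : f ∈ H10 a b hab) {x : ℝ} (hx : x ∈ Icc a b) :
    f x ^ 2 ≤ (b - a) * dirichlet a b f := by
  have h := H10.sq_sub_le hf (left_mem_Icc.2 hab.le) hx
  rw [H10.left hf, sub_zero, abs_of_nonneg (sub_nonneg.2 hx.1)] at h
  exact h.trans (mul_le_mul_of_nonneg_right (by linarith [hx.2]) (dirichlet_nonneg f))

lemma H10.integral_sq_le {f : ℝ → ℝ} (hf : f ∈ H10 a b hab) :
    ∫ x, f x ^ 2 ∂ivol a b ≤ (b - a) ^ 2 * dirichlet a b f := by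
  calc ∫ x, f x ^ 2 ∂ivol a b ≤ ∫ x, (b - a) * dirichlet a b f ∂ivol a b := by
        refine integral_mono_ae (H10.memLp hf).integrable_sq (integrable_const _) ?_
        exact (ae_restrict_iff' measurableSet_Ioo).2 (ae_of_all _ fun x hx =>
          H10.sq_le hf (Ioo_subset_Icc_self hx))
    _ = (b - a) ^ 2 * dirichlet a b f := by
        simp [Real.volume_real_Ioo_of_le hab.le]; ring

/-- The primitive of an `L²` function of mean zero lies in `H¹₀`. -/
lemma primitive_mem_H10 {w : ℝ → ℝ} (hw : MemLp w 2 (ivol a b)) (h0 : ∫ x, w x ∂ivol a b = 0) :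
    (fun x => ∫ t in a..x, w t) ∈ H10 a b hab ∧
      deriv (fun x => ∫ t in a..x, w t) =ᵐ[ivol a b] w := by
  have hi : IntervalIntegrable w volume a b :=
    (intervalIntegrable_iff_ivol hab.le w).2 (hw.integrable one_le_two)
  have hd : deriv (fun x => ∫ t in a..x, w t) =ᵐ[ivol a b] w := by
    refine ae_ivol_of_ae_uIcc hab.le ?_
    filter_upwards [hi.ae_hasDerivAt_integral] with x hx hx'
    exact (hx hx' a left_mem_uIcc).deriv
  refine ⟨⟨hi.absolutelyContinuousOnInterval_intervalIntegral left_mem_uIcc,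
    hw.ae_eq hd.symm, by simp, ?_⟩, hd⟩
  change ∫ t in a..b, w t = 0
  rw [intervalIntegral_eq_ivol hab.le, h0]

/-- `H¹₀` is complete. -/
lemma H10.complete (f : ℕ → ℝ → ℝ) (hf : ∀ n, f n ∈ H10 a b hab)
    (hc : ∀ ε > 0, ∃ N, ∀ n ≥ N, ∀ k ≥ N, dirichlet a b (f n - f k) < ε) :
    ∃ g ∈ H10 a b hab, Tendsto (fun n => dirichlet a b (f n - g)) atTop (𝓝 0) := by
  set w : ℕ → Lp ℝ 2 (ivol a b) := fun n => (H10.memLp_deriv (hf n)).toLp _ with hw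
  -- Differentiation is an isometry into `L²`, which is complete. Allowing any representative `z` of
  -- `v'` lets the same identity serve for the sequence and for its limit.
  have hnorm : ∀ u v : ℝ → ℝ, u ∈ H10 a b hab → v ∈ H10 a b hab → ∀ (z : ℝ → ℝ)
      (hz : MemLp z 2 (ivol a b)), deriv v =ᵐ[ivol a b] z → ∀ hu : MemLp (deriv u) 2 (ivol a b),
      ‖hu.toLp _ - hz.toLp _‖ ^ 2 = dirichlet a b (u - v) := by
    intro u v hu' hv z hz hzv hu
    rw [← MemLp.toLp_sub hu hz, ← real_inner_self_eq_norm_sq, L2.inner_def, dirichlet]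
    refine integral_congr_ae ?_
    have e1 := deriv_add_ae hab.le (H10.ac hu') (H10.ac (Submodule.smul_mem _ (-1) hv))
    have e2 := deriv_smul_ae hab.le (-1) (H10.ac hv)
    have e3 : u - v = u + (-1 : ℝ) • v := by simp [sub_eq_add_neg]
    rw [e3]
    filter_upwards [e1, e2, hzv, MemLp.coeFn_toLp (hu.sub hz)] with x h1 h2 h3 h4
    simp only [real_inner_self_eq_norm_sq, h4, Real.norm_eq_abs, sq_abs]
    rw [h1, Pi.add_apply, h2, Pi.sub_apply, Pi.smul_apply, h3]
    simp only [smul_eq_mul]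
    ring
  have hcauchy : CauchySeq w := by
    rw [Metric.cauchySeq_iff]
    intro ε hε
    obtain ⟨N, hN⟩ := hc (ε ^ 2) (by positivity)
    refine ⟨N, fun n hn k hk => ?_⟩
    have := hN n hn k hk
    rw [← hnorm (f n) (f k) (hf n) (hf k) _ (H10.memLp_deriv (hf k)) EventuallyEq.rfl
      (H10.memLp_deriv (hf n))] at this
    rw [dist_eq_norm]
    exact lt_of_pow_lt_pow_left₀ 2 hε.le this
  obtain ⟨z, hz⟩ := cauchySeq_tendsto_of_complete hcauchy
  have hz2 : MemLp z 2 (ivol a b) := Lp.memLp z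
  have hzt : hz2.toLp _ = z := Lp.toLp_coeFn z hz2
  -- Mean zero is orthogonality to the constant `1`, hence survives the `L²` limit. It is what makes
  -- the primitive of `z` vanish at `b`.
  have h0 : ∫ x, z x ∂ivol a b = 0 := by
    have hone : MemLp (fun _ : ℝ => (1 : ℝ)) 2 (ivol a b) := memLp_const 1
    have h1 : ∀ u : Lp ℝ 2 (ivol a b), inner ℝ (hone.toLp _) u = ∫ x, u x ∂ivol a b := by
      intro u
      rw [L2.inner_def]
      refine integral_congr_ae ?_
      filter_upwards [MemLp.coeFn_toLp hone] with x hx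
      rw [hx, real_inner_comm, real_inner_eq_re_inner]
      simp
    have h2 : Tendsto (fun n => inner ℝ (hone.toLp _) (w n)) atTop (𝓝 (inner ℝ (hone.toLp _) z)) :=
      ((continuous_const.inner continuous_id).tendsto z).comp hz
    have h3 : ∀ n, inner ℝ (hone.toLp _) (w n) = 0 := by
      intro n
      rw [h1]
      have := H10.integral_deriv (hf n) (left_mem_Icc.2 hab.le) (right_mem_Icc.2 hab.le)
      rw [H10.left (hf n), H10.right (hf n), intervalIntegral_eq_ivol hab.le, sub_zero] at this
      rw [← this]
      exact integral_congr_ae (MemLp.coeFn_toLp _)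
    simp_rw [h3] at h2
    rw [← h1]
    exact (tendsto_nhds_unique h2 tendsto_const_nhds)
  obtain ⟨hg, hgd⟩ := primitive_mem_H10 (hab := hab) hz2 h0
  refine ⟨_, hg, ?_⟩
  have h5 : ∀ n, dirichlet a b (f n - fun x => ∫ t in a..x, z t) = ‖w n - z‖ ^ 2 := by
    intro n
    rw [← hnorm (f n) _ (hf n) hg z hz2 hgd (H10.memLp_deriv (hf n)), hzt]
  simp_rw [h5]
  have := (tendsto_iff_norm_sub_tendsto_zero.1 hz).pow 2
  simpa using this

/-- Rellich: a sequence bounded in `H¹₀` has a uniformly Cauchy subsequence. -/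
lemma H10.exists_subseq (f : ℕ → ℝ → ℝ) (hf : ∀ n, f n ∈ H10 a b hab) (K : ℝ)
    (hK : ∀ n, dirichlet a b (f n) ≤ K) :
    ∃ s : ℕ → ℕ, StrictMono s ∧ ∀ ε > 0, ∃ N, ∀ n ≥ N, ∀ k ≥ N, ∀ x ∈ Icc a b,
      |f (s n) x - f (s k) x| < ε := by
  have hK0 : 0 ≤ K := (dirichlet_nonneg _).trans (hK 0)
  let F : ℕ → BoundedContinuousFunction (Icc a b) ℝ := fun n =>
    BoundedContinuousFunction.mkOfCompact
      ⟨(Icc a b).domRestrict (f n), (H10.continuousOn (hf n)).domRestrict⟩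
  have hbd : ∀ n, ∀ x ∈ Icc a b, |f n x| ≤ √((b - a) * K) := by
    intro n x hx
    refine Real.abs_le_sqrt ((H10.sq_le (hf n) hx).trans ?_)
    exact mul_le_mul_of_nonneg_left (hK n) (sub_nonneg.2 hab.le)
  have hcomp : IsCompact (closure (range F)) := by
    refine BoundedContinuousFunction.arzela_ascoli (Metric.closedBall 0 (√((b - a) * K)))
      (isCompact_closedBall _ _) _ ?_ ?_
    · rintro _ x ⟨n, rfl⟩
      rw [mem_closedBall_zero_iff]
      exact hbd n x x.2
    · intro x
      rw [Metric.equicontinuousAt_iff]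
      intro ε hε
      -- From `|f x - f y|² ≤ K |x - y|`, uniformly in the sequence; `K + 1` guards against `K = 0`.
      refine ⟨ε ^ 2 / (K + 1), by positivity, ?_⟩
      rintro y hy ⟨_, n, rfl⟩
      have h1 := H10.sq_sub_le (hf n) y.2 x.2
      have h2 : |(x : ℝ) - y| < ε ^ 2 / (K + 1) := by
        rw [abs_sub_comm]; exact hy
      have h3 : (f n x - f n y) ^ 2 < ε ^ 2 := by
        calc (f n x - f n y) ^ 2 ≤ |(x : ℝ) - y| * K :=
              h1.trans (mul_le_mul_of_nonneg_left (hK n) (abs_nonneg _))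
          _ ≤ |(x : ℝ) - y| * (K + 1) := mul_le_mul_of_nonneg_left (by linarith) (abs_nonneg _)
          _ < ε ^ 2 / (K + 1) * (K + 1) := by gcongr
          _ = ε ^ 2 := by field_simp
      have h4 := abs_lt_of_sq_lt_sq h3 hε.le
      exact h4
  obtain ⟨G, -, s, hs, hlim⟩ := hcomp.tendsto_subseq (fun n => subset_closure (mem_range_self n))
  refine ⟨s, hs, fun ε hε => ?_⟩
  obtain ⟨N, hN⟩ := Metric.cauchySeq_iff.1 hlim.cauchySeq ε hε
  refine ⟨N, fun n hn k hk x hx => ?_⟩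
  have := (BoundedContinuousFunction.dist_coe_le_dist (⟨x, hx⟩ : Icc a b)).trans_lt (hN n hn k hk)
  exact this

end H10

/-! ### The quadratic form of the variational problem -/

/-- Coefficients of the energy `½ τ ψ(0)² + ½ ∫ κ (ψ' + rφ)² - 2 γ ρ r φ ψ + ε (…)` on `(a, b)`. -/
structure FormData (a b : ℝ) where
  κ : ℝ → ℝ
  ε : ℝ → ℝ
  ρ : ℝ → ℝ
  τ : ℝ
  γ : ℝ
  r : ℝ
  lo : ℝ
  hi : ℝ
  neg : a < 0
  pos : 0 < b
  τ_nonneg : 0 ≤ τ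
  γ_nonneg : 0 ≤ γ
  r_pos : 0 < r
  lo_pos : 0 < lo
  κ_meas : AEStronglyMeasurable κ (ivol a b)
  ε_meas : AEStronglyMeasurable ε (ivol a b)
  ρ_meas : AEStronglyMeasurable ρ (ivol a b)
  κ_bd : ∀ x ∈ Ioo a b, 0 ≤ κ x ∧ κ x ≤ hi
  ε_bd : ∀ x ∈ Ioo a b, lo ≤ ε x ∧ ε x ≤ hi
  ρ_bd : ∀ x ∈ Ioo a b, lo ≤ ρ x ∧ ρ x ≤ hi

lemma integrable_coeff_mul {a b : ℝ} {c f g : ℝ → ℝ} {C : ℝ}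
    (hc : AEStronglyMeasurable c (ivol a b)) (hC : ∀ x ∈ Ioo a b, |c x| ≤ C)
    (hf : MemLp f 2 (ivol a b)) (hg : MemLp g 2 (ivol a b)) :
    Integrable (fun x => c x * (f x * g x)) (ivol a b) :=
  (hf.integrable_mul hg).bdd_mul hc
    ((ae_restrict_iff' measurableSet_Ioo).2 (ae_of_all _ fun x hx => hC x hx))

namespace FormData

variable {a b : ℝ} (F : FormData a b)

include F in
lemma lt : a < b := F.neg.trans F.pos

lemma hi_pos : 0 < F.hi := by
  have h := F.ρ_bd 0 ⟨F.neg, F.pos⟩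
  linarith [F.lo_pos, h.1, h.2]

lemma abs_κ_le {x : ℝ} (hx : x ∈ Ioo a b) : |F.κ x| ≤ F.hi := by
  rw [abs_of_nonneg (F.κ_bd x hx).1]; exact (F.κ_bd x hx).2

lemma abs_ε_le {x : ℝ} (hx : x ∈ Ioo a b) : |F.ε x| ≤ F.hi := by
  rw [abs_of_nonneg (F.lo_pos.le.trans (F.ε_bd x hx).1)]; exact (F.ε_bd x hx).2

lemma abs_ρ_le {x : ℝ} (hx : x ∈ Ioo a b) : |F.ρ x| ≤ F.hi := by
  rw [abs_of_nonneg (F.lo_pos.le.trans (F.ρ_bd x hx).1)]; exact (F.ρ_bd x hx).2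

/-- The density of the polarized energy at `x`. -/
noncomputable def dens (x p q p' q' P Q P' Q' : ℝ) : ℝ :=
  F.κ x * ((q' + F.r * p) * (Q' + F.r * P))
    + F.ρ x * (-(F.γ * F.r) * p * Q) + F.ρ x * (-(F.γ * F.r) * q * P)
    + F.ε x * ((p' - F.r * q) * (P' - F.r * Q)) + F.ε x * ((q' - F.r * p) * (Q' - F.r * P))
    + F.ε x * (1 / 3 * (q' + F.r * p) * (Q' + F.r * P))

/-- The pairs `(φ, ψ)` of `H¹₀` functions. -/
abbrev Pairs : Type := H10 a b F.lt × H10 a b F.lt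

/-- The density of the polarized energy along two pairs. -/
noncomputable def densFun (u v : F.Pairs) (x : ℝ) : ℝ :=
  F.dens x (u.1.1 x) (u.2.1 x) (deriv u.1.1 x) (deriv u.2.1 x)
    (v.1.1 x) (v.2.1 x) (deriv v.1.1 x) (deriv v.2.1 x)

lemma integrable_densFun (u v : F.Pairs) : Integrable (F.densFun u v) (ivol a b) := by
  have a1 := H10.memLp u.1.2
  have a2 := H10.memLp u.2.2
  have a3 := H10.memLp_deriv u.1.2
  have a4 := H10.memLp_deriv u.2.2
  have b1 := H10.memLp v.1.2
  have b2 := H10.memLp v.2.2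
  have b3 := H10.memLp_deriv v.1.2
  have b4 := H10.memLp_deriv v.2.2
  have hκ : ∀ x ∈ Ioo a b, |F.κ x| ≤ F.hi := fun x hx => F.abs_κ_le hx
  have hε : ∀ x ∈ Ioo a b, |F.ε x| ≤ F.hi := fun x hx => F.abs_ε_le hx
  have hρ : ∀ x ∈ Ioo a b, |F.ρ x| ≤ F.hi := fun x hx => F.abs_ρ_le hx
  have s1 := a4.add (a1.const_mul F.r)
  have s2 := b4.add (b1.const_mul F.r)
  have i1 := integrable_coeff_mul F.κ_meas hκ s1 s2
  have i2 := integrable_coeff_mul F.ρ_meas hρ (a1.const_mul (-(F.γ * F.r))) b2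
  have i3 := integrable_coeff_mul F.ρ_meas hρ (a2.const_mul (-(F.γ * F.r))) b1
  have i4 := integrable_coeff_mul F.ε_meas hε (a3.sub (a2.const_mul F.r)) (b3.sub (b2.const_mul F.r))
  have i5 := integrable_coeff_mul F.ε_meas hε (a4.sub (a1.const_mul F.r)) (b4.sub (b1.const_mul F.r))
  have i6 := integrable_coeff_mul F.ε_meas hε (s1.const_mul (1 / 3)) s2
  exact ((((i1.add i2).add i3).add i4).add i5).add i6

lemma deriv_coe_add (u v : H10 a b F.lt) :
    ∀ᵐ x ∂ivol a b, deriv (u + v).1 x = deriv u.1 x + deriv v.1 x :=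
  deriv_add_ae F.lt.le (H10.ac u.2) (H10.ac v.2)

lemma deriv_coe_smul (c : ℝ) (u : H10 a b F.lt) :
    ∀ᵐ x ∂ivol a b, deriv (c • u).1 x = c * deriv u.1 x :=
  deriv_smul_ae F.lt.le c (H10.ac u.2)

lemma integral_densFun_add (u w v : F.Pairs) : ∫ x, F.densFun (u + w) v x ∂ivol a b
    = ∫ x, F.densFun u v x ∂ivol a b + ∫ x, F.densFun w v x ∂ivol a b := by
  rw [← integral_add (F.integrable_densFun u v) (F.integrable_densFun w v)]
  refine integral_congr_ae ?_
  filter_upwards [F.deriv_coe_add u.1 w.1, F.deriv_coe_add u.2 w.2] with x h1 h2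
  simp only [densFun, Prod.fst_add, Prod.snd_add, h1, h2]
  simp only [Submodule.coe_add, Pi.add_apply, dens]
  ring

lemma integral_densFun_smul (c : ℝ) (u v : F.Pairs) : ∫ x, F.densFun (c • u) v x ∂ivol a b
    = c * ∫ x, F.densFun u v x ∂ivol a b := by
  rw [← integral_const_mul]
  refine integral_congr_ae ?_
  filter_upwards [F.deriv_coe_smul c u.1, F.deriv_coe_smul c u.2] with x h1 h2
  simp only [densFun, Prod.smul_fst, Prod.smul_snd, h1, h2]
  simp only [Submodule.coe_smul, Pi.smul_apply, smul_eq_mul, dens]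
  ring

lemma densFun_comm (u v : F.Pairs) : F.densFun u v = F.densFun v u := by
  ext x
  simp only [densFun, dens]
  ring

/-- The polarized energy. -/
noncomputable def B : LinearMap.BilinForm ℝ F.Pairs :=
  LinearMap.mk₂ ℝ (fun u v => F.τ * u.2.1 0 * v.2.1 0 + ∫ x, F.densFun u v x ∂ivol a b)
    (fun u w v => by rw [integral_densFun_add]; simp; ring)
    (fun c u v => by rw [integral_densFun_smul]; simp; ring)
    (fun v u w => by
      rw [densFun_comm, integral_densFun_add, densFun_comm, F.densFun_comm w]; simp; ring)
    (fun c v u => by rw [densFun_comm, integral_densFun_smul, densFun_comm]; simp; ring)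

lemma B_apply (u v : F.Pairs) :
    F.B u v = F.τ * u.2.1 0 * v.2.1 0 + ∫ x, F.densFun u v x ∂ivol a b := rfl

lemma B_comm (u v : F.Pairs) : F.B u v = F.B v u := by
  rw [B_apply, B_apply, densFun_comm]; ring

/-- The density of the polarized constraint. -/
noncomputable def massFun (u v : F.Pairs) (x : ℝ) : ℝ :=
  F.ρ x * (u.1.1 x * v.1.1 x) + F.ρ x * (u.2.1 x * v.2.1 x)

lemma integrable_massFun (u v : F.Pairs) : Integrable (F.massFun u v) (ivol a b) :=
  (integrable_coeff_mul F.ρ_meas (fun _ hx => F.abs_ρ_le hx) (H10.memLp u.1.2)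
    (H10.memLp v.1.2)).add
  (integrable_coeff_mul F.ρ_meas (fun _ hx => F.abs_ρ_le hx) (H10.memLp u.2.2)
    (H10.memLp v.2.2))

lemma integral_massFun_add (u w v : F.Pairs) : ∫ x, F.massFun (u + w) v x ∂ivol a b
    = ∫ x, F.massFun u v x ∂ivol a b + ∫ x, F.massFun w v x ∂ivol a b := by
  rw [← integral_add (F.integrable_massFun u v) (F.integrable_massFun w v)]
  refine integral_congr_ae (ae_of_all _ fun x => ?_)
  simp only [massFun, Prod.fst_add, Prod.snd_add, Submodule.coe_add, Pi.add_apply]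
  ring

lemma integral_massFun_smul (c : ℝ) (u v : F.Pairs) : ∫ x, F.massFun (c • u) v x ∂ivol a b
    = c * ∫ x, F.massFun u v x ∂ivol a b := by
  rw [← integral_const_mul]
  refine integral_congr_ae (ae_of_all _ fun x => ?_)
  simp only [massFun, Prod.smul_fst, Prod.smul_snd, Submodule.coe_smul, Pi.smul_apply, smul_eq_mul]
  ring

lemma massFun_comm (u v : F.Pairs) : F.massFun u v = F.massFun v u := by
  ext x
  simp only [massFun]
  ring

/-- The polarized constraint. -/
noncomputable def M : LinearMap.BilinForm ℝ F.Pairs :=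
  LinearMap.mk₂ ℝ (fun u v => ∫ x, F.massFun u v x ∂ivol a b)
    (fun u w v => F.integral_massFun_add u w v)
    (fun c u v => F.integral_massFun_smul c u v)
    (fun v u w => by
      rw [massFun_comm, integral_massFun_add, massFun_comm, F.massFun_comm w])
    (fun c v u => by rw [massFun_comm, integral_massFun_smul, massFun_comm, smul_eq_mul])

lemma M_apply (u v : F.Pairs) : F.M u v = ∫ x, F.massFun u v x ∂ivol a b := rfl

lemma M_comm (u v : F.Pairs) : F.M u v = F.M v u := by
  rw [M_apply, M_apply, massFun_comm]

/-- The Dirichlet integral of a pair. -/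
noncomputable def dir (u : F.Pairs) : ℝ := dirichlet a b u.1.1 + dirichlet a b u.2.1

/-- The squared `L²` norm of a pair. -/
noncomputable def mass (u : F.Pairs) : ℝ :=
  ∫ x, u.1.1 x ^ 2 ∂ivol a b + ∫ x, u.2.1 x ^ 2 ∂ivol a b

lemma dir_nonneg (u : F.Pairs) : 0 ≤ F.dir u := add_nonneg (dirichlet_nonneg _) (dirichlet_nonneg _)

lemma mass_nonneg (u : F.Pairs) : 0 ≤ F.mass u :=
  add_nonneg (integral_nonneg fun _ => sq_nonneg _) (integral_nonneg fun _ => sq_nonneg _)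

lemma mass_le (u : F.Pairs) : F.mass u ≤ (b - a) ^ 2 * F.dir u := by
  rw [mass, dir, mul_add]
  exact add_le_add (H10.integral_sq_le u.1.2) (H10.integral_sq_le u.2.2)

lemma mass_eq (u : F.Pairs) : F.mass u = ∫ x, (u.1.1 x ^ 2 + u.2.1 x ^ 2) ∂ivol a b :=
  (integral_add (H10.memLp u.1.2).integrable_sq (H10.memLp u.2.2).integrable_sq).symm

lemma integrable_mass (u : F.Pairs) :
    Integrable (fun x => u.1.1 x ^ 2 + u.2.1 x ^ 2) (ivol a b) :=
  (H10.memLp u.1.2).integrable_sq.add (H10.memLp u.2.2).integrable_sq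

lemma dir_eq (u : F.Pairs) : F.dir u = ∫ x, (deriv u.1.1 x ^ 2 + deriv u.2.1 x ^ 2) ∂ivol a b :=
  (integral_add (H10.memLp_deriv u.1.2).integrable_sq (H10.memLp_deriv u.2.2).integrable_sq).symm

lemma integrable_dir (u : F.Pairs) :
    Integrable (fun x => deriv u.1.1 x ^ 2 + deriv u.2.1 x ^ 2) (ivol a b) :=
  (H10.memLp_deriv u.1.2).integrable_sq.add (H10.memLp_deriv u.2.2).integrable_sq

lemma M_le (u : F.Pairs) : F.M u u ≤ F.hi * F.mass u := by
  rw [M_apply, mass_eq, ← integral_const_mul]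
  refine integral_mono_ae (F.integrable_massFun u u) ((F.integrable_mass u).const_mul _) ?_
  refine (ae_restrict_iff' measurableSet_Ioo).2 (ae_of_all _ fun x hx => ?_)
  have := (F.ρ_bd x hx).2
  simp only [massFun]
  nlinarith [sq_nonneg (u.1.1 x), sq_nonneg (u.2.1 x)]

lemma le_M (u : F.Pairs) : F.lo * F.mass u ≤ F.M u u := by
  rw [M_apply, mass_eq, ← integral_const_mul]
  refine integral_mono_ae ((F.integrable_mass u).const_mul _) (F.integrable_massFun u u) ?_
  refine (ae_restrict_iff' measurableSet_Ioo).2 (ae_of_all _ fun x hx => ?_)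
  have := (F.ρ_bd x hx).1
  simp only [massFun]
  nlinarith [sq_nonneg (u.1.1 x), sq_nonneg (u.2.1 x)]

lemma M_nonneg (u : F.Pairs) : 0 ≤ F.M u u :=
  (mul_nonneg F.lo_pos.le (F.mass_nonneg u)).trans (F.le_M u)

/-- Coercivity of the energy. -/
lemma le_B (u : F.Pairs) :
    F.lo * (F.dir u + F.r ^ 2 * F.mass u) - F.γ * F.r * F.M u u ≤ F.B u u := by
  -- Expanding `(φ' - rψ)² + (ψ' - rφ)²` leaves the cross term `-2r(φψ)'`, whose integral vanishes
  -- by the boundary values.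
  have h0 : ∫ x, (deriv u.1.1 x * u.2.1 x + u.1.1 x * deriv u.2.1 x) ∂ivol a b = 0 := by
    rw [← intervalIntegral_eq_ivol F.lt.le,
      (H10.ac u.1.2).integral_deriv_mul_eq_sub (H10.ac u.2.2), H10.left u.1.2, H10.right u.1.2]
    simp
  have hi0 : Integrable (fun x => deriv u.1.1 x * u.2.1 x + u.1.1 x * deriv u.2.1 x) (ivol a b) :=
    ((H10.memLp_deriv u.1.2).integrable_mul (H10.memLp u.2.2)).add
      ((H10.memLp u.1.2).integrable_mul (H10.memLp_deriv u.2.2))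
  have h1 : F.lo * (F.dir u + F.r ^ 2 * F.mass u) - F.γ * F.r * F.M u u
      = ∫ x, (F.lo * ((deriv u.1.1 x ^ 2 + deriv u.2.1 x ^ 2)
        + F.r ^ 2 * (u.1.1 x ^ 2 + u.2.1 x ^ 2)
        - 2 * F.r * (deriv u.1.1 x * u.2.1 x + u.1.1 x * deriv u.2.1 x))
        - F.γ * F.r * F.massFun u u x) ∂ivol a b := by
    have j1 := (F.integrable_dir u).add ((F.integrable_mass u).const_mul (F.r ^ 2))
    rw [integral_sub, integral_const_mul, integral_sub, integral_add, integral_const_mul,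
      integral_const_mul, integral_const_mul, h0, dir_eq, mass_eq, M_apply]
    · ring
    · exact F.integrable_dir u
    · exact (F.integrable_mass u).const_mul _
    · exact j1
    · exact hi0.const_mul _
    · exact (j1.sub (hi0.const_mul _)).const_mul _
    · exact (F.integrable_massFun u u).const_mul _
  have h2 : 0 ≤ F.τ * u.2.1 0 * u.2.1 0 := by
    rw [mul_assoc]; exact mul_nonneg F.τ_nonneg (mul_self_nonneg _)
  rw [h1, B_apply]
  refine le_trans (integral_mono_ae ?_ (F.integrable_densFun u u) ?_) (le_add_of_nonneg_left h2)
  · exact ((((F.integrable_dir u).add ((F.integrable_mass u).const_mul (F.r ^ 2))).sub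
      (hi0.const_mul _)).const_mul _).sub ((F.integrable_massFun u u).const_mul _)
  refine (ae_restrict_iff' measurableSet_Ioo).2 (ae_of_all _ fun x hx => ?_)
  have hκ := (F.κ_bd x hx).1
  have hε := (F.ε_bd x hx).1
  have hρ := F.lo_pos.le.trans (F.ρ_bd x hx).1
  simp only [densFun, dens, massFun]
  generalize u.1.1 x = p, u.2.1 x = q, deriv u.1.1 x = p', deriv u.2.1 x = q'
  have k1 := mul_nonneg hκ (sq_nonneg (q' + F.r * p))
  have k2 := mul_nonneg (sub_nonneg.2 hε) (add_nonneg (sq_nonneg (p' - F.r * q))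
    (sq_nonneg (q' - F.r * p)))
  have k3 := mul_nonneg (F.lo_pos.le.trans hε) (sq_nonneg (q' + F.r * p))
  -- This square gives `-2γrρφψ ≥ -γrρ(φ² + ψ²)`, which accounts for the subtracted multiple of `M`.
  have k4 := mul_nonneg (mul_nonneg hρ (mul_nonneg F.γ_nonneg F.r_pos.le)) (sq_nonneg (p - q))
  nlinarith [k1, k2, k3, k4]

/-- Boundedness of the energy. -/
lemma exists_B_le : ∃ C, 0 ≤ C ∧ ∀ u, F.B u u ≤ C * F.dir u := by
  have hhi := F.hi_pos
  have hr := F.r_pos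
  have hγ := F.γ_nonneg
  have hτ := F.τ_nonneg
  have hlt := sub_pos.2 F.lt
  set C2 : ℝ := F.hi * (7 * F.r ^ 2 + F.γ * F.r)
  have hC2 : 0 ≤ C2 := by positivity
  -- The sup bound handles `ψ(0)²`, Poincaré turns mass into Dirichlet integral, and `7` generously
  -- covers `2 + 2 + 2/3` from the three squares of `ψ' ± rφ`.
  refine ⟨F.τ * (b - a) + (7 * F.hi + C2 * (b - a) ^ 2), by positivity, fun u => ?_⟩
  have h1 : F.τ * u.2.1 0 * u.2.1 0 ≤ F.τ * (b - a) * F.dir u := by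
    have h := H10.sq_le u.2.2 (x := 0) ⟨F.neg.le, F.pos.le⟩
    have h' : (b - a) * dirichlet a b u.2.1 ≤ (b - a) * F.dir u :=
      mul_le_mul_of_nonneg_left (le_add_of_nonneg_left (dirichlet_nonneg _)) hlt.le
    calc F.τ * u.2.1 0 * u.2.1 0 = F.τ * u.2.1 0 ^ 2 := by ring
      _ ≤ F.τ * ((b - a) * F.dir u) := mul_le_mul_of_nonneg_left (h.trans h') hτ
      _ = _ := by ring
  have h2 : ∫ x, F.densFun u u x ∂ivol a b ≤ 7 * F.hi * F.dir u + C2 * F.mass u := by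
    rw [dir_eq, mass_eq, ← integral_const_mul, ← integral_const_mul, ← integral_add
      ((F.integrable_dir u).const_mul _) ((F.integrable_mass u).const_mul _)]
    refine integral_mono_ae (F.integrable_densFun u u)
      (((F.integrable_dir u).const_mul _).add ((F.integrable_mass u).const_mul _)) ?_
    refine (ae_restrict_iff' measurableSet_Ioo).2 (ae_of_all _ fun x hx => ?_)
    have hκ := F.κ_bd x hx
    have hε := F.ε_bd x hx
    have hε0 := F.lo_pos.le.trans hε.1
    have hρ := F.ρ_bd x hx
    have hρ0 := F.lo_pos.le.trans hρ.1
    simp only [densFun, dens, C2]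
    generalize u.1.1 x = p, u.2.1 x = q, deriv u.1.1 x = p', deriv u.2.1 x = q'
    have m1 : (q' + F.r * p) ^ 2 ≤ 2 * (q' ^ 2 + F.r ^ 2 * p ^ 2) := by
      nlinarith [sq_nonneg (q' - F.r * p)]
    have m2 : (q' - F.r * p) ^ 2 ≤ 2 * (q' ^ 2 + F.r ^ 2 * p ^ 2) := by
      nlinarith [sq_nonneg (q' + F.r * p)]
    have m3 : (p' - F.r * q) ^ 2 ≤ 2 * (p' ^ 2 + F.r ^ 2 * q ^ 2) := by
      nlinarith [sq_nonneg (p' + F.r * q)]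
    have n1 : F.κ x * (q' + F.r * p) ^ 2 ≤ F.hi * (2 * (q' ^ 2 + F.r ^ 2 * p ^ 2)) :=
      mul_le_mul hκ.2 m1 (sq_nonneg _) hhi.le
    have n2 : F.ε x * (q' + F.r * p) ^ 2 ≤ F.hi * (2 * (q' ^ 2 + F.r ^ 2 * p ^ 2)) :=
      mul_le_mul hε.2 m1 (sq_nonneg _) hhi.le
    have n3 : F.ε x * (q' - F.r * p) ^ 2 ≤ F.hi * (2 * (q' ^ 2 + F.r ^ 2 * p ^ 2)) :=
      mul_le_mul hε.2 m2 (sq_nonneg _) hhi.le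
    have n4 : F.ε x * (p' - F.r * q) ^ 2 ≤ F.hi * (2 * (p' ^ 2 + F.r ^ 2 * q ^ 2)) :=
      mul_le_mul hε.2 m3 (sq_nonneg _) hhi.le
    have n5 : F.ρ x * (F.γ * F.r * (-(2 * p * q))) ≤ F.hi * (F.γ * F.r * (p ^ 2 + q ^ 2)) := by
      refine (mul_le_mul_of_nonneg_left (mul_le_mul_of_nonneg_left (b := -(2 * p * q))
        (c := p ^ 2 + q ^ 2) (by nlinarith [sq_nonneg (p + q)]) (by positivity)) hρ0).trans ?_
      exact mul_le_mul_of_nonneg_right hρ.2 (by positivity)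
    have n6 : 0 ≤ F.hi * (F.r ^ 2 * p ^ 2) := by positivity
    have n7 : 0 ≤ F.hi * (F.r ^ 2 * q ^ 2) := by positivity
    have n8 : 0 ≤ F.hi * p' ^ 2 := by positivity
    have n9 : 0 ≤ F.hi * q' ^ 2 := by positivity
    linarith
  rw [B_apply]
  have h3 := mul_le_mul_of_nonneg_left (F.mass_le u) hC2
  linarith

end FormData

/-! ### Existence of minimizers and the weak Euler–Lagrange equation. -/

namespace FormData

variable {a b : ℝ} (F : FormData a b)

/-- The parallelogram identity with the nonnegative term `Q (u + v) (u + v)` dropped. -/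
lemma parallelogram_le {V : Type*} [AddCommGroup V] [Module ℝ V] (Q : LinearMap.BilinForm ℝ V)
    (hQ : ∀ v, 0 ≤ Q v v) (u v : V) : Q (u - v) (u - v) ≤ 2 * Q u u + 2 * Q v v := by
  have := hQ (u + v)
  simp only [map_add, map_sub, LinearMap.add_apply, LinearMap.sub_apply] at this ⊢
  linarith

/-- The shifted form `B - m M`. -/
noncomputable def Q (m : ℝ) : LinearMap.BilinForm ℝ F.Pairs := F.B - m • F.M

lemma Q_apply (m : ℝ) (u v : F.Pairs) : F.Q m u v = F.B u v - m * F.M u v := rfl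

/-- Homogeneity extends the bound from the constraint set to every pair of positive mass; where `M v
v = 0`, coercivity gives `B ≥ 0`. -/
lemma Q_nonneg {m : ℝ} (h : ∀ v, F.M v v = 2 → 2 * m ≤ F.B v v) (v : F.Pairs) :
    0 ≤ F.Q m v v := by
  rw [Q_apply]
  rcases (F.M_nonneg v).eq_or_lt with h0 | h0
  · have h1 := F.le_B v
    have h2 := mul_nonneg F.lo_pos.le (add_nonneg (F.dir_nonneg v)
      (mul_nonneg (sq_nonneg F.r) (F.mass_nonneg v)))
    rw [← h0] at h1 ⊢
    linarith
  · set c := √(2 / F.M v v)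
    have hc : c * c = 2 / F.M v v := Real.mul_self_sqrt (by positivity)
    have h1 := h (c • v) (by simp [← mul_assoc, hc, h0.ne'])
    have h2 : F.B (c • v) (c • v) = 2 / F.M v v * F.B v v := by simp [← mul_assoc, hc]
    rw [h2, div_mul_eq_mul_div, le_div_iff₀ h0] at h1
    linarith

/-- A Gårding inequality: `Q` controls derivatives modulo the mass, and the mass is the quantity
that Rellich's theorem makes small. -/
lemma lo_mul_dir_le (m : ℝ) (v : F.Pairs) :
    F.lo * F.dir v ≤ F.Q m v v + |F.γ * F.r + m| * (F.hi * F.mass v) := by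
  have h1 := F.le_B v
  have h2 : 0 ≤ F.lo * (F.r ^ 2 * F.mass v) :=
    mul_nonneg F.lo_pos.le (mul_nonneg (sq_nonneg _) (F.mass_nonneg v))
  have h3 : (F.γ * F.r + m) * F.M v v ≤ |F.γ * F.r + m| * (F.hi * F.mass v) :=
    (mul_le_mul_of_nonneg_right (le_abs_self _) (F.M_nonneg v)).trans
      (mul_le_mul_of_nonneg_left (F.M_le v) (abs_nonneg _))
  rw [Q_apply]
  linarith

lemma exists_Q_le (m : ℝ) : ∃ C, 0 ≤ C ∧ ∀ v, F.Q m v v ≤ C * F.dir v ∧ F.M v v ≤ C * F.dir v := by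
  obtain ⟨C, hC, h⟩ := F.exists_B_le
  have hM : ∀ v, F.M v v ≤ F.hi * (b - a) ^ 2 * F.dir v := fun v =>
    (F.M_le v).trans (by
      rw [mul_assoc]; exact mul_le_mul_of_nonneg_left (F.mass_le v) F.hi_pos.le)
  have hhi := F.hi_pos
  have hpos : 0 ≤ F.hi * (b - a) ^ 2 := by positivity
  refine ⟨C + (|m| + 1) * (F.hi * (b - a) ^ 2), by positivity, fun v => ⟨?_, ?_⟩⟩
  · have h1 : -m * F.M v v ≤ |m| * (F.hi * (b - a) ^ 2 * F.dir v) :=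
      (mul_le_mul_of_nonneg_right (neg_le_abs m) (F.M_nonneg v)).trans
        (mul_le_mul_of_nonneg_left (hM v) (abs_nonneg m))
    have h2 := mul_nonneg hpos (F.dir_nonneg v)
    rw [Q_apply]
    linarith [h v]
  · have h2 := mul_nonneg hC (F.dir_nonneg v)
    have h3 := mul_nonneg (mul_nonneg (abs_nonneg m) hpos) (F.dir_nonneg v)
    linarith [hM v]

lemma mass_sub_le {u v : F.Pairs} {δ : ℝ} 
    (h1 : ∀ x ∈ Icc a b, |u.1.1 x - v.1.1 x| ≤ δ)
    (h2 : ∀ x ∈ Icc a b, |u.2.1 x - v.2.1 x| ≤ δ) : F.mass (u - v) ≤ 2 * (b - a) * δ ^ 2 := by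
  calc F.mass (u - v) ≤ ∫ x, 2 * δ ^ 2 ∂ivol a b := by
        rw [mass_eq]
        refine integral_mono_ae (F.integrable_mass _) (integrable_const _) ?_
        refine (ae_restrict_iff' measurableSet_Ioo).2 (ae_of_all _ fun x hx => ?_)
        have hx' := Ioo_subset_Icc_self hx
        have k1 := sq_le_sq' (abs_le.1 (h1 x hx')).1 (abs_le.1 (h1 x hx')).2
        have k2 := sq_le_sq' (abs_le.1 (h2 x hx')).1 (abs_le.1 (h2 x hx')).2
        change (u.1.1 x - v.1.1 x) ^ 2 + (u.2.1 x - v.2.1 x) ^ 2 ≤ 2 * δ ^ 2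
        linarith
    _ = 2 * (b - a) * δ ^ 2 := by
        simp [Real.volume_real_Ioo_of_le F.lt.le]; ring

/-- The energy attains its infimum on the constraint set. -/
theorem exists_minimizer (m : ℝ) (h : ∀ v, F.M v v = 2 → 2 * m ≤ F.B v v)
    (h' : ∀ ε > 0, ∃ v, F.M v v = 2 ∧ F.B v v < 2 * m + ε) :
    ∃ u, F.M u u = 2 ∧ F.B u u = 2 * m := by
  have hQ := F.Q_nonneg h
  choose u hu hu' using fun n : ℕ => h' (1 / ((n : ℝ) + 1)) Nat.one_div_pos_of_nat
  have hlo := F.lo_pos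
  -- On the constraint set `Q m u u = B u u - 2m`, the distance from minimality.
  have hQu : ∀ n, F.Q m (u n) (u n) ≤ 1 / ((n : ℝ) + 1) := fun n => by
    rw [Q_apply, hu]; linarith [hu' n]
  set K : ℝ := (1 + |F.γ * F.r + m| * (F.hi * (2 / F.lo))) / F.lo
  have hK : ∀ n, F.dir (u n) ≤ K := by
    intro n
    rw [le_div_iff₀ hlo, mul_comm]
    have h1 := F.lo_mul_dir_le m (u n)
    have h2 := F.le_M (u n)
    rw [hu, ← le_div_iff₀' hlo] at h2
    have h3 : (1 : ℝ) / ((n : ℝ) + 1) ≤ 1 := by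
      rw [div_le_one (by positivity)]; linarith [(Nat.cast_nonneg n : (0 : ℝ) ≤ n)]
    have h4 := mul_le_mul_of_nonneg_left (mul_le_mul_of_nonneg_left h2 F.hi_pos.le)
      (abs_nonneg (F.γ * F.r + m))
    linarith [hQu n]
  -- Two successive extractions, one per component; the second runs along the first.
  obtain ⟨s, hs, hsc⟩ := H10.exists_subseq (fun n => (u n).1.1) (fun n => (u n).1.2) K
    (fun n => (le_add_of_nonneg_right (dirichlet_nonneg _)).trans (hK n))
  obtain ⟨t, ht, htc⟩ := H10.exists_subseq (fun n => (u (s n)).2.1) (fun n => (u (s n)).2.2) K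
    (fun n => (le_add_of_nonneg_left (dirichlet_nonneg _)).trans (hK (s n)))
  set w : ℕ → F.Pairs := fun n => u (s (t n)) with hw
  have hQw : ∀ n, F.Q m (w n) (w n) ≤ 1 / ((n : ℝ) + 1) := by
    intro n
    refine (hQu _).trans ?_
    have : n ≤ s (t n) := (ht.id_le n).trans (hs.id_le _)
    gcongr
  -- Strong convergence is obtained directly: `Q` of a difference is at most twice the sum of the
  -- two small `Q` values, and uniform convergence makes the mass of the difference small.
  have hcauchy : ∀ ε > 0, ∃ N, ∀ n ≥ N, ∀ k ≥ N, F.dir (w n - w k) < ε := by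
    intro ε hε
    set c := |F.γ * F.r + m| * F.hi * (2 * (b - a)) with hc
    have hc0 : 0 ≤ c := by
      have := F.hi_pos
      have := sub_pos.2 F.lt
      positivity
    -- The mass part is then at most `ε lo / 4`. With `Q` values below `ε lo / 8` the `Q` part is
    -- below `ε lo / 2`, for a total below `ε lo`.
    set δ := √(ε * F.lo / (4 * (c + 1))) with hδ
    have hδ0 : 0 < δ := Real.sqrt_pos.2 (by positivity)
    have hδ2 : δ ^ 2 = ε * F.lo / (4 * (c + 1)) := Real.sq_sqrt (by positivity)
    obtain ⟨N1, hN1⟩ := hsc δ hδ0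
    obtain ⟨N2, hN2⟩ := htc δ hδ0
    obtain ⟨N3, hN3⟩ := exists_nat_one_div_lt (show 0 < ε * F.lo / 8 by positivity)
    refine ⟨max N1 (max N2 N3), fun n hn k hk => ?_⟩
    have hn1 : N1 ≤ t n := (le_of_max_le_left hn).trans (ht.id_le n)
    have hk1 : N1 ≤ t k := (le_of_max_le_left hk).trans (ht.id_le k)
    have hm := F.mass_sub_le (u := w n) (v := w k)
      (fun x hx => (hN1 _ hn1 _ hk1 x hx).le)
      (fun x hx => (hN2 n (le_of_max_le_left (le_of_max_le_right hn)) k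
        (le_of_max_le_left (le_of_max_le_right hk)) x hx).le)
    have hq := parallelogram_le (F.Q m) hQ (w n) (w k)
    have e1 : ∀ j ≥ max N1 (max N2 N3), F.Q m (w j) (w j) < ε * F.lo / 8 := by
      intro j hj
      refine (hQw j).trans_lt (lt_of_le_of_lt ?_ hN3)
      have : N3 ≤ j := le_of_max_le_right (le_of_max_le_right hj)
      gcongr
    have h1 := F.lo_mul_dir_le m (w n - w k)
    have h2 : |F.γ * F.r + m| * (F.hi * F.mass (w n - w k)) ≤ c * δ ^ 2 := by
      rw [hc]
      have := mul_le_mul_of_nonneg_left hm (mul_nonneg (abs_nonneg (F.γ * F.r + m)) F.hi_pos.le)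
      linarith
    have h3 : c * δ ^ 2 ≤ ε * F.lo / 4 := by
      rw [hδ2, mul_div_assoc', div_le_div_iff₀ (by positivity) (by norm_num)]
      nlinarith [mul_pos hε hlo]
    have h4 : F.lo * F.dir (w n - w k) < F.lo * ε := by
      linarith [e1 n hn, e1 k hk, mul_pos hε hlo]
    exact lt_of_mul_lt_mul_left h4 hlo.le
  obtain ⟨g1, hg1, hlim1⟩ := H10.complete (fun n => (w n).1.1) (fun n => (w n).1.2)
    (fun ε hε => (hcauchy ε hε).imp fun N hN n hn k hk =>
      (le_add_of_nonneg_right (dirichlet_nonneg _)).trans_lt (hN n hn k hk))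
  obtain ⟨g2, hg2, hlim2⟩ := H10.complete (fun n => (w n).2.1) (fun n => (w n).2.2)
    (fun ε hε => (hcauchy ε hε).imp fun N hN n hn k hk =>
      (le_add_of_nonneg_left (dirichlet_nonneg _)).trans_lt (hN n hn k hk))
  set z : F.Pairs := (⟨g1, hg1⟩, ⟨g2, hg2⟩)
  have hlim : Tendsto (fun n => F.dir (w n - z)) atTop (𝓝 0) := by
    have := hlim1.add hlim2
    rwa [add_zero] at this
  obtain ⟨C, hC, hle⟩ := F.exists_Q_le m
  have hlimC : Tendsto (fun n => C * F.dir (w n - z)) atTop (𝓝 0) := by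
    simpa using hlim.const_mul C
  -- Since `z = w n - (w n - z)`, the parallelogram bound splits `Q z z` into two parts that tend to
  -- zero.
  have hQz : F.Q m z z = 0 := by
    refine le_antisymm ?_ (hQ z)
    have h1 : ∀ n : ℕ, F.Q m z z ≤ 2 * (1 / ((n : ℝ) + 1)) + 2 * (C * F.dir (w n - z)) := by
      intro n
      have := parallelogram_le (F.Q m) hQ (w n) (w n - z)
      rw [sub_sub_cancel] at this
      linarith [hQw n, (hle (w n - z)).1]
    have h2 : Tendsto (fun n : ℕ => 2 * (1 / ((n : ℝ) + 1)) + 2 * (C * F.dir (w n - z)))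
        atTop (𝓝 0) := by
      simpa using (tendsto_one_div_add_atTop_nhds_zero_nat.const_mul (2 : ℝ)).add
        (hlimC.const_mul 2)
    exact ge_of_tendsto' h2 h1
  have hMz : F.M z z = 2 := by
    have h0 : Tendsto (fun n => F.M (w n - z) (w n - z)) atTop (𝓝 0) :=
      squeeze_zero (fun n => F.M_nonneg _) (fun n => (hle _).2) hlimC
    -- Cauchy–Schwarz for the form `M`, with `M (w n) (w n) = 2`; the constraint thus passes to the
    -- limit.
    have h1 : Tendsto (fun n => F.M (w n - z) (w n)) atTop (𝓝 0) := by
      have h2 : ∀ n, |F.M (w n - z) (w n)| ≤ √(F.M (w n - z) (w n - z) * 2) := by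
        intro n
        refine Real.abs_le_sqrt ?_
        have := LinearMap.BilinForm.apply_mul_apply_le_of_forall_zero_le F.M F.M_nonneg
          (w n - z) (w n)
        rw [F.M_comm (w n) (w n - z), hu] at this
        rwa [sq]
      have h3 : Tendsto (fun n => √(F.M (w n - z) (w n - z) * 2)) atTop (𝓝 0) := by
        have := (Real.continuous_sqrt.tendsto _).comp (h0.mul_const 2)
        rwa [zero_mul, Real.sqrt_zero] at this
      exact squeeze_zero_norm h2 h3
    have h4 : ∀ n, F.M z z = 2 - 2 * F.M (w n - z) (w n) + F.M (w n - z) (w n - z) := by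
      intro n
      have h5 := hu (s (t n))
      have h6 := F.M_comm (w n) z
      change F.M (w n) (w n) = 2 at h5
      simp only [map_sub, LinearMap.sub_apply]
      linarith
    have h5 : Tendsto (fun n => 2 - 2 * F.M (w n - z) (w n) + F.M (w n - z) (w n - z)) atTop
        (𝓝 (2 - 2 * 0 + 0)) := (tendsto_const_nhds.sub (h1.const_mul 2)).add h0
    have h6 : Tendsto (fun _ : ℕ => F.M z z) atTop (𝓝 (2 - 2 * 0 + 0)) := by
      refine h5.congr fun n => (h4 n).symm
    simpa using tendsto_nhds_unique tendsto_const_nhds h6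
  refine ⟨z, hMz, ?_⟩
  rw [Q_apply, hMz] at hQz
  linarith

/-- The weak Euler–Lagrange equation. -/
lemma weak_euler_lagrange {m : ℝ} (h : ∀ v, F.M v v = 2 → 2 * m ≤ F.B v v) {u : F.Pairs}
    (hM : F.M u u = 2) (hB : F.B u u = 2 * m) (v : F.Pairs) : F.B u v = m * F.M u v := by
  -- Cauchy–Schwarz for the nonnegative form `Q`: since `Q u u = 0`, also `Q u v = 0` for every `v`.
  -- This replaces variations along the constraint set and a Lagrange multiplier.
  have h1 := LinearMap.BilinForm.apply_mul_apply_le_of_forall_zero_le (F.Q m) (F.Q_nonneg h) u v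
  have h2 : F.Q m u u = 0 := by rw [Q_apply, hM, hB]; ring
  have h3 : F.Q m v u = F.Q m u v := by rw [Q_apply, Q_apply, B_comm, M_comm]
  rw [h2, h3, zero_mul] at h1
  have h4 : F.Q m u v = 0 := mul_self_eq_zero.1 (le_antisymm h1 (mul_self_nonneg _))
  rw [Q_apply] at h4
  linarith

end FormData

/-! ### The Euler–Lagrange equations in integrated form -/

lemma MemLp_integrable_mul {a b : ℝ} {f g : ℝ → ℝ} (hf : MemLp f 2 (ivol a b))
    (hg : MemLp g 2 (ivol a b)) : Integrable (fun x => f x * g x) (ivol a b) :=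
  hf.integrable_mul hg

/-- du Bois-Reymond: if `∫ f v' + g v = 0` for all `v ∈ H¹₀`, then `f' = g`. -/
lemma du_bois_reymond {a b : ℝ} (hab : a < b) {f g : ℝ → ℝ} (hf : MemLp f 2 (ivol a b))
    (hg : MemLp g 2 (ivol a b))
    (h : ∀ v ∈ H10 a b hab, ∫ x, (f x * deriv v x + g x * v x) ∂ivol a b = 0) :
    ∃ c, ∀ᵐ x ∂ivol a b, f x = c + ∫ t in a..x, g t := by
  set k : ℝ → ℝ := fun x => ∫ t in a..x, g t with hk
  have hgi : IntervalIntegrable g volume a b :=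
    (intervalIntegrable_iff_ivol hab.le g).2 (hg.integrable one_le_two)
  have hkac : AbsolutelyContinuousOnInterval k a b :=
    hgi.absolutelyContinuousOnInterval_intervalIntegral left_mem_uIcc
  have hkc : ContinuousOn k (Icc a b) := by
    have := hkac.continuousOn
    rwa [uIcc_of_le hab.le] at this
  have hkd : deriv k =ᵐ[ivol a b] g := by
    refine ae_ivol_of_ae_uIcc hab.le ?_
    filter_upwards [hgi.ae_hasDerivAt_integral] with x hx hx'
    exact (hx hx' a left_mem_uIcc).deriv
  have hk2 : MemLp k 2 (ivol a b) := hkc.memLp_ivol 2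
  set w : ℝ → ℝ := fun x => f x - k x with hw
  have hw2 : MemLp w 2 (ivol a b) := hf.sub hk2
  -- The mean of `w`, so that the primitive of `w - c` is an admissible test function. Testing with
  -- it yields `∫ (w - c)² = 0`.
  set c : ℝ := (∫ x, w x ∂ivol a b) / (b - a) with hc
  have hz2 : MemLp (fun x => w x - c) 2 (ivol a b) := hw2.sub (memLp_const c)
  have hz0 : ∫ x, (w x - c) ∂ivol a b = 0 := by
    rw [integral_sub (hw2.integrable one_le_two) (integrable_const c)]
    have : b - a ≠ 0 := (sub_pos.2 hab).ne'
    simp only [integral_const, smul_eq_mul, Measure.real, Measure.restrict_apply_univ,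
      Real.volume_Ioo, ENNReal.toReal_ofReal (sub_pos.2 hab).le, hc]
    field_simp
    ring
  obtain ⟨hv, hvd⟩ := primitive_mem_H10 (hab := hab) hz2 hz0
  set v : ℝ → ℝ := fun x => ∫ t in a..x, (w t - c) with hv'
  have h1 : ∫ x, k x * deriv v x ∂ivol a b = - ∫ x, g x * v x ∂ivol a b := by
    have := hkac.integral_mul_deriv_eq_deriv_mul (H10.ac hv)
    rw [H10.left hv, H10.right hv, intervalIntegral_eq_ivol hab.le,
      intervalIntegral_eq_ivol hab.le] at this
    rw [this, mul_zero, mul_zero, sub_zero, zero_sub]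
    congr 1
    refine integral_congr_ae ?_
    filter_upwards [hkd] with x hx
    rw [hx]
  have h2 : ∫ x, w x * deriv v x ∂ivol a b = 0 := by
    have h3 := h v hv
    rw [integral_add (MemLp_integrable_mul hf (H10.memLp_deriv hv)) (MemLp_integrable_mul hg (H10.memLp hv))]
      at h3
    have h4 : ∀ x, w x * deriv v x = f x * deriv v x - k x * deriv v x := fun x => by
      rw [hw]; ring
    simp_rw [h4]
    rw [integral_sub (MemLp_integrable_mul hf (H10.memLp_deriv hv))
      (MemLp_integrable_mul hk2 (H10.memLp_deriv hv)), h1]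
    linarith
  have h5 : ∫ x, (w x - c) ^ 2 ∂ivol a b = 0 := by
    have h6 : ∫ x, (w x - c) ^ 2 ∂ivol a b = ∫ x, (w x * deriv v x - c * (w x - c)) ∂ivol a b := by
      refine integral_congr_ae ?_
      filter_upwards [hvd] with x hx
      rw [hx]; ring
    rw [h6, integral_sub (MemLp_integrable_mul hw2 (H10.memLp_deriv hv))
      ((hz2.integrable one_le_two).const_mul c), h2, integral_const_mul, hz0]
    simp
  rw [integral_eq_zero_iff_of_nonneg (fun x => sq_nonneg _) hz2.integrable_sq] at h5
  refine ⟨c, ?_⟩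
  filter_upwards [h5] with x hx
  have : w x - c = 0 := by simpa using hx
  simp only [hw] at this
  linarith

lemma MemLp_coeff_mul {a b : ℝ} {c f : ℝ → ℝ} {C : ℝ}
    (hc : AEStronglyMeasurable c (ivol a b)) (hC : ∀ x ∈ Ioo a b, |c x| ≤ C)
    (hf : MemLp f 2 (ivol a b)) : MemLp (fun x => c x * f x) 2 (ivol a b) := by
  have hc' : MemLp c ⊤ (ivol a b) := memLp_top_of_bound hc C
    ((ae_restrict_iff' measurableSet_Ioo).2 (ae_of_all _ fun x hx => hC x hx))
  exact hf.mul hc'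

namespace FormData

variable {a b : ℝ} (F : FormData a b)

/-- The horizontal flux `ε (φ' - rψ)`. -/
noncomputable def flux₁ (u : F.Pairs) (x : ℝ) : ℝ := F.ε x * (deriv u.1.1 x - F.r * u.2.1 x)

/-- The vertical flux. -/
noncomputable def flux₂ (u : F.Pairs) (x : ℝ) : ℝ :=
  F.κ x * (deriv u.2.1 x + F.r * u.1.1 x) + F.ε x * (deriv u.2.1 x - F.r * u.1.1 x)
    + F.ε x * (1 / 3 * (deriv u.2.1 x + F.r * u.1.1 x))

/-- The right-hand side of the horizontal equation. -/
noncomputable def rhs₁ (m : ℝ) (u : F.Pairs) (x : ℝ) : ℝ :=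
  F.κ x * (F.r * (deriv u.2.1 x + F.r * u.1.1 x)) - F.ρ x * (F.γ * F.r * u.2.1 x)
    - F.ε x * (F.r * (deriv u.2.1 x - F.r * u.1.1 x))
    + F.ε x * (1 / 3 * F.r * (deriv u.2.1 x + F.r * u.1.1 x)) - F.ρ x * (m * u.1.1 x)

/-- The right-hand side of the vertical equation. -/
noncomputable def rhs₂ (m : ℝ) (u : F.Pairs) (x : ℝ) : ℝ :=
  -(F.ρ x * (F.γ * F.r * u.1.1 x)) - F.ε x * (F.r * (deriv u.1.1 x - F.r * u.2.1 x))
    - F.ρ x * (m * u.2.1 x)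

lemma memLp_flux_rhs (m : ℝ) (u : F.Pairs) :
    MemLp (F.flux₁ u) 2 (ivol a b) ∧ MemLp (F.flux₂ u) 2 (ivol a b) ∧
      MemLp (F.rhs₁ m u) 2 (ivol a b) ∧ MemLp (F.rhs₂ m u) 2 (ivol a b) := by
  have a1 := H10.memLp u.1.2
  have a2 := H10.memLp u.2.2
  have a3 := H10.memLp_deriv u.1.2
  have a4 := H10.memLp_deriv u.2.2
  have hκ : ∀ f : ℝ → ℝ, MemLp f 2 (ivol a b) → MemLp (fun x => F.κ x * f x) 2 (ivol a b) :=
    fun f hf => MemLp_coeff_mul F.κ_meas (fun _ hx => F.abs_κ_le hx) hf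
  have hε : ∀ f : ℝ → ℝ, MemLp f 2 (ivol a b) → MemLp (fun x => F.ε x * f x) 2 (ivol a b) :=
    fun f hf => MemLp_coeff_mul F.ε_meas (fun _ hx => F.abs_ε_le hx) hf
  have hρ : ∀ f : ℝ → ℝ, MemLp f 2 (ivol a b) → MemLp (fun x => F.ρ x * f x) 2 (ivol a b) :=
    fun f hf => MemLp_coeff_mul F.ρ_meas (fun _ hx => F.abs_ρ_le hx) hf
  have s1 := a4.add (a1.const_mul F.r)
  have s2 := a4.sub (a1.const_mul F.r)
  have s3 := a3.sub (a2.const_mul F.r)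
  refine ⟨hε _ s3, ((hκ _ s1).add (hε _ s2)).add (hε _ (s1.const_mul (1 / 3))), ?_, ?_⟩
  · exact ((((hκ _ (s1.const_mul F.r)).sub (hρ _ (a2.const_mul (F.γ * F.r)))).sub
      (hε _ (s2.const_mul F.r))).add (hε _ (s1.const_mul (1 / 3 * F.r)))).sub
      (hρ _ (a1.const_mul m))
  · exact (((hρ _ (a1.const_mul (F.γ * F.r))).neg).sub (hε _ (s3.const_mul F.r))).sub
      (hρ _ (a2.const_mul m))

/-- The strong Euler–Lagrange equations, integrated once. -/
theorem euler_lagrange {m : ℝ} {u : F.Pairs} (h : ∀ v, F.B u v = m * F.M u v) :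
    (∃ c, ∀ᵐ x ∂ivol a b, F.flux₁ u x = c + ∫ t in a..x, F.rhs₁ m u t) ∧
    ∃ c, ∀ᵐ x ∂ivol a b, F.flux₂ u x + (if x < 0 then F.τ * u.2.1 0 else 0)
      = c + ∫ t in a..x, F.rhs₂ m u t := by
  obtain ⟨m1, m2, m3, m4⟩ := F.memLp_flux_rhs m u
  constructor
  · refine du_bois_reymond F.lt m1 m3 fun v hv => ?_
    have h1 := h (⟨v, hv⟩, 0)
    rw [B_apply, M_apply, ← integral_const_mul] at h1
    have e0 : ((⟨v, hv⟩, 0) : F.Pairs).2.1 0 = 0 := rfl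
    rw [e0, mul_zero, zero_add, ← sub_eq_zero, ← integral_sub (F.integrable_densFun _ _)
      ((F.integrable_massFun _ _).const_mul _)] at h1
    refine Eq.trans ?_ h1
    refine integral_congr_ae (ae_of_all _ fun x => ?_)
    simp only [flux₁, rhs₁, densFun, dens, massFun, Submodule.coe_zero,
      Pi.zero_apply, deriv_zero]
    ring
  · have hs : MemLp (fun x => if x < 0 then F.τ * u.2.1 0 else 0) 2 (ivol a b) := by
      refine MemLp.of_bound (Measurable.aestronglyMeasurable ?_) |F.τ * u.2.1 0|
        (ae_of_all _ fun x => ?_)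
      · exact Measurable.ite measurableSet_Iio measurable_const measurable_const
      · split_ifs
        · exact le_rfl
        · simp only [norm_zero]; exact abs_nonneg _
    refine du_bois_reymond F.lt (m2.add hs) m4 fun v hv => ?_
    have h1 := h (0, ⟨v, hv⟩)
    rw [B_apply, M_apply, ← integral_const_mul] at h1
    -- Writing `v 0 = ∫_a^0 v'` turns the surface tension term into a step function added to the
    -- vertical flux. This step is the source of the stress jump.
    have e0 : F.τ * u.2.1 0 * ((0, ⟨v, hv⟩) : F.Pairs).2.1 0
        = ∫ x, (if x < 0 then F.τ * u.2.1 0 else 0) * deriv v x ∂ivol a b := by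
      have e1 := H10.integral_deriv hv (left_mem_Icc.2 F.lt.le) (y := 0) ⟨F.neg.le, F.pos.le⟩
      rw [H10.left hv, sub_zero, intervalIntegral_eq_ivol F.neg.le] at e1
      change F.τ * u.2.1 0 * v 0 = _
      rw [← e1, ← integral_const_mul]
      have e2 : (fun x => (if x < 0 then F.τ * u.2.1 0 else 0) * deriv v x)
          = (Iio 0).indicator (fun x => F.τ * u.2.1 0 * deriv v x) := by
        ext x; simp [indicator]
      have e3 : Iio 0 ∩ Ioo a b = Ioo a 0 := by
        ext x
        simp only [mem_Ioo, mem_inter_iff, mem_Iio]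
        exact ⟨fun hx => ⟨hx.2.1, hx.1⟩, fun hx => ⟨hx.2, hx.1, hx.2.trans F.pos⟩⟩
      rw [e2, integral_indicator measurableSet_Iio, Measure.restrict_restrict measurableSet_Iio, e3]
    have hi : Integrable (fun x => (if x < 0 then F.τ * u.2.1 0 else 0) * deriv v x
        + F.densFun u (0, ⟨v, hv⟩) x) (ivol a b) :=
      (MemLp_integrable_mul hs (H10.memLp_deriv hv)).add (F.integrable_densFun _ _)
    rw [e0, ← integral_add (MemLp_integrable_mul hs (H10.memLp_deriv hv)) (F.integrable_densFun _ _),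
      ← sub_eq_zero, ← integral_sub hi ((F.integrable_massFun _ _).const_mul _)] at h1
    refine Eq.trans ?_ h1
    refine integral_congr_ae (ae_of_all _ fun x => ?_)
    simp only [flux₂, rhs₂, densFun, dens, massFun, Submodule.coe_zero,
      Pi.zero_apply, deriv_zero]
    ring

end FormData

/-! ### Regularity in a layer -/

/-- A primitive of a continuous function on `[c, d]` is differentiable on `[c, d]`. -/
lemma hasDerivWithinAt_of_eq_integral {c d : ℝ} (hcd : c ≤ d) {f w : ℝ → ℝ}
    (hw : ContinuousOn w (Icc c d)) (h : ∀ x ∈ Icc c d, f x = f c + ∫ t in c..x, w t) {x : ℝ}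
    (hx : x ∈ Icc c d) : HasDerivWithinAt f (w x) (Icc c d) x := by
  -- A continuous extension to the line, so that the fundamental theorem of calculus also applies at
  -- the endpoints.
  set W : ℝ → ℝ := IccExtend hcd ((Icc c d).domRestrict w) with hW
  have hWc : Continuous W := hw.domRestrict.Icc_extend'
  have hWw : ∀ y ∈ Icc c d, W y = w y := fun y hy => by rw [hW, IccExtend_of_mem hcd _ hy]; rfl
  have h1 : HasDerivAt (fun y => f c + ∫ t in c..y, W t) (W x) x :=
    (hWc.integral_hasStrictDerivAt c x).hasDerivAt.const_add _
  rw [← hWw x hx]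
  refine h1.hasDerivWithinAt.congr (fun y hy => ?_) ?_
  · rw [h y hy]
    congr 1
    refine intervalIntegral.integral_congr fun t ht => (hWw t ?_).symm
    exact uIcc_subset_Icc (left_mem_Icc.2 hcd) hy ht
  · rw [h x hx]
    congr 1
    refine intervalIntegral.integral_congr fun t ht => (hWw t ?_).symm
    exact uIcc_subset_Icc (left_mem_Icc.2 hcd) hx ht

lemma contDiffOn_succ_of_hasDerivWithinAt {s : Set ℝ} (hs : UniqueDiffOn ℝ s) {f f' : ℝ → ℝ}
    {n : ℕ} (h : ∀ x ∈ s, HasDerivWithinAt f (f' x) s x) (hf' : ContDiffOn ℝ n f' s) :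
    ContDiffOn ℝ (n + 1) f s := by
  rw [contDiffOn_succ_iff_derivWithin hs]
  refine ⟨fun x hx => (h x hx).differentiableWithinAt, by simp, ?_⟩
  exact hf'.congr fun x hx => (h x hx).derivWithin (hs x hx)

/-- A mode profile `(φ, ψ)` with its fluxes `(f₁, f₂)`, smooth in the closed layer `[c, d]`. -/
structure LayerSolution (κ ε ρ : ℝ → ℝ) (γ r m c d : ℝ) (φ ψ f₁ f₂ : ℝ → ℝ) : Prop where
  smooth_φ : ContDiffOn ℝ ∞ φ (Icc c d)
  smooth_ψ : ContDiffOn ℝ ∞ ψ (Icc c d)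
  smooth_f₁ : ContDiffOn ℝ ∞ f₁ (Icc c d)
  smooth_f₂ : ContDiffOn ℝ ∞ f₂ (Icc c d)
  f₁_eq : ∀ x ∈ Ioo c d, f₁ x = ε x * (deriv φ x - r * ψ x)
  f₂_eq : ∀ x ∈ Ioo c d, f₂ x = κ x * (deriv ψ x + r * φ x) + ε x * (deriv ψ x - r * φ x)
    + ε x * (1 / 3 * (deriv ψ x + r * φ x))
  deriv_f₁ : ∀ x ∈ Ioo c d, HasDerivAt f₁ (κ x * (r * (deriv ψ x + r * φ x))
    - ρ x * (γ * r * ψ x) - ε x * (r * (deriv ψ x - r * φ x))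
    + ε x * (1 / 3 * r * (deriv ψ x + r * φ x)) - ρ x * (m * φ x)) x
  deriv_f₂ : ∀ x ∈ Ioo c d, HasDerivAt f₂ (-(ρ x * (γ * r * φ x))
    - ε x * (r * (deriv φ x - r * ψ x)) - ρ x * (m * ψ x)) x

/-- Bootstrap: solutions of the integrated first-order system are smooth up to the boundary. -/
lemma layerSolution_of_integral {κ ε ρ : ℝ → ℝ} {γ r m c d : ℝ} (hcd : c < d) {φ ψ f₁ f₂ : ℝ → ℝ}
    (hκ : ContDiffOn ℝ ∞ κ (Icc c d)) (hε : ContDiffOn ℝ ∞ ε (Icc c d))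
    (hρ : ContDiffOn ℝ ∞ ρ (Icc c d)) (hκ0 : ∀ x ∈ Icc c d, 0 ≤ κ x)
    (hε0 : ∀ x ∈ Icc c d, 0 < ε x) (cφ : ContinuousOn φ (Icc c d)) (cψ : ContinuousOn ψ (Icc c d))
    (cf₁ : ContinuousOn f₁ (Icc c d)) (cf₂ : ContinuousOn f₂ (Icc c d))
    (iφ : ∀ x ∈ Icc c d, φ x = φ c + ∫ t in c..x, deriv φ t)
    (iψ : ∀ x ∈ Icc c d, ψ x = ψ c + ∫ t in c..x, deriv ψ t)
    (if₁ : ∀ x ∈ Icc c d, f₁ x = f₁ c + ∫ t in c..x, (κ t * (r * (deriv ψ t + r * φ t))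
      - ρ t * (γ * r * ψ t) - ε t * (r * (deriv ψ t - r * φ t))
      + ε t * (1 / 3 * r * (deriv ψ t + r * φ t)) - ρ t * (m * φ t)))
    (if₂ : ∀ x ∈ Icc c d, f₂ x = f₂ c + ∫ t in c..x, (-(ρ t * (γ * r * φ t))
      - ε t * (r * (deriv φ t - r * ψ t)) - ρ t * (m * ψ t)))
    (e₁ : ∀ᵐ x ∂ivol c d, f₁ x = ε x * (deriv φ x - r * ψ x))
    (e₂ : ∀ᵐ x ∂ivol c d, f₂ x = κ x * (deriv ψ x + r * φ x) + ε x * (deriv ψ x - r * φ x)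
      + ε x * (1 / 3 * (deriv ψ x + r * φ x))) :
    LayerSolution κ ε ρ γ r m c d φ ψ f₁ f₂ := by
  set S := Icc c d with hS
  have hu : UniqueDiffOn ℝ S := uniqueDiffOn_Icc hcd
  have hε' : ∀ x ∈ S, ε x ≠ 0 := fun x hx => (hε0 x hx).ne'
  have hq' : ∀ x ∈ S, κ x + 4 / 3 * ε x ≠ 0 := fun x hx => by
    have := hκ0 x hx; have := hε0 x hx; positivity
  -- `P` and `R` are `φ'` and `ψ'` solved from the flux definitions; `ε > 0` and `κ ≥ 0` keep the
  -- divisors `ε` and `κ + 4ε/3` positive. `G₁`, `G₂` are the right-hand sides with these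
  -- substituted.
  set P : ℝ → ℝ := fun x => f₁ x / ε x + r * ψ x with hP
  set R : ℝ → ℝ := fun x => (f₂ x - (κ x - 2 / 3 * ε x) * (r * φ x)) / (κ x + 4 / 3 * ε x) with hR
  set G₁ : ℝ → ℝ := fun x => κ x * (r * (R x + r * φ x))
      - ρ x * (γ * r * ψ x) - ε x * (r * (R x - r * φ x))
      + ε x * (1 / 3 * r * (R x + r * φ x)) - ρ x * (m * φ x) with hG₁
  set G₂ : ℝ → ℝ := fun x => -(ρ x * (γ * r * φ x))
      - ε x * (r * (P x - r * ψ x)) - ρ x * (m * ψ x) with hG₂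
  have smooth : ∀ n : ℕ∞, ContDiffOn ℝ n φ S → ContDiffOn ℝ n ψ S → ContDiffOn ℝ n f₁ S →
      ContDiffOn ℝ n f₂ S → ContDiffOn ℝ n P S ∧ ContDiffOn ℝ n R S ∧ ContDiffOn ℝ n G₁ S ∧
        ContDiffOn ℝ n G₂ S := by
    intro n h1 h2 h3 h4
    have hn : (n : WithTop ℕ∞) ≤ ((⊤ : ℕ∞) : WithTop ℕ∞) := WithTop.coe_le_coe.2 le_top
    have k1 := hκ.of_le hn
    have k2 := hε.of_le hn
    have k3 := hρ.of_le hn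
    have hPs : ContDiffOn ℝ n P S := (h3.div k2 hε').add (contDiffOn_const.mul h2)
    have hRs : ContDiffOn ℝ n R S :=
      (h4.sub ((k1.sub (contDiffOn_const.mul k2)).mul (contDiffOn_const.mul h1))).div
        (k1.add (contDiffOn_const.mul k2)) hq'
    refine ⟨hPs, hRs, ?_, ?_⟩
    · fun_prop
    · fun_prop
  have c0 := smooth 0 (contDiffOn_zero.2 cφ) (contDiffOn_zero.2 cψ)
    (contDiffOn_zero.2 cf₁) (contDiffOn_zero.2 cf₂)
  obtain ⟨cP, cR, cG₁, cG₂⟩ := c0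
  have dP : ∀ᵐ x ∂ivol c d, deriv φ x = P x := by
    filter_upwards [e₁, ae_restrict_mem measurableSet_Ioo] with x hx hx'
    have := hε' x (Ioo_subset_Icc_self hx')
    simp only [hP, hx]
    field_simp
    ring
  have dR : ∀ᵐ x ∂ivol c d, deriv ψ x = R x := by
    filter_upwards [e₂, ae_restrict_mem measurableSet_Ioo] with x hx hx'
    have := hq' x (Ioo_subset_Icc_self hx')
    simp only [hR, hx]
    rw [eq_div_iff this]
    ring
  have congrInt : ∀ {f g : ℝ → ℝ}, (∀ᵐ x ∂ivol c d, f x = g x) → ∀ x ∈ S,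
      ∫ t in c..x, f t = ∫ t in c..x, g t := by
    intro f g hfg x hx
    rw [intervalIntegral_eq_ivol hx.1, intervalIntegral_eq_ivol hx.1]
    exact integral_congr_ae (ae_mono (Measure.restrict_mono (Ioo_subset_Ioo_right hx.2) le_rfl) hfg)
  have Dφ : ∀ x ∈ S, HasDerivWithinAt φ (P x) S x := fun x hx =>
    hasDerivWithinAt_of_eq_integral hcd.le cP.continuousOn
      (fun y hy => by rw [iφ y hy, congrInt dP y hy]) hx
  have Dψ : ∀ x ∈ S, HasDerivWithinAt ψ (R x) S x := fun x hx =>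
    hasDerivWithinAt_of_eq_integral hcd.le cR.continuousOn
      (fun y hy => by rw [iψ y hy, congrInt dR y hy]) hx
  have Df₁ : ∀ x ∈ S, HasDerivWithinAt f₁ (G₁ x) S x := fun x hx =>
    hasDerivWithinAt_of_eq_integral hcd.le cG₁.continuousOn
      (fun y hy => by
        rw [if₁ y hy, congrInt ?_ y hy]
        filter_upwards [dR] with t ht
        simp only [hG₁, ht]) hx
  have Df₂ : ∀ x ∈ S, HasDerivWithinAt f₂ (G₂ x) S x := fun x hx =>
    hasDerivWithinAt_of_eq_integral hcd.le cG₂.continuousOn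
      (fun y hy => by
        rw [if₂ y hy, congrInt ?_ y hy]
        filter_upwards [dP] with t ht
        simp only [hG₂, ht]) hx
  -- Each pass through the first-order system gains one derivative.
  have all : ∀ n : ℕ, ContDiffOn ℝ n φ S ∧ ContDiffOn ℝ n ψ S ∧ ContDiffOn ℝ n f₁ S ∧
      ContDiffOn ℝ n f₂ S := by
    intro n
    induction n with
    | zero =>
      exact ⟨contDiffOn_zero.2 cφ, contDiffOn_zero.2 cψ,
        contDiffOn_zero.2 cf₁, contDiffOn_zero.2 cf₂⟩
    | succ n ih =>
      obtain ⟨i1, i2, i3, i4⟩ := ih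
      obtain ⟨j1, j2, j3, j4⟩ := smooth n i1 i2 i3 i4
      exact ⟨contDiffOn_succ_of_hasDerivWithinAt hu Dφ j1,
        contDiffOn_succ_of_hasDerivWithinAt hu Dψ j2,
        contDiffOn_succ_of_hasDerivWithinAt hu Df₁ j3,
        contDiffOn_succ_of_hasDerivWithinAt hu Df₂ j4⟩
  have nb : ∀ x ∈ Ioo c d, S ∈ 𝓝 x := fun x hx => Icc_mem_nhds hx.1 hx.2
  have hφ' : ∀ x ∈ Ioo c d, deriv φ x = P x := fun x hx =>
    ((Dφ x (Ioo_subset_Icc_self hx)).hasDerivAt (nb x hx)).deriv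
  have hψ' : ∀ x ∈ Ioo c d, deriv ψ x = R x := fun x hx =>
    ((Dψ x (Ioo_subset_Icc_self hx)).hasDerivAt (nb x hx)).deriv
  refine ⟨contDiffOn_infty.2 fun n => (all n).1, contDiffOn_infty.2 fun n => (all n).2.1,
    contDiffOn_infty.2 fun n => (all n).2.2.1, contDiffOn_infty.2 fun n => (all n).2.2.2,
    fun x hx => ?_, fun x hx => ?_, fun x hx => ?_, fun x hx => ?_⟩
  · have := hε' x (Ioo_subset_Icc_self hx)
    rw [hφ' x hx, hP]
    field_simp
    ring
  · have := hq' x (Ioo_subset_Icc_self hx)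
    have h1 : R x * (κ x + 4 / 3 * ε x) = f₂ x - (κ x - 2 / 3 * ε x) * (r * φ x) := by
      rw [hR]; exact div_mul_cancel₀ _ this
    rw [hψ' x hx]
    linarith
  · rw [hψ' x hx]
    exact (Df₁ x (Ioo_subset_Icc_self hx)).hasDerivAt (nb x hx)
  · rw [hφ' x hx]
    exact (Df₂ x (Ioo_subset_Icc_self hx)).hasDerivAt (nb x hx)

/-! ### The steady state -/

/-- The inverse of an injective smooth function with nonvanishing derivative. -/
lemma invFunOn_Ioi_spec {h h' : ℝ → ℝ} (hc : ContDiffOn ℝ ∞ h (Ioi 0)) (hinj : InjOn h (Ioi 0))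
    (hd : ∀ z > 0, HasDerivAt h (h' z) z) (hd' : ∀ z > 0, h' z ≠ 0) {z : ℝ} (hz : 0 < z) :
    Function.invFunOn h (Ioi 0) (h z) = z ∧
      ContDiffAt ℝ ∞ (Function.invFunOn h (Ioi 0)) (h z) ∧
      HasDerivAt (Function.invFunOn h (Ioi 0)) (h' z)⁻¹ (h z) := by
  have hleft : ∀ y > 0, Function.invFunOn h (Ioi 0) (h y) = y := fun y hy =>
    hinj.leftInvOn_invFunOn hy
  have hca : ContDiffAt ℝ ∞ h z := hc.contDiffAt (Ioi_mem_nhds hz)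
  have hf := (hd z hz).hasFDerivAt_equiv (hd' z hz)
  have hn : (∞ : WithTop ℕ∞) ≠ 0 := by simp
  have hs := hca.hasStrictFDerivAt' hf hn
  -- Near `h z` the chosen global inverse coincides with the inverse function theorem's local one
  -- and inherits its smoothness.
  have hu := hs.localInverse_unique (g := Function.invFunOn h (Ioi 0))
    (by filter_upwards [Ioi_mem_nhds hz] with y hy using hleft y hy)
  have hcd : ContDiffAt ℝ ∞ (Function.invFunOn h (Ioi 0)) (h z) :=
    (hca.to_localInverse hf hn).congr_of_eventuallyEq hu
  refine ⟨hleft z hz, hcd, ?_⟩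
  refine HasDerivAt.of_local_left_inverse (f := h) hcd.continuousAt ?_ (hd' z hz) ?_
  · rw [hleft z hz]; exact hd z hz
  · filter_upwards [hu, hs.eventually_right_inverse] with y h1 h2
    rw [h1, h2]

namespace FluidData

variable (D : FluidData)

/-- The steady density of a fluid at the interface. -/
noncomputable def baseRho : Phase → ℝ
  | .lower => D.rhoMinus
  | .upper => D.rhoPlus

/-- The lower end of the layer occupied by a fluid. -/
def layerBot : Phase → ℝ
  | .lower => -D.m
  | .upper => 0

/-- The upper end of the layer occupied by a fluid. -/
def layerTop : Phase → ℝ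
  | .lower => 0
  | .upper => D.ℓ

/-- The steady density of one fluid, as a function of the height. -/
noncomputable def layerRho (a : Phase) (x : ℝ) : ℝ :=
  Function.invFunOn (D.enthalpy a) (Ioi 0) (D.enthalpy a (D.baseRho a) - D.g * x)

/-- `P'(ρ₀)` in one fluid. -/
noncomputable def layerdP (a : Phase) (x : ℝ) : ℝ := deriv (D.P a) (D.layerRho a x)

/-- `ε₀` in one fluid. -/
noncomputable def layerEps (a : Phase) (x : ℝ) : ℝ := D.eps a (D.layerRho a x)

/-- `δ₀` in one fluid. -/
noncomputable def layerDel (a : Phase) (x : ℝ) : ℝ := D.del a (D.layerRho a x)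

/-- The closed layer occupied by a fluid. -/
def layerIcc (a : Phase) : Set ℝ := Icc (D.layerBot a) (D.layerTop a)

/-- The open layer occupied by a fluid. -/
def layerIoo (a : Phase) : Set ℝ := Ioo (D.layerBot a) (D.layerTop a)

variable {D}

namespace Admissible

variable (hD : D.Admissible)

include hD

lemma layer_lt (a : Phase) : D.layerBot a < D.layerTop a := by
  cases a
  · exact neg_lt_zero.2 hD.m_pos
  · exact hD.ℓ_pos

lemma contDiffOn_dP (a : Phase) : ContDiffOn ℝ ∞ (deriv (D.P a)) (Ioi 0) :=
  (hD.P_smooth a).deriv_of_isOpen isOpen_Ioi (by simp)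

lemma contDiffOn_dP_div (a : Phase) : ContDiffOn ℝ ∞ (fun r => deriv (D.P a) r / r) (Ioi 0) :=
  (hD.contDiffOn_dP a).div contDiffOn_id fun _ hx => (mem_Ioi.1 hx).ne'

lemma hasDerivAt_enthalpy (a : Phase) {z : ℝ} (hz : 0 < z) :
    HasDerivAt (D.enthalpy a) (deriv (D.P a) z / z) z := by
  have hc := (hD.contDiffOn_dP_div a).continuousOn
  refine intervalIntegral.integral_hasDerivAt_right ?_ ?_ ?_
  · refine (hc.mono ?_).intervalIntegrable
    intro x hx
    exact (lt_min one_pos hz).trans_le hx.1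
  · exact hc.stronglyMeasurableAtFilter isOpen_Ioi z hz
  · exact hc.continuousAt (Ioi_mem_nhds hz)

lemma contDiffOn_enthalpy (a : Phase) : ContDiffOn ℝ ∞ (D.enthalpy a) (Ioi 0) := by
  rw [contDiffOn_infty_iff_deriv_of_isOpen isOpen_Ioi]
  refine ⟨fun z hz => (hD.hasDerivAt_enthalpy a hz).differentiableAt.differentiableWithinAt, ?_⟩
  exact (hD.contDiffOn_dP_div a).congr fun z hz => (hD.hasDerivAt_enthalpy a hz).deriv

lemma strictMonoOn_enthalpy (a : Phase) : StrictMonoOn (D.enthalpy a) (Ioi 0) := by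
  refine strictMonoOn_of_deriv_pos (convex_Ioi 0) (hD.contDiffOn_enthalpy a).continuousOn ?_
  intro z hz
  rw [interior_Ioi] at hz
  rw [(hD.hasDerivAt_enthalpy a hz).deriv]
  exact div_pos (hD.P_deriv_pos a z hz) hz

lemma rhoPlus_spec : 0 < D.rhoPlus ∧ D.P .upper D.rhoPlus = D.P .lower D.rhoMinus :=
  ⟨Function.invFunOn_mem hD.rhoMinus_mem, Function.invFunOn_eq hD.rhoMinus_mem⟩

lemma jumpRho_pos : 0 < D.jumpRho := by
  obtain ⟨h1, h2⟩ := hD.rhoPlus_spec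
  have h3 := hD.rhoMinus_unstable
  rw [← h2] at h3
  exact sub_pos.2 (((hD.P_strictMono .upper).lt_iff_lt hD.rhoMinus_pos h1).1 h3)

lemma baseRho_pos (a : Phase) : 0 < D.baseRho a := by
  cases a
  · exact hD.rhoMinus_pos
  · exact hD.rhoPlus_spec.1

/-- The range of the enthalpy is an interval, and the value lies between those at the interface and
at the wall, which belong to the range by assumption. -/
lemma enthalpy_mem (a : Phase) {x : ℝ} (hx : x ∈ D.layerIcc a) :
    D.enthalpy a (D.baseRho a) - D.g * x ∈ D.enthalpy a '' Ioi 0 := by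
  have hoc : OrdConnected (D.enthalpy a '' Ioi 0) :=
    (isPreconnected_Ioi.image _ (hD.contDiffOn_enthalpy a).continuousOn).ordConnected
  have h1 : D.enthalpy a (D.baseRho a) ∈ D.enthalpy a '' Ioi 0 :=
    mem_image_of_mem _ (hD.baseRho_pos a)
  have hg := hD.g_pos
  cases a
  · obtain ⟨hx1, hx2⟩ := hx
    simp only [layerBot, layerTop] at hx1 hx2
    refine hoc.out h1 hD.m_range ⟨?_, ?_⟩
    · nlinarith
    · change D.enthalpy .lower D.rhoMinus - D.g * x ≤ D.enthalpy .lower D.rhoMinus + D.g * D.m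
      nlinarith
  · obtain ⟨hx1, hx2⟩ := hx
    simp only [layerBot, layerTop] at hx1 hx2
    refine hoc.out hD.ℓ_range h1 ⟨?_, ?_⟩
    · change D.enthalpy .upper D.rhoPlus - D.g * D.ℓ ≤ D.enthalpy .upper D.rhoPlus - D.g * x
      nlinarith
    · nlinarith

/-- Differentiating `h(ρ₀) = const - g x₃` with `h' = P'/z` gives the hydrostatic balance `P'(ρ₀)
ρ₀' = -g ρ₀`. -/
lemma layerRho_spec (a : Phase) {x : ℝ} (hx : x ∈ D.layerIcc a) :
    0 < D.layerRho a x ∧ ContDiffAt ℝ ∞ (D.layerRho a) x ∧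
      HasDerivAt (D.layerRho a) (-(D.g * D.layerRho a x / D.layerdP a x)) x := by
  obtain ⟨z, hz, hzx⟩ := hD.enthalpy_mem a hx
  rw [mem_Ioi] at hz
  obtain ⟨h1, h2, h3⟩ := invFunOn_Ioi_spec (hD.contDiffOn_enthalpy a)
    (hD.strictMonoOn_enthalpy a).injOn (fun z hz => hD.hasDerivAt_enthalpy a hz)
    (fun z hz => (div_pos (hD.P_deriv_pos a z hz) hz).ne') hz
  have h4 : D.layerRho a x = z := by rw [layerRho, ← hzx, h1]
  rw [hzx] at h2 h3
  have h5 : HasDerivAt (fun x => D.enthalpy a (D.baseRho a) - D.g * x) (-D.g) x := by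
    simpa using ((hasDerivAt_id x).const_mul D.g).const_sub (D.enthalpy a (D.baseRho a))
  refine ⟨h4 ▸ hz, h2.comp x (by fun_prop), ?_⟩
  have h6 := h3.comp x h5
  rw [layerdP, h4]
  convert! h6 using 1
  rw [inv_div]
  ring

lemma layerRho_zero (a : Phase) : D.layerRho a 0 = D.baseRho a := by
  rw [layerRho, mul_zero, sub_zero]
  exact (hD.strictMonoOn_enthalpy a).injOn.leftInvOn_invFunOn (hD.baseRho_pos a)

lemma layerRho_pos (a : Phase) {x : ℝ} (hx : x ∈ D.layerIcc a) : 0 < D.layerRho a x :=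
  (hD.layerRho_spec a hx).1

lemma contDiffOn_layerRho (a : Phase) : ContDiffOn ℝ ∞ (D.layerRho a) (D.layerIcc a) :=
  fun _ hx => (hD.layerRho_spec a hx).2.1.contDiffWithinAt

lemma layerdP_pos (a : Phase) {x : ℝ} (hx : x ∈ D.layerIcc a) : 0 < D.layerdP a x :=
  hD.P_deriv_pos a _ (hD.layerRho_pos a hx)

lemma layerEps_pos (a : Phase) {x : ℝ} (hx : x ∈ D.layerIcc a) : 0 < D.layerEps a x :=
  hD.eps_pos a _ (hD.layerRho_pos a hx)

lemma layerDel_nonneg (a : Phase) {x : ℝ} (hx : x ∈ D.layerIcc a) : 0 ≤ D.layerDel a x :=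
  hD.del_nonneg a _ (hD.layerRho_pos a hx)

lemma contDiffOn_layerdP (a : Phase) : ContDiffOn ℝ ∞ (D.layerdP a) (D.layerIcc a) :=
  (hD.contDiffOn_dP a).comp (hD.contDiffOn_layerRho a) fun _ hx => hD.layerRho_pos a hx

lemma contDiffOn_layerEps (a : Phase) : ContDiffOn ℝ ∞ (D.layerEps a) (D.layerIcc a) :=
  (hD.eps_smooth a).comp (hD.contDiffOn_layerRho a) fun _ hx => hD.layerRho_pos a hx

lemma contDiffOn_layerDel (a : Phase) : ContDiffOn ℝ ∞ (D.layerDel a) (D.layerIcc a) :=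
  (hD.del_smooth a).comp (hD.contDiffOn_layerRho a) fun _ hx => hD.layerRho_pos a hx

end Admissible

lemma phaseAt_eq {a : Phase} {x : ℝ} (hx : x ∈ D.layerIoo a) : phaseAt x = a := by
  cases a
  · exact if_pos hx.2
  · exact if_neg (not_lt.2 (le_of_lt hx.1))

lemma rho0_eq {a : Phase} {x : ℝ} (hx : x ∈ D.layerIoo a) : D.rho0 x = D.layerRho a x := by
  cases a
  · exact if_pos hx.2
  · exact if_neg (not_lt.2 (le_of_lt hx.1))

lemma dP0_eq {a : Phase} {x : ℝ} (hx : x ∈ D.layerIoo a) : D.dP0 x = D.layerdP a x := by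
  rw [dP0, phaseAt_eq hx, rho0_eq hx, layerdP]

lemma eps0_eq {a : Phase} {x : ℝ} (hx : x ∈ D.layerIoo a) : D.eps0 x = D.layerEps a x := by
  rw [eps0, phaseAt_eq hx, rho0_eq hx, layerEps]

lemma del0_eq {a : Phase} {x : ℝ} (hx : x ∈ D.layerIoo a) : D.del0 x = D.layerDel a x := by
  rw [del0, phaseAt_eq hx, rho0_eq hx, layerDel]

lemma layerIoo_subset (a : Phase) : D.layerIoo a ⊆ D.layerIcc a := Ioo_subset_Icc_self

lemma isOpen_layerIoo (a : Phase) : IsOpen (D.layerIoo a) := isOpen_Ioo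

/-- A function that agrees in each layer with a continuous function is measurable. -/
lemma aestronglyMeasurable_of_layers (hm : 0 < D.m) (hl : 0 < D.ℓ) {f : ℝ → ℝ}
    {c : Phase → ℝ → ℝ} (hc : ∀ a, ContinuousOn (c a) (D.layerIcc a))
    (hf : ∀ a, ∀ x ∈ D.layerIoo a, f x = c a x) :
    AEStronglyMeasurable f (ivol (-D.m) D.ℓ) := by
  have key : ∀ a, AEStronglyMeasurable f (volume.restrict (D.layerIoo a)) := fun a =>
    ((hc a).mono (layerIoo_subset a)).congr (hf a) |>.aestronglyMeasurable
      (isOpen_layerIoo a).measurableSet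
  have h1 : AEStronglyMeasurable f
      (volume.restrict (D.layerIoo .lower ∪ D.layerIoo .upper)) := by
    rw [aestronglyMeasurable_union_iff]
    exact ⟨key _, key _⟩
  have h2 : (D.layerIoo .lower ∪ D.layerIoo .upper : Set ℝ) =ᵐ[volume] Ioo (-D.m) D.ℓ := by
    have h0 : ∀ᵐ x : ℝ, x ≠ 0 := by simp [ae_iff]
    filter_upwards [h0] with x hx0
    refine propext ⟨?_, ?_⟩
    · rintro (hx | hx)
      · exact ⟨hx.1, lt_trans hx.2 hl⟩
      · exact ⟨lt_trans (neg_lt_zero.2 hm) hx.1, hx.2⟩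
    · intro hx
      rcases lt_or_gt_of_ne hx0 with h | h
      · exact .inl ⟨hx.1, h⟩
      · exact .inr ⟨h, hx.2⟩
  rwa [Measure.restrict_congr_set h2] at h1

/-- Uniform bounds for the coefficients. -/
lemma Admissible.exists_bounds (hD : D.Admissible) :
    ∃ lo hi : ℝ, 0 < lo ∧ 0 < hi ∧ ∀ x ∈ Ioo (-D.m) D.ℓ,
      (lo ≤ D.rho0 x ∧ D.rho0 x ≤ hi) ∧ (lo ≤ D.eps0 x ∧ D.eps0 x ≤ hi) ∧
      (0 ≤ D.del0 x ∧ D.del0 x ≤ hi) ∧ (lo ≤ D.dP0 x ∧ D.dP0 x ≤ hi) := by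
  have key : ∀ (a : Phase) (f : ℝ → ℝ), ContinuousOn f (D.layerIcc a) →
      (∀ x ∈ D.layerIcc a, 0 < f x) → ∃ l h : ℝ, 0 < l ∧ ∀ x ∈ D.layerIcc a, l ≤ f x ∧ f x ≤ h := by
    intro a f hf hpos
    have hne : (D.layerIcc a).Nonempty := nonempty_Icc.2 (hD.layer_lt a).le
    obtain ⟨y, hy, hy'⟩ := isCompact_Icc.exists_isMinOn hne hf
    obtain ⟨z, hz, hz'⟩ := isCompact_Icc.exists_isMaxOn hne hf
    exact ⟨f y, f z, hpos y hy, fun x hx => ⟨hy' hx, hz' hx⟩⟩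
  have layer : ∀ a, ∃ l h : ℝ, 0 < l ∧ 0 < h ∧ ∀ x ∈ D.layerIcc a,
      (l ≤ D.layerRho a x ∧ D.layerRho a x ≤ h) ∧ (l ≤ D.layerEps a x ∧ D.layerEps a x ≤ h) ∧
      (0 ≤ D.layerDel a x ∧ D.layerDel a x ≤ h) ∧ (l ≤ D.layerdP a x ∧ D.layerdP a x ≤ h) := by
    intro a
    obtain ⟨l1, h1, p1, b1⟩ := key a _ (hD.contDiffOn_layerRho a).continuousOn
      fun x hx => hD.layerRho_pos a hx
    obtain ⟨l2, h2, p2, b2⟩ := key a _ (hD.contDiffOn_layerEps a).continuousOn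
      fun x hx => hD.layerEps_pos a hx
    -- The bulk viscosity may vanish, while `key` needs a positive function; only the upper bound is
    -- kept.
    obtain ⟨l3, h3, p3, b3⟩ := key a (fun x => D.layerDel a x + 1)
      ((hD.contDiffOn_layerDel a).continuousOn.add continuousOn_const)
      fun x hx => by linarith [hD.layerDel_nonneg a hx]
    obtain ⟨l4, h4, p4, b4⟩ := key a _ (hD.contDiffOn_layerdP a).continuousOn
      fun x hx => hD.layerdP_pos a hx
    refine ⟨min l1 (min l2 l4), max 1 (max (max h1 h2) (max h3 h4)),
      lt_min p1 (lt_min p2 p4), lt_max_of_lt_left one_pos, fun x hx => ?_⟩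
    have e1 := b1 x hx
    have e2 := b2 x hx
    have e3 := b3 x hx
    have e4 := b4 x hx
    have e5 := hD.layerDel_nonneg a hx
    refine ⟨⟨?_, ?_⟩, ⟨?_, ?_⟩, ⟨e5, ?_⟩, ⟨?_, ?_⟩⟩ <;> grind
  obtain ⟨l1, h1, p1, q1, b1⟩ := layer .lower
  obtain ⟨l2, h2, p2, q2, b2⟩ := layer .upper
  refine ⟨min l1 l2, max h1 h2, lt_min p1 p2, lt_max_of_lt_left q1, fun x hx => ?_⟩
  by_cases h : x < 0
  · have hx' : x ∈ D.layerIoo .lower := ⟨hx.1, h⟩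
    obtain ⟨e1, e2, e3, e4⟩ := b1 x (layerIoo_subset _ hx')
    rw [rho0_eq hx', eps0_eq hx', del0_eq hx', dP0_eq hx']
    grind
  -- The closed layer is needed here: `x = 0` falls on the upper branch of the profile.
  · have hx' : x ∈ D.layerIcc .upper := ⟨not_lt.1 h, hx.2.le⟩
    obtain ⟨e1, e2, e3, e4⟩ := b2 x hx'
    have f1 : D.rho0 x = D.layerRho .upper x := if_neg h
    have f2 : phaseAt x = .upper := if_neg h
    have f3 : D.eps0 x = D.layerEps .upper x := by rw [eps0, f1, f2, layerEps]
    have f4 : D.del0 x = D.layerDel .upper x := by rw [del0, f1, f2, layerDel]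
    have f5 : D.dP0 x = D.layerdP .upper x := by rw [dP0, f1, f2, layerdP]
    rw [f1, f3, f4, f5]
    grind

end FluidData

namespace FluidData

variable {D : FluidData}

namespace Admissible

variable (hD : D.Admissible)

include hD

/-! ### The energy as a quadratic form -/

lemma neg_lt : -D.m < D.ℓ := (neg_lt_zero.2 hD.m_pos).trans hD.ℓ_pos

omit hD in
/-- A lower bound for the coefficients. -/
noncomputable def lo (hD : D.Admissible) : ℝ := hD.exists_bounds.choose

omit hD in
/-- An upper bound for the coefficients. -/
noncomputable def hi (hD : D.Admissible) : ℝ := hD.exists_bounds.choose_spec.choose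

lemma lo_pos : 0 < hD.lo := hD.exists_bounds.choose_spec.choose_spec.1

lemma hi_pos : 0 < hD.hi := hD.exists_bounds.choose_spec.choose_spec.2.1

lemma bounds {x : ℝ} (hx : x ∈ Ioo (-D.m) D.ℓ) :
    (hD.lo ≤ D.rho0 x ∧ D.rho0 x ≤ hD.hi) ∧ (hD.lo ≤ D.eps0 x ∧ D.eps0 x ≤ hD.hi) ∧
      (0 ≤ D.del0 x ∧ D.del0 x ≤ hD.hi) ∧ (hD.lo ≤ D.dP0 x ∧ D.dP0 x ≤ hD.hi) :=
  hD.exists_bounds.choose_spec.choose_spec.2.2 x hx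

/-- The energy at frequency modulus `r` with viscosities scaled by `s`, as a quadratic form. -/
noncomputable def form {r s : ℝ} (hr : 0 < r) (hs : 0 < s) : FormData (-D.m) D.ℓ where
  κ x := s * D.del0 x + D.dP0 x * D.rho0 x
  ε x := s * D.eps0 x
  ρ := D.rho0
  τ := D.σ * r ^ 2
  γ := D.g
  r := r
  -- One pair of bounds must serve both `ρ₀` and the viscosity `s ε₀`.
  lo := min hD.lo (s * hD.lo)
  hi := max hD.hi (max (s * hD.hi) (s * hD.hi + hD.hi * hD.hi))
  neg := neg_lt_zero.2 hD.m_pos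
  pos := hD.ℓ_pos
  τ_nonneg := mul_nonneg hD.σ_nonneg (sq_nonneg r)
  γ_nonneg := hD.g_pos.le
  r_pos := hr
  lo_pos := lt_min hD.lo_pos (mul_pos hs hD.lo_pos)
  κ_meas := aestronglyMeasurable_of_layers hD.m_pos hD.ℓ_pos
    (c := fun a x => s * D.layerDel a x + D.layerdP a x * D.layerRho a x)
    (fun a => (continuousOn_const.mul (hD.contDiffOn_layerDel a).continuousOn).add
      ((hD.contDiffOn_layerdP a).continuousOn.mul (hD.contDiffOn_layerRho a).continuousOn))
    (fun a x hx => by rw [rho0_eq hx, dP0_eq hx, del0_eq hx])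
  ε_meas := aestronglyMeasurable_of_layers hD.m_pos hD.ℓ_pos
    (c := fun a x => s * D.layerEps a x)
    (fun a => continuousOn_const.mul (hD.contDiffOn_layerEps a).continuousOn)
    (fun a x hx => by rw [eps0_eq hx])
  ρ_meas := aestronglyMeasurable_of_layers hD.m_pos hD.ℓ_pos
    (c := D.layerRho) (fun a => (hD.contDiffOn_layerRho a).continuousOn)
    (fun a x hx => rho0_eq hx)
  κ_bd x hx := by
    obtain ⟨⟨b1, b2⟩, ⟨b3, b4⟩, ⟨b5, b6⟩, ⟨b7, b8⟩⟩ := hD.bounds hx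
    have hlo := hD.lo_pos
    refine ⟨add_nonneg (mul_nonneg hs.le b5) (mul_nonneg (hlo.le.trans b7) (hlo.le.trans b1)), ?_⟩
    refine le_trans (add_le_add (mul_le_mul_of_nonneg_left b6 hs.le) ?_)
      ((le_max_right _ _).trans (le_max_right _ _))
    exact mul_le_mul b8 b2 (hlo.le.trans b1) hD.hi_pos.le
  ε_bd x hx := by
    obtain ⟨-, ⟨b3, b4⟩, -, -⟩ := hD.bounds hx
    exact ⟨(min_le_right _ _).trans (mul_le_mul_of_nonneg_left b3 hs.le),
      (mul_le_mul_of_nonneg_left b4 hs.le).trans ((le_max_left _ _).trans (le_max_right _ _))⟩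
  ρ_bd x hx := by
    obtain ⟨⟨b1, b2⟩, -, -, -⟩ := hD.bounds hx
    exact ⟨(min_le_left _ _).trans b1, b2.trans (le_max_left _ _)⟩

omit hD in
/-- The pairs of `H¹₀` functions; this is the type of arguments of each `form`. -/
abbrev HPairs (hD : D.Admissible) : Type := H10 (-D.m) D.ℓ hD.neg_lt × H10 (-D.m) D.ℓ hD.neg_lt

variable {r s : ℝ} (hr : 0 < r) (hs : 0 < s)

/-- `M` and `B` omit the factor `½`, so the constraint reads `M u u = 2` and minimality reads `B u u
= 2μ`. -/
lemma constraintJ_eq (u : hD.HPairs) :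
    D.constraintJ u.1.1 u.2.1 = 1 / 2 * (hD.form hr hs).M u u := by
  rw [constraintJ, intervalIntegral_eq_ivol hD.neg_lt.le, FormData.M_apply]
  congr 2
  ext x
  simp only [FormData.massFun, form]
  ring

/-- The shear part of the energy density. -/
noncomputable def shearFun (D : FluidData) (r : ℝ) (φ ψ : ℝ → ℝ) (x : ℝ) : ℝ :=
  D.eps0 x * ((deriv φ x - r * ψ x) ^ 2 + (deriv ψ x - r * φ x) ^ 2
    + 1 / 3 * (deriv ψ x + r * φ x) ^ 2)

lemma integrable_shearFun (u : hD.HPairs) :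
    Integrable (shearFun D r u.1.1 u.2.1) (ivol (-D.m) D.ℓ) := by
  have a1 := H10.memLp u.1.2
  have a2 := H10.memLp u.2.2
  have a3 := H10.memLp_deriv u.1.2
  have a4 := H10.memLp_deriv u.2.2
  -- The form at `r = s = 1` is used only to borrow measurability and bounds of `ε₀`.
  have hm := (hD.form (r := 1) (s := 1) one_pos one_pos).ε_meas
  have hb : ∀ x ∈ Ioo (-D.m) D.ℓ, |1 * D.eps0 x| ≤ _ := fun x hx =>
    (hD.form (r := 1) (s := 1) one_pos one_pos).abs_ε_le hx
  have s1 := a4.add (a1.const_mul r)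
  have s2 := a4.sub (a1.const_mul r)
  have s3 := a3.sub (a2.const_mul r)
  have i1 := integrable_coeff_mul hm hb s3 s3
  have i2 := integrable_coeff_mul hm hb s2 s2
  have i3 := integrable_coeff_mul hm hb (s1.const_mul (1 / 3)) s1
  refine ((i1.add i2).add i3).congr (ae_of_all _ fun x => ?_)
  simp only [form, shearFun, Pi.add_apply, Pi.sub_apply]
  ring

lemma densFun_self (u : hD.HPairs) (x : ℝ) : (hD.form hr hs).densFun u u x =
    ((s * D.del0 x + D.dP0 x * D.rho0 x) * (deriv u.2.1 x + r * u.1.1 x) ^ 2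
      - 2 * D.g * D.rho0 x * r * u.1.1 x * u.2.1 x) + s * shearFun D r u.1.1 u.2.1 x := by
  simp only [FormData.densFun, FormData.dens, form, shearFun]
  ring

lemma energy_eq (u : hD.HPairs) :
    D.energy r s u.1.1 u.2.1 = 1 / 2 * (hD.form hr hs).B u u := by
  have h1 := (hD.form hr hs).integrable_densFun u u
  have h2 := (hD.integrable_shearFun (r := r) u).const_mul s
  have h3 : Integrable (fun x => (s * D.del0 x + D.dP0 x * D.rho0 x)
      * (deriv u.2.1 x + r * u.1.1 x) ^ 2
      - 2 * D.g * D.rho0 x * r * u.1.1 x * u.2.1 x) (ivol (-D.m) D.ℓ) := by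
    refine (h1.sub h2).congr (ae_of_all _ fun x => ?_)
    rw [Pi.sub_apply, densFun_self]
    ring
  rw [FormData.B_apply]
  simp_rw [densFun_self]
  rw [integral_add h3 h2, energy, intervalIntegral_eq_ivol hD.neg_lt.le,
    intervalIntegral_eq_ivol hD.neg_lt.le]
  have h4 : ∀ x, s * D.eps0 x * ((deriv u.1.1 x - r * u.2.1 x) ^ 2
      + (deriv u.2.1 x - r * u.1.1 x) ^ 2 + 1 / 3 * (deriv u.2.1 x + r * u.1.1 x) ^ 2)
      = s * shearFun D r u.1.1 u.2.1 x := fun x => by rw [shearFun]; ring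
  simp_rw [h4]
  simp only [form]
  ring

/-! ### Integration by parts against the steady density -/

lemma measurable_rho_div_dP :
    AEStronglyMeasurable (fun x => D.rho0 x / D.dP0 x) (ivol (-D.m) D.ℓ) :=
  aestronglyMeasurable_of_layers hD.m_pos hD.ℓ_pos
    (c := fun a x => D.layerRho a x / D.layerdP a x)
    (fun a => (hD.contDiffOn_layerRho a).continuousOn.div (hD.contDiffOn_layerdP a).continuousOn
      fun _ hx => (hD.layerdP_pos a hx).ne')
    (fun a x hx => by rw [rho0_eq hx, dP0_eq hx])

lemma rho_div_dP_bound {x : ℝ} (hx : x ∈ Ioo (-D.m) D.ℓ) :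
    0 ≤ D.rho0 x / D.dP0 x ∧ D.rho0 x / D.dP0 x ≤ hD.hi / hD.lo := by
  obtain ⟨⟨b1, b2⟩, -, -, ⟨b7, b8⟩⟩ := hD.bounds hx
  have hlo := hD.lo_pos
  exact ⟨div_nonneg (hlo.le.trans b1) (hlo.le.trans b7), div_le_div₀ hD.hi_pos.le b2 hlo b7⟩

lemma integrable_rho_div_dP_mul {ψ : ℝ → ℝ} (hψ : ψ ∈ H10 (-D.m) D.ℓ hD.neg_lt) :
    Integrable (fun x => D.rho0 x / D.dP0 x * (ψ x * ψ x)) (ivol (-D.m) D.ℓ) :=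
  integrable_coeff_mul hD.measurable_rho_div_dP (fun x hx => by
    rw [abs_of_nonneg (hD.rho_div_dP_bound hx).1]; exact (hD.rho_div_dP_bound hx).2)
    (H10.memLp hψ) (H10.memLp hψ)

lemma integrable_rho_mul_deriv {ψ : ℝ → ℝ} (hψ : ψ ∈ H10 (-D.m) D.ℓ hD.neg_lt) :
    Integrable (fun x => D.rho0 x * (ψ x * deriv ψ x)) (ivol (-D.m) D.ℓ) :=
  integrable_coeff_mul (hD.form (r := 1) (s := 1) one_pos one_pos).ρ_meas
    (fun _ hx => (hD.form (r := 1) (s := 1) one_pos one_pos).abs_ρ_le hx)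
    (H10.memLp hψ) (H10.memLp_deriv hψ)

/-- Integrate `(ρ₀ψ²)'` over each layer and use `ρ₀' = -gρ₀/P'(ρ₀)`. The wall terms vanish and the
two interface terms combine into the density jump. -/
lemma integral_rho_mul_deriv {ψ : ℝ → ℝ} (hψ : ψ ∈ H10 (-D.m) D.ℓ hD.neg_lt) :
    2 * ∫ x, D.rho0 x * (ψ x * deriv ψ x) ∂ivol (-D.m) D.ℓ
      = -(D.jumpRho * ψ 0 ^ 2) + D.g * ∫ x, D.rho0 x / D.dP0 x * (ψ x * ψ x) ∂ivol (-D.m) D.ℓ := by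
  set f : ℝ → ℝ := fun x => 2 * (D.rho0 x * (ψ x * deriv ψ x))
    - D.g * (D.rho0 x / D.dP0 x * (ψ x * ψ x)) with hf
  have hfi : Integrable f (ivol (-D.m) D.ℓ) := ((hD.integrable_rho_mul_deriv hψ).const_mul 2).sub
    ((hD.integrable_rho_div_dP_mul hψ).const_mul D.g)
  have hfint : ∫ x, f x ∂ivol (-D.m) D.ℓ = 2 * ∫ x, D.rho0 x * (ψ x * deriv ψ x) ∂ivol (-D.m) D.ℓ
      - D.g * ∫ x, D.rho0 x / D.dP0 x * (ψ x * ψ x) ∂ivol (-D.m) D.ℓ := by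
    rw [hf, integral_sub ((hD.integrable_rho_mul_deriv hψ).const_mul 2)
      ((hD.integrable_rho_div_dP_mul hψ).const_mul D.g), integral_const_mul, integral_const_mul]
  have layer : ∀ a : Phase, Icc (D.layerBot a) (D.layerTop a) ⊆ Icc (-D.m) D.ℓ →
      ∫ x in (D.layerBot a)..(D.layerTop a), f x
      = D.layerRho a (D.layerTop a) * (ψ (D.layerTop a) * ψ (D.layerTop a))
        - D.layerRho a (D.layerBot a) * (ψ (D.layerBot a) * ψ (D.layerBot a)) := by
    intro a hsub
    have hlt := hD.layer_lt a
    have ac1 : AbsolutelyContinuousOnInterval (D.layerRho a) (D.layerBot a) (D.layerTop a) := by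
      refine ContDiffOn.absolutelyContinuousOnInterval ?_
      rw [uIcc_of_le hlt.le]
      exact (hD.contDiffOn_layerRho a).of_le (by exact_mod_cast le_top)
    have acψ : AbsolutelyContinuousOnInterval ψ (D.layerBot a) (D.layerTop a) := by
      refine (H10.ac hψ).mono ?_
      rwa [uIcc_of_le hlt.le, uIcc_of_le hD.neg_lt.le]
    have ac2 := acψ.fun_mul acψ
    rw [← ac1.integral_deriv_mul_eq_sub ac2]
    rw [intervalIntegral_eq_ivol hlt.le, intervalIntegral_eq_ivol hlt.le]
    refine integral_congr_ae ?_
    filter_upwards [ae_ivol_of_ae_uIcc hlt.le acψ.ae_differentiableAt,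
      ae_restrict_mem measurableSet_Ioo] with x hx hx'
    have e1 := (hD.layerRho_spec a (layerIoo_subset a hx')).2.2.deriv
    have e2 : deriv (fun y => ψ y * ψ y) x = deriv ψ x * ψ x + ψ x * deriv ψ x :=
      (hx.hasDerivAt.mul hx.hasDerivAt).deriv
    rw [e1, e2, hf]
    simp only
    rw [rho0_eq hx', dP0_eq hx']
    ring
  have h1 := layer .lower (Icc_subset_Icc_right hD.ℓ_pos.le)
  have h2 := layer .upper (Icc_subset_Icc_left (neg_nonpos.2 hD.m_pos.le))
  simp only [layerBot, layerTop] at h1 h2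
  rw [hD.layerRho_zero .lower, H10.left hψ] at h1
  rw [hD.layerRho_zero .upper, H10.right hψ] at h2
  have ii : ∀ c d, Icc c d ⊆ Icc (-D.m) D.ℓ → c ≤ d → IntervalIntegrable f volume c d := by
    intro c d hcd hle
    rw [intervalIntegrable_iff_integrableOn_Icc_of_le hle]
    refine IntegrableOn.mono_set ?_ hcd
    rw [integrableOn_Icc_iff_integrableOn_Ioo]
    exact hfi
  have h3 := intervalIntegral.integral_add_adjacent_intervals
    (ii (-D.m) 0 (Icc_subset_Icc_right hD.ℓ_pos.le) (neg_nonpos.2 hD.m_pos.le))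
    (ii 0 D.ℓ (Icc_subset_Icc_left (neg_nonpos.2 hD.m_pos.le)) hD.ℓ_pos.le)
  rw [h1, h2, intervalIntegral_eq_ivol hD.neg_lt.le, hfint] at h3
  simp only [jumpRho]
  simp only [baseRho] at h3
  linarith

/-- The energy is nonnegative up to the interface term. -/
lemma interface_le_B (u : hD.HPairs) :
    (D.σ * r ^ 2 - D.g * D.jumpRho) * u.2.1 0 ^ 2 ≤ (hD.form hr hs).B u u := by
  have h1 := hD.integral_rho_mul_deriv u.2.2
  have i1 := (hD.integrable_rho_mul_deriv u.2.2).const_mul (2 * D.g)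
  have i2 := (hD.integrable_rho_div_dP_mul u.2.2).const_mul (D.g ^ 2)
  have h2 : ∫ x, (2 * D.g * (D.rho0 x * (u.2.1 x * deriv u.2.1 x))
      - D.g ^ 2 * (D.rho0 x / D.dP0 x * (u.2.1 x * u.2.1 x))) ∂ivol (-D.m) D.ℓ
      ≤ ∫ x, (hD.form hr hs).densFun u u x ∂ivol (-D.m) D.ℓ := by
    refine integral_mono_ae (i1.sub i2) ((hD.form hr hs).integrable_densFun u u) ?_
    refine (ae_restrict_iff' measurableSet_Ioo).2 (ae_of_all _ fun x hx => ?_)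
    obtain ⟨⟨b1, -⟩, ⟨b3, -⟩, ⟨b5, -⟩, ⟨b7, -⟩⟩ := hD.bounds hx
    have hρ := hD.lo_pos.trans_le b1
    have hε := hD.lo_pos.trans_le b3
    have hP := hD.lo_pos.trans_le b7
    change _ ≤ (hD.form hr hs).densFun u u x
    rw [densFun_self]
    have k1 : 0 ≤ s * shearFun D r u.1.1 u.2.1 x := by
      rw [shearFun]; positivity
    have k2 : 0 ≤ s * D.del0 x * (deriv u.2.1 x + r * u.1.1 x) ^ 2 :=
      mul_nonneg (mul_nonneg hs.le b5) (sq_nonneg _)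
    -- With `rφ = (ψ' + rφ) - ψ'`, the compression and gravity terms become this square plus
    -- `2gρ₀ψψ' - g²ρ₀ψ²/P'`, whose integral is exactly `-g⟦ρ₀⟧ψ(0)²`.
    have k3 : 0 ≤ D.rho0 x * D.dP0 x
        * ((deriv u.2.1 x + r * u.1.1 x) - D.g * u.2.1 x / D.dP0 x) ^ 2 := by positivity
    have k4 : D.rho0 x * D.dP0 x
        * ((deriv u.2.1 x + r * u.1.1 x) - D.g * u.2.1 x / D.dP0 x) ^ 2
        = D.dP0 x * D.rho0 x * (deriv u.2.1 x + r * u.1.1 x) ^ 2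
          - 2 * D.g * D.rho0 x * u.2.1 x * (deriv u.2.1 x + r * u.1.1 x)
          + D.g ^ 2 * (D.rho0 x / D.dP0 x * (u.2.1 x * u.2.1 x)) := by
      field_simp
      ring
    linarith
  rw [integral_sub i1 i2, integral_const_mul, integral_const_mul] at h2
  rw [FormData.B_apply]
  have h3 : (hD.form hr hs).τ = D.σ * r ^ 2 := rfl
  rw [h3]
  have h4 := congrArg (fun t => D.g * t) h1
  linarith

end Admissible

end FluidData

namespace FluidData

variable {D : FluidData}

namespace Admissible

variable (hD : D.Admissible)

include hD

/-! ### A destabilizing test pair -/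

/-- A smooth function with compact support in `(-m, ℓ)` lies in `H¹₀`. -/
lemma mem_H10_of_contDiff {f : ℝ → ℝ} (hf : ContDiff ℝ 1 f) (h0 : f (-D.m) = 0)
    (h1 : f D.ℓ = 0) : f ∈ H10 (-D.m) D.ℓ hD.neg_lt :=
  ⟨hf.contDiffOn.absolutelyContinuousOnInterval,
    (hf.continuous_deriv le_rfl).continuousOn.memLp_ivol 2, h0, h1⟩

/-- There is a divergence-free pair, concentrated near the interface, for which the potential
energy is negative. -/
lemma exists_test_pair {r : ℝ} (h : D.IsUnstable r) : ∃ u : hD.HPairs,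
    (∀ x, deriv u.2.1 x + r * u.1.1 x = 0) ∧ u.2.1 0 = 1 ∧
      D.g ^ 2 * ∫ x, D.rho0 x / D.dP0 x * (u.2.1 x * u.2.1 x) ∂ivol (-D.m) D.ℓ
        < D.g * D.jumpRho - D.σ * r ^ 2 := by
  obtain ⟨hr, hu⟩ := h
  have hgap : 0 < D.g * D.jumpRho - D.σ * r ^ 2 := sub_pos.2 hu
  have hg := hD.g_pos
  have hm := hD.m_pos
  have hl := hD.ℓ_pos
  have hlo := hD.lo_pos
  have hhi := hD.hi_pos
  set c : ℝ := D.g ^ 2 * (hD.hi / hD.lo) with hc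
  have hc0 : 0 < c := by positivity
  -- The first two bounds keep the support inside the slab; the third makes `g²∫ρ₀ψ²/P' ≤ 2cα` at
  -- most half of the gap `g⟦ρ₀⟧ - σr²`.
  set α : ℝ := min (min (D.m / 2) (D.ℓ / 2)) ((D.g * D.jumpRho - D.σ * r ^ 2) / (4 * c)) with hα
  have hα0 : 0 < α := by
    refine lt_min (lt_min ?_ ?_) ?_ <;> positivity
  have hαm : α < D.m := ((min_le_left _ _).trans (min_le_left _ _)).trans_lt (half_lt_self hm)
  have hαl : α < D.ℓ := ((min_le_left _ _).trans (min_le_right _ _)).trans_lt (half_lt_self hl)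
  have hαc : α ≤ (D.g * D.jumpRho - D.σ * r ^ 2) / (4 * c) := min_le_right _ _
  let χ : ContDiffBump (0 : ℝ) := ⟨α / 2, α, by positivity, half_lt_self hα0⟩
  have hχ : ContDiff ℝ 2 χ := χ.contDiff
  have hsupp : ∀ x, α < |x| → χ =ᶠ[𝓝 x] 0 := by
    intro x hx
    have : ∀ᶠ y in 𝓝 x, α < |y| := continuous_abs.continuousAt.eventually (lt_mem_nhds hx)
    filter_upwards [this] with y hy
    exact χ.zero_of_le_dist (by simpa using hy.le)
  have hz : ∀ x, α < |x| → χ x = 0 ∧ deriv χ x = 0 := by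
    intro x hx
    refine ⟨(hsupp x hx).self_of_nhds, ?_⟩
    rw [(hsupp x hx).deriv_eq]
    simp
  have em : α < |-D.m| := by rw [abs_neg, abs_of_pos hm]; exact hαm
  have el : α < |D.ℓ| := by rw [abs_of_pos hl]; exact hαl
  have hψ : (χ : ℝ → ℝ) ∈ H10 (-D.m) D.ℓ hD.neg_lt :=
    hD.mem_H10_of_contDiff (hχ.of_le (by norm_num)) (hz _ em).1 (hz _ el).1
  -- The divergence-free choice `φ = -ψ'/r` removes the compression term.
  have hφ : (fun x => -(1 / r) * deriv χ x) ∈ H10 (-D.m) D.ℓ hD.neg_lt := by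
    refine hD.mem_H10_of_contDiff (contDiff_const.mul ?_) ?_ ?_
    · exact (contDiff_succ_iff_deriv (n := 1) (f := (χ : ℝ → ℝ))).1 hχ |>.2.2
    · rw [(hz _ em).2, mul_zero]
    · rw [(hz _ el).2, mul_zero]
  refine ⟨(⟨_, hφ⟩, ⟨_, hψ⟩), fun x => ?_, χ.one_of_mem_closedBall (by simp [χ.rIn_pos.le]), ?_⟩
  · simp only
    field_simp
    ring
  · have h1 : ∫ x, D.rho0 x / D.dP0 x * (χ x * χ x) ∂ivol (-D.m) D.ℓ
        ≤ ∫ x, (Icc (-α) α).indicator (fun _ => hD.hi / hD.lo) x ∂ivol (-D.m) D.ℓ := by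
      refine integral_mono_ae (hD.integrable_rho_div_dP_mul hψ)
        ((integrable_const _).indicator measurableSet_Icc) ?_
      refine (ae_restrict_iff' measurableSet_Ioo).2 (ae_of_all _ fun x hx => ?_)
      obtain ⟨b1, b2⟩ := hD.rho_div_dP_bound hx
      by_cases hx' : x ∈ Icc (-α) α
      · rw [indicator_of_mem hx']
        have := χ.nonneg (x := x)
        have := χ.le_one (x := x)
        calc D.rho0 x / D.dP0 x * (χ x * χ x) ≤ D.rho0 x / D.dP0 x * 1 :=
              mul_le_mul_of_nonneg_left (by nlinarith) b1
          _ ≤ _ := by rwa [mul_one]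
      · rw [indicator_of_notMem hx']
        have : α < |x| := by
          by_contra hcon
          exact hx' (abs_le.1 (not_lt.1 hcon))
        change D.rho0 x / D.dP0 x * (χ x * χ x) ≤ 0
        rw [(hz x this).1]; simp
    have h2 : ∫ x, (Icc (-α) α).indicator (fun _ => hD.hi / hD.lo) x ∂ivol (-D.m) D.ℓ
        ≤ 2 * α * (hD.hi / hD.lo) := by
      rw [integral_indicator measurableSet_Icc, Measure.restrict_restrict measurableSet_Icc]
      have : Icc (-α) α ∩ Ioo (-D.m) D.ℓ = Icc (-α) α := by
        refine inter_eq_left.2 fun x hx => ⟨?_, ?_⟩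
        · linarith [hx.1]
        · linarith [hx.2]
      rw [this]
      simp only [integral_const, smul_eq_mul, Measure.real, Measure.restrict_apply_univ,
        Real.volume_Icc]
      rw [ENNReal.toReal_ofReal (by linarith)]
      apply le_of_eq; ring
    have h3 : c * α ≤ (D.g * D.jumpRho - D.σ * r ^ 2) / 4 := by
      calc c * α ≤ c * ((D.g * D.jumpRho - D.σ * r ^ 2) / (4 * c)) :=
            mul_le_mul_of_nonneg_left hαc hc0.le
        _ = _ := by field_simp
    have h4 := mul_le_mul_of_nonneg_left (h1.trans h2) (sq_nonneg D.g)
    simp only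
    have h5 : D.g ^ 2 * (2 * α * (hD.hi / hD.lo)) = 2 * (c * α) := by rw [hc]; ring
    linarith

/-! ### The infimum `μ` -/

variable {r s : ℝ}

lemma mem_constraintSet_iff {φ ψ : ℝ → ℝ} : (φ, ψ) ∈ D.constraintSet ↔
    ∃ u : hD.HPairs, u.1.1 = φ ∧ u.2.1 = ψ ∧ D.constraintJ u.1.1 u.2.1 = 1 := by
  constructor
  · rintro ⟨h1, h2, h3⟩
    exact ⟨(⟨φ, h1⟩, ⟨ψ, h2⟩), rfl, rfl, h3⟩
  · rintro ⟨u, rfl, rfl, h3⟩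
    exact ⟨u.1.2, u.2.2, h3⟩

lemma constraintJ_eq_one_iff (hr : 0 < r) (hs : 0 < s) (u : hD.HPairs) :
    D.constraintJ u.1.1 u.2.1 = 1 ↔ (hD.form hr hs).M u u = 2 := by
  rw [hD.constraintJ_eq hr hs]
  constructor <;> intro h <;> linarith

/-- Coercivity with the Dirichlet part dropped, since the constraint forces mass at least `2/hi`.
The quadratic term in `r` is retained for the high-frequency decay. -/
lemma neg_le_energy (hr : 0 < r) (hs : 0 < s) (u : hD.HPairs)
    (hu : D.constraintJ u.1.1 u.2.1 = 1) :
    (hD.form hr hs).lo * r ^ 2 / (hD.form hr hs).hi - D.g * r ≤ D.energy r s u.1.1 u.2.1 := by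
  rw [hD.constraintJ_eq_one_iff hr hs] at hu
  have h1 := (hD.form hr hs).le_B u
  have h2 := (hD.form hr hs).M_le u
  have h3 := (hD.form hr hs).hi_pos
  have h4 := mul_nonneg (hD.form hr hs).lo_pos.le ((hD.form hr hs).dir_nonneg u)
  rw [hu] at h1 h2
  have h5 : 2 / (hD.form hr hs).hi ≤ (hD.form hr hs).mass u := by
    rw [div_le_iff₀ h3]; linarith
  have h6 := mul_le_mul_of_nonneg_left h5 (mul_nonneg (hD.form hr hs).lo_pos.le (sq_nonneg r))
  have e1 : (hD.form hr hs).r = r := rfl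
  have e2 : (hD.form hr hs).γ = D.g := rfl
  rw [e1, e2] at h1
  rw [hD.energy_eq hr hs]
  have h7 : (hD.form hr hs).lo * r ^ 2 / (hD.form hr hs).hi
      = 1 / 2 * ((hD.form hr hs).lo * r ^ 2 * (2 / (hD.form hr hs).hi)) := by ring
  rw [h7]
  linarith

lemma bddBelow_energy (hr : 0 < r) (hs : 0 < s) :
    BddBelow ((fun p => D.energy r s p.1 p.2) '' D.constraintSet) := by
  refine ⟨(hD.form hr hs).lo * r ^ 2 / (hD.form hr hs).hi - D.g * r, ?_⟩
  rintro _ ⟨⟨φ, ψ⟩, hp, rfl⟩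
  obtain ⟨u, rfl, rfl, hu⟩ := hD.mem_constraintSet_iff.1 hp
  exact hD.neg_le_energy hr hs u hu

/-- The test pair at some small unstable frequency has `ψ(0) = 1`, so by continuity its mass is
positive and it can be normalized. -/
lemma nonempty_constraintSet : D.constraintSet.Nonempty := by
  have hj := hD.jumpRho_pos
  have hg := hD.g_pos
  have hσ := hD.σ_nonneg
  obtain ⟨r, hr⟩ : ∃ r, D.IsUnstable r := by
    have ht : Tendsto (fun r : ℝ => D.σ * r ^ 2) (𝓝[>] 0) (𝓝 (D.σ * 0 ^ 2)) :=
      ((by fun_prop : Continuous fun r : ℝ => D.σ * r ^ 2).tendsto 0).mono_left nhdsWithin_le_nhds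
    have h1 : ∀ᶠ r in 𝓝[>] (0 : ℝ), D.σ * r ^ 2 < D.g * D.jumpRho :=
      ht.eventually (gt_mem_nhds (by
        rw [zero_pow two_ne_zero, mul_zero]; positivity))
    obtain ⟨r, h2, h3⟩ := (h1.and self_mem_nhdsWithin).exists
    exact ⟨r, h3, h2⟩
  obtain ⟨u, -, hu, -⟩ := hD.exists_test_pair hr
  set F := hD.form hr.1 one_pos
  have hpos : 0 < F.M u u := by
    refine lt_of_le_of_ne (F.M_nonneg u) fun h0 => ?_
    have h1 := F.le_M u
    rw [← h0] at h1
    have h2 : F.mass u = 0 :=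
      le_antisymm (le_of_mul_le_mul_left (by simpa using h1) F.lo_pos) (F.mass_nonneg u)
    have h3 : ∫ x, u.2.1 x ^ 2 ∂ivol (-D.m) D.ℓ = 0 := by
      have k1 : 0 ≤ ∫ x, u.1.1 x ^ 2 ∂ivol (-D.m) D.ℓ := integral_nonneg fun _ => sq_nonneg _
      have k2 : 0 ≤ ∫ x, u.2.1 x ^ 2 ∂ivol (-D.m) D.ℓ := integral_nonneg fun _ => sq_nonneg _
      rw [FormData.mass] at h2
      linarith
    rw [integral_eq_zero_iff_of_nonneg (fun _ => sq_nonneg _) (H10.memLp u.2.2).integrable_sq] at h3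
    have hcont : ContinuousOn (fun x => u.2.1 x ^ 2) (Ioo (-D.m) D.ℓ) :=
      ((H10.continuousOn u.2.2).mono Ioo_subset_Icc_self).pow 2
    have h4 := Measure.eqOn_open_of_ae_eq h3 isOpen_Ioo hcont continuousOn_const
      (show (0 : ℝ) ∈ Ioo (-D.m) D.ℓ from ⟨neg_lt_zero.2 hD.m_pos, hD.ℓ_pos⟩)
    simp [hu] at h4
  set c := √(2 / F.M u u)
  have hc : c * c = 2 / F.M u u := Real.mul_self_sqrt (by positivity)
  refine ⟨((c • u).1.1, (c • u).2.1), hD.mem_constraintSet_iff.2 ⟨c • u, rfl, rfl, ?_⟩⟩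
  rw [hD.constraintJ_eq_one_iff hr.1 one_pos]
  change F.M (c • u) (c • u) = 2
  simp [← mul_assoc, hc, hpos.ne']

lemma mu_le (hr : 0 < r) (hs : 0 < s) {p : (ℝ → ℝ) × (ℝ → ℝ)} (hp : p ∈ D.constraintSet) :
    D.mu r s ≤ D.energy r s p.1 p.2 :=
  csInf_le (hD.bddBelow_energy hr hs) (mem_image_of_mem _ hp)

lemma mu_le_B (hr : 0 < r) (hs : 0 < s) (v : hD.HPairs) (hv : (hD.form hr hs).M v v = 2) :
    2 * D.mu r s ≤ (hD.form hr hs).B v v := by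
  have h1 := hD.mu_le hr hs (hD.mem_constraintSet_iff.2
    ⟨v, rfl, rfl, (hD.constraintJ_eq_one_iff hr hs v).2 hv⟩)
  rw [hD.energy_eq hr hs] at h1
  linarith

/-- The homogeneous form of the bound, usable with test pairs that are not normalized. -/
lemma mu_mul_M_le_B (hr : 0 < r) (hs : 0 < s) (v : hD.HPairs) :
    D.mu r s * (hD.form hr hs).M v v ≤ (hD.form hr hs).B v v := by
  have := (hD.form hr hs).Q_nonneg (hD.mu_le_B hr hs) v
  rw [FormData.Q_apply] at this
  linarith

/-- The infimum `μ` is attained. -/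
theorem exists_isMinimizer (hr : 0 < r) (hs : 0 < s) :
    ∃ p ∈ D.constraintSet, D.energy r s p.1 p.2 = D.mu r s := by
  obtain ⟨u, h1, h2⟩ := (hD.form hr hs).exists_minimizer (D.mu r s) (hD.mu_le_B hr hs) (by
    intro ε hε
    have hne := hD.nonempty_constraintSet.image (fun p => D.energy r s p.1 p.2)
    obtain ⟨_, ⟨⟨φ, ψ⟩, hp, rfl⟩, hlt⟩ := exists_lt_of_csInf_lt hne
      (show D.mu r s < D.mu r s + ε / 2 by linarith)
    obtain ⟨u, rfl, rfl, hu⟩ := hD.mem_constraintSet_iff.1 hp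
    refine ⟨u, (hD.constraintJ_eq_one_iff hr hs u).1 hu, ?_⟩
    simp only [hD.energy_eq hr hs] at hlt
    linarith)
  refine ⟨(u.1.1, u.2.1), hD.mem_constraintSet_iff.2
    ⟨u, rfl, rfl, (hD.constraintJ_eq_one_iff hr hs u).2 h1⟩, ?_⟩
  rw [hD.energy_eq hr hs, h2]
  ring

lemma B_affine (hr : 0 < r) {s t α β : ℝ} (hs : 0 < s) (ht : 0 < t) (hst : 0 < α * s + β * t)
    (hαβ : α + β = 1) (u : hD.HPairs) : (hD.form hr hst).B u u
      = α * (hD.form hr hs).B u u + β * (hD.form hr ht).B u u := by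
  have h1 : ∀ x, (hD.form hr hst).densFun u u x
      = α * (hD.form hr hs).densFun u u x + β * (hD.form hr ht).densFun u u x := by
    intro x
    rw [densFun_self, densFun_self, densFun_self]
    obtain rfl : β = 1 - α := by linarith
    ring
  rw [FormData.B_apply, FormData.B_apply, FormData.B_apply]
  simp_rw [h1]
  have i1 := ((hD.form hr hs).integrable_densFun u u).const_mul α
  have i2 := ((hD.form hr ht).integrable_densFun u u).const_mul β
  rw [integral_add i1 i2, integral_const_mul, integral_const_mul]
  obtain rfl : β = 1 - α := by linarith
  simp only [form]
  ring

/-- Only the dissipative terms depend on `s`, linearly and with nonnegative coefficient. -/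
lemma B_mono (hr : 0 < r) {s t : ℝ} (hs : 0 < s) (ht : 0 < t) (hst : s ≤ t) (u : hD.HPairs) :
    (hD.form hr hs).B u u ≤ (hD.form hr ht).B u u := by
  rw [FormData.B_apply, FormData.B_apply]
  refine add_le_add le_rfl (integral_mono_ae ((hD.form hr hs).integrable_densFun u u)
    ((hD.form hr ht).integrable_densFun u u) ?_)
  refine (ae_restrict_iff' measurableSet_Ioo).2 (ae_of_all _ fun x hx => ?_)
  obtain ⟨-, ⟨b3, -⟩, ⟨b5, -⟩, -⟩ := hD.bounds hx
  have hε := hD.lo_pos.trans_le b3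
  rw [densFun_self, densFun_self]
  have k1 : 0 ≤ (t - s) * shearFun D r u.1.1 u.2.1 x := by
    refine mul_nonneg (sub_nonneg.2 hst) ?_
    rw [shearFun]; positivity
  have k2 : 0 ≤ (t - s) * D.del0 x * (deriv u.2.1 x + r * u.1.1 x) ^ 2 :=
    mul_nonneg (mul_nonneg (sub_nonneg.2 hst) b5) (sq_nonneg _)
  linarith

lemma le_mu (hr : 0 < r) (hs : 0 < s) {c : ℝ}
    (h : ∀ v, (hD.form hr hs).M v v = 2 → 2 * c ≤ (hD.form hr hs).B v v) : c ≤ D.mu r s := by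
  refine le_csInf (hD.nonempty_constraintSet.image _) ?_
  rintro _ ⟨⟨φ, ψ⟩, hp, rfl⟩
  obtain ⟨u, rfl, rfl, hu⟩ := hD.mem_constraintSet_iff.1 hp
  have := h u ((hD.constraintJ_eq_one_iff hr hs u).1 hu)
  simp only [hD.energy_eq hr hs]
  linarith

lemma mu_mono (hr : 0 < r) {s t : ℝ} (hs : 0 < s) (hst : s ≤ t) : D.mu r s ≤ D.mu r t :=
  hD.le_mu hr (hs.trans_le hst) fun v hv =>
    (hD.mu_le_B hr hs v hv).trans (hD.B_mono hr hs (hs.trans_le hst) hst v)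

/-- An infimum of affine functions of `s`, over a constraint set independent of `s`. Continuity on
the open half-line follows. -/
lemma concaveOn_mu (hr : 0 < r) : ConcaveOn ℝ (Ioi 0) (D.mu r) := by
  refine ⟨convex_Ioi 0, fun s hs t ht α β hα hβ hαβ => ?_⟩
  have hst : 0 < α * s + β * t := (convex_Ioi (0 : ℝ)) hs ht hα hβ hαβ
  simp only [smul_eq_mul]
  refine hD.le_mu hr hst fun v hv => ?_
  rw [hD.B_affine hr hs ht hst hαβ]
  have h1 := mul_le_mul_of_nonneg_left (hD.mu_le_B hr hs v hv) hα
  have h2 := mul_le_mul_of_nonneg_left (hD.mu_le_B hr ht v hv) hβ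
  linarith

lemma continuousOn_mu (hr : 0 < r) : ContinuousOn (D.mu r) (Ioi 0) := by
  have := (hD.concaveOn_mu hr).neg.continuousOn isOpen_Ioi
  simpa using this.neg

lemma neg_le_mu (hr : 0 < r) (hs : 0 < s) :
    (hD.form hr hs).lo * r ^ 2 / (hD.form hr hs).hi - D.g * r ≤ D.mu r s := by
  refine hD.le_mu hr hs fun v hv => ?_
  have := hD.neg_le_energy hr hs v ((hD.constraintJ_eq_one_iff hr hs v).2 hv)
  rw [hD.energy_eq hr hs] at this
  linarith

/-- Along the test pair the energy form is `A + sC`, where `A < 0` is the potential part and `C` the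
shear part; for small `s` the negative part wins even against `s²`. -/
lemma exists_mu_neg (h : D.IsUnstable r) : ∃ s, 0 < s ∧ s ≤ 1 ∧ s ^ 2 + D.mu r s < 0 := by
  have hr := h.1
  obtain ⟨u, hu1, hu2, hu3⟩ := hD.exists_test_pair h
  have h1 := hD.integral_rho_mul_deriv u.2.2
  set A : ℝ := D.σ * r ^ 2 - D.g * D.jumpRho
    + D.g ^ 2 * ∫ x, D.rho0 x / D.dP0 x * (u.2.1 x * u.2.1 x) ∂ivol (-D.m) D.ℓ with hA
  have hA0 : A < 0 := by linarith
  set C : ℝ := ∫ x, shearFun D r u.1.1 u.2.1 x ∂ivol (-D.m) D.ℓ with hC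
  have hB : ∀ (s : ℝ) (hs : 0 < s), (hD.form hr hs).B u u = A + s * C := by
    intro s hs
    have e1 : ∀ x, (hD.form hr hs).densFun u u x
        = 2 * D.g * (D.rho0 x * (u.2.1 x * deriv u.2.1 x))
          + s * shearFun D r u.1.1 u.2.1 x := by
      intro x
      rw [densFun_self, hu1 x]
      have e2 : deriv u.2.1 x = - (r * u.1.1 x) := by linarith [hu1 x]
      rw [e2]
      ring
    rw [FormData.B_apply]
    simp_rw [e1]
    rw [integral_add ((hD.integrable_rho_mul_deriv u.2.2).const_mul _)
      ((hD.integrable_shearFun u).const_mul _), integral_const_mul, integral_const_mul, hu2]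
    have e3 : (hD.form hr hs).τ = D.σ * r ^ 2 := rfl
    rw [e3, hA]
    have e4 := congrArg (fun t => D.g * t) h1
    simp only [hu2] at e4
    linarith
  set Mu : ℝ := (hD.form hr one_pos).M u u with hMu
  have hMu0 : 0 ≤ Mu := FormData.M_nonneg _ u
  have key : ∀ s, 0 < s → D.mu r s * Mu ≤ A + s * C := by
    intro s hs
    rw [← hB s hs]
    exact hD.mu_mul_M_le_B hr hs u
  have hMu1 : 0 < Mu + |C| + 1 := by positivity
  -- If `s² + μ ≥ 0`, then `-A ≤ s² Mu + sC ≤ s(Mu + |C|)`, contradicting this choice.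
  set s : ℝ := min 1 (-A / (2 * (Mu + |C| + 1))) with hs
  have hs0 : 0 < s := lt_min one_pos (div_pos (by linarith) (by positivity))
  have hs1 : s ≤ 1 := min_le_left _ _
  have hs2 : s * (2 * (Mu + |C| + 1)) ≤ -A := by
    rw [← le_div_iff₀ (by positivity)]; exact min_le_right _ _
  refine ⟨s, hs0, hs1, ?_⟩
  by_contra hcon
  rw [not_lt] at hcon
  have k1 := key s hs0
  have k2 : -s ^ 2 * Mu ≤ D.mu r s * Mu := mul_le_mul_of_nonneg_right (by linarith) hMu0
  have k3 : s ^ 2 * Mu ≤ s * Mu := mul_le_mul_of_nonneg_right (by nlinarith) hMu0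
  have k4 : s * C ≤ s * |C| := mul_le_mul_of_nonneg_left (le_abs_self C) hs0.le
  nlinarith [mul_nonneg hs0.le hMu0, mul_nonneg hs0.le (abs_nonneg C)]

omit hD in
-- The root-free form: `μ = -s²` with `s > 0` already forces `μ < 0`.
lemma isFixedRate_iff : D.IsFixedRate r s ↔ 0 < s ∧ s ^ 2 + D.mu r s = 0 := by
  constructor
  · rintro ⟨h1, h2, h3⟩
    refine ⟨h1, ?_⟩
    have := Real.sq_sqrt (show 0 ≤ -D.mu r s by linarith)
    rw [← h3] at this
    linarith
  · rintro ⟨h1, h2⟩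
    have h3 : -D.mu r s = s ^ 2 := by linarith
    refine ⟨h1, by nlinarith, ?_⟩
    rw [h3, Real.sqrt_sq h1.le]

/-- `s² + μ(s)` is continuous and strictly increasing, negative at some small `s` and nonnegative at
a large one. -/
theorem existsUnique_isFixedRate (h : D.IsUnstable r) : ∃! s, D.IsFixedRate r s := by
  have hr := h.1
  have hmono : ∀ s t, 0 < s → s < t → s ^ 2 + D.mu r s < t ^ 2 + D.mu r t := by
    intro s t hs hst
    have := hD.mu_mono hr hs hst.le
    nlinarith
  obtain ⟨s₀, h1, h2, h3⟩ := hD.exists_mu_neg h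
  -- Since `μ ≥ -gr`, this point gives `s₁² + μ ≥ 0`; the summand `1` also ensures `s₀ ≤ s₁`.
  set s₁ : ℝ := D.g * r + 1 with hs₁
  have hgr : 0 < D.g * r := mul_pos hD.g_pos hr
  have h4 : 0 ≤ s₁ ^ 2 + D.mu r s₁ := by
    have k1 := hD.neg_le_mu hr (show 0 < s₁ by linarith)
    have k2 : 0 ≤ (hD.form hr (show 0 < s₁ by linarith)).lo * r ^ 2
        / (hD.form hr (show 0 < s₁ by linarith)).hi :=
      div_nonneg (mul_nonneg (FormData.lo_pos _).le (sq_nonneg r)) (FormData.hi_pos _).le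
    nlinarith
  have hle : s₀ ≤ s₁ := by linarith
  have hc : ContinuousOn (fun s => s ^ 2 + D.mu r s) (Icc s₀ s₁) :=
    (continuousOn_id.pow 2).add ((hD.continuousOn_mu hr).mono fun x hx => h1.trans_le hx.1)
  obtain ⟨s, hs, hs'⟩ := intermediate_value_Icc hle hc ⟨h3.le, h4⟩
  refine ⟨s, isFixedRate_iff.2 ⟨h1.trans_le hs.1, hs'⟩, fun t ht => ?_⟩
  obtain ⟨ht0, ht'⟩ := isFixedRate_iff.1 ht
  simp only at hs'
  rcases lt_trichotomy t s with hts | hts | hts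
  · have := hmono t s ht0 hts
    linarith
  · exact hts
  · have := hmono s t (h1.trans_le hs.1) hts
    linarith

lemma isFixedRate_growthRate (h : D.IsUnstable r) : D.IsFixedRate r (D.growthRate r) := by
  obtain ⟨s, hs, hu⟩ := hD.existsUnique_isFixedRate h
  have : {s | D.IsFixedRate r s} = {s} := by
    ext t
    exact ⟨fun ht => hu t ht, fun ht => by rw [mem_singleton_iff.1 ht]; exact hs⟩
  rw [growthRate, this, csSup_singleton]
  exact hs

theorem exists_isModeFamily : ∃ Φ Ψ : ℝ → ℝ → ℝ, D.IsModeFamily Φ Ψ := by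
  have : ∀ r, ∃ p : (ℝ → ℝ) × (ℝ → ℝ), D.IsUnstable r → p ∈ D.constraintSet ∧
      D.energy r (D.growthRate r) p.1 p.2 = D.mu r (D.growthRate r) := by
    intro r
    by_cases h : D.IsUnstable r
    · obtain ⟨p, h1, h2⟩ := hD.exists_isMinimizer h.1 (hD.isFixedRate_growthRate h).1
      exact ⟨p, fun _ => ⟨h1, h2⟩⟩
    · exact ⟨(0, 0), fun h' => absurd h' h⟩
  choose p hp using this
  exact ⟨fun r => (p r).1, fun r => (p r).2, fun r hr => hp r hr⟩

/-! ### The maximal growth rate -/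

/-- The growth rate decays at high frequency. -/
lemma growthRate_lt_of_large {δ : ℝ} (hδ : 0 < δ) :
    ∃ R, ∀ r, R < r → D.IsUnstable r → D.growthRate r < δ := by
  set lo := min hD.lo (δ * hD.lo) with hlo
  set hi := max hD.hi (max (δ * hD.hi) (δ * hD.hi + hD.hi * hD.hi)) with hhi
  have hlo0 : 0 < lo := lt_min hD.lo_pos (mul_pos hδ hD.lo_pos)
  have hhi0 : 0 < hi := lt_max_of_lt_left hD.hi_pos
  -- Beyond this `r` the lower bound on `μ_r(δ)` is nonnegative. A rate at least `δ` would then have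
  -- `μ ≥ 0` by monotonicity, although a rate needs `μ < 0`.
  refine ⟨D.g * hi / lo, fun r hR h => ?_⟩
  by_contra hcon
  rw [not_lt] at hcon
  have h1 := hD.mu_mono h.1 hδ hcon
  have h2 := (hD.isFixedRate_growthRate h).2.1
  have h3 : lo * r ^ 2 / hi - D.g * r ≤ D.mu r δ := hD.neg_le_mu h.1 hδ
  rw [div_lt_iff₀ hlo0] at hR
  have h4 : 0 ≤ lo * r ^ 2 / hi - D.g * r := by
    have h5 : D.g * r ≤ lo * r ^ 2 / hi := by
      rw [le_div_iff₀ hhi0]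
      nlinarith [h.1]
    linarith
  linarith

omit hD in
lemma isLattice_iff {L : ℝ} {ξ : EuclideanSpace ℝ (Fin 2)} :
    IsLattice L ξ ↔ ∃ n, ξ = latticePoint L n := by
  constructor
  · rintro ⟨n, hn⟩
    refine ⟨n, ?_⟩
    ext i
    exact hn i
  · rintro ⟨n, rfl⟩
    exact ⟨n, fun i => rfl⟩

omit hD in
lemma abs_le_of_latticePoint {L R : ℝ} (hL : 0 < L) {n : Fin 2 → ℤ} (h : ‖latticePoint L n‖ ≤ R)
    (i : Fin 2) : |n i| ≤ ⌈R * L⌉ := by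
  have h1 : ‖latticePoint L n i‖ ≤ ‖latticePoint L n‖ := PiLp.norm_apply_le _ i
  have h2 : latticePoint L n i = n i / L := rfl
  rw [h2, Real.norm_eq_abs, abs_div, abs_of_pos hL] at h1
  have h3 : |(n i : ℝ)| ≤ R * L := (div_le_iff₀ hL).1 (h1.trans h)
  have h4 : ((|n i| : ℤ) : ℝ) ≤ ⌈R * L⌉ := by
    push_cast
    exact h3.trans (Int.le_ceil _)
  exact_mod_cast h4

/-- One unstable lattice point has a positive rate; frequencies far out have smaller rates, and only
finitely many lattice points remain. -/
theorem isGreatest_maxRate {L : ℝ} (hL : √(D.σ / (D.g * D.jumpRho)) < L) :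
    0 < D.maxRate L ∧ IsGreatest (D.latticeRates L) (D.maxRate L) := by
  have hL0 : 0 < L := (Real.sqrt_nonneg _).trans_lt hL
  have hgj : 0 < D.g * D.jumpRho := mul_pos hD.g_pos hD.jumpRho_pos
  have hex : ∃ n : Fin 2 → ℤ, D.IsUnstable ‖latticePoint L n‖ := by
    -- The condition on `L` says exactly that the shortest nonzero frequency `1/L` lies below the
    -- critical one.
    refine ⟨![1, 0], ?_⟩
    have h1 : ‖latticePoint L ![1, 0]‖ = 1 / L := by
      rw [EuclideanSpace.norm_eq]
      simp [latticePoint, Fin.sum_univ_two, Real.sqrt_sq hL0.le]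
    rw [h1]
    refine ⟨by positivity, ?_⟩
    rw [Real.sqrt_lt' hL0, div_lt_iff₀ hgj] at hL
    rw [div_pow, one_pow, mul_one_div, div_lt_iff₀ (by positivity)]
    linarith
  obtain ⟨n₀, h₀⟩ := hex
  set l₀ := D.growthRate ‖latticePoint L n₀‖
  have hl₀ : 0 < l₀ := (hD.isFixedRate_growthRate h₀).1
  obtain ⟨R, hR⟩ := hD.growthRate_lt_of_large hl₀
  -- The radius is enlarged so that `n₀` belongs to the finite competition; points outside it have
  -- rate below that of `n₀`.
  set S : Set (Fin 2 → ℤ) := {n | D.IsUnstable ‖latticePoint L n‖ ∧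
    ‖latticePoint L n‖ ≤ max R ‖latticePoint L n₀‖} with hS
  have hfin : S.Finite := by
    refine (finite_Icc (fun _ => -⌈max R ‖latticePoint L n₀‖ * L⌉)
      (fun _ => ⌈max R ‖latticePoint L n₀‖ * L⌉)).subset fun n hn => ?_
    exact ⟨fun i => (abs_le.1 (abs_le_of_latticePoint hL0 hn.2 i)).1,
      fun i => (abs_le.1 (abs_le_of_latticePoint hL0 hn.2 i)).2⟩
  have hn₀ : n₀ ∈ S := ⟨h₀, le_max_right _ _⟩
  obtain ⟨n, hn, hmax⟩ := S.exists_max_image (fun n => D.growthRate ‖latticePoint L n‖) hfin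
    ⟨n₀, hn₀⟩
  have hg : IsGreatest (D.latticeRates L) (D.growthRate ‖latticePoint L n‖) := by
    refine ⟨⟨_, isLattice_iff.2 ⟨n, rfl⟩, hn.1, rfl⟩, ?_⟩
    rintro _ ⟨ξ, hξ, hξu, rfl⟩
    obtain ⟨k, rfl⟩ := isLattice_iff.1 hξ
    by_cases hk : ‖latticePoint L k‖ ≤ max R ‖latticePoint L n₀‖
    · exact hmax k ⟨hξu, hk⟩
    · have := hR _ ((le_max_left _ _).trans_lt (not_le.1 hk)) hξu
      exact this.le.trans (hmax n₀ hn₀)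
  have he : D.maxRate L = D.growthRate ‖latticePoint L n‖ := hg.csSup_eq
  rw [he]
  exact ⟨hl₀.trans_le (hmax n₀ hn₀), hg⟩

/-! ### Minimizers -/

/-- A minimizer at the growth rate does not vanish at the interface. -/
lemma minimizer_ne_zero (hr : D.IsUnstable r) (hs : D.IsFixedRate r s) (u : hD.HPairs)
    (hB : (hD.form hr.1 hs.1).B u u = 2 * D.mu r s) : u.2.1 0 ≠ 0 := by
  intro h0
  have h1 := hD.interface_le_B hr.1 hs.1 u
  rw [h0, hB] at h1
  have h2 := hs.2.1
  norm_num at h1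
  linarith

end Admissible

end FluidData

/-! ### From minimizers to smooth normal modes. -/

namespace FluidData

variable {D : FluidData}

/-- The normal mode `(φ, ψ)` at frequency modulus `r` and rate `s`, with its fluxes, in the layer
of the fluid `a`. -/
abbrev LayerMode (D : FluidData) (r s : ℝ) (a : Phase) (φ ψ f₁ f₂ : ℝ → ℝ) : Prop :=
  LayerSolution (fun x => s * D.layerDel a x + D.layerdP a x * D.layerRho a x)
    (fun x => s * D.layerEps a x) (D.layerRho a) D.g r (-s ^ 2) (D.layerBot a) (D.layerTop a)
    φ ψ f₁ f₂

/-- A normal mode: smooth in each closed layer, solving the Euler–Lagrange equations, the jump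
conditions and the boundary conditions. -/
structure IsNormalMode (D : FluidData) (r s : ℝ) (φ ψ f₁ : ℝ → ℝ) (f₂ : Phase → ℝ → ℝ) :
    Prop where
  layer : ∀ a, D.LayerMode r s a φ ψ f₁ (f₂ a)
  jump : f₂ .upper 0 - f₂ .lower 0 = D.σ * r ^ 2 * ψ 0
  left_φ : φ (-D.m) = 0
  left_ψ : ψ (-D.m) = 0
  right_φ : φ D.ℓ = 0
  right_ψ : ψ D.ℓ = 0
  ψ_ne_zero : ψ 0 ≠ 0
  cont_φ : ContinuousOn φ (Icc (-D.m) D.ℓ)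
  cont_ψ : ContinuousOn ψ (Icc (-D.m) D.ℓ)

namespace Admissible

variable (hD : D.Admissible)

include hD

lemma layerIcc_subset (a : Phase) : Icc (D.layerBot a) (D.layerTop a) ⊆ Icc (-D.m) D.ℓ := by
  cases a
  · exact Icc_subset_Icc_right hD.ℓ_pos.le
  · exact Icc_subset_Icc_left (neg_nonpos.2 hD.m_pos.le)

/-- Minimizers are normal modes. -/
theorem isNormalMode_of_minimizer {r : ℝ} (hr : D.IsUnstable r) {φ ψ : ℝ → ℝ}
    (hp : (φ, ψ) ∈ D.constraintSet)
    (hE : D.energy r (D.growthRate r) φ ψ = D.mu r (D.growthRate r)) :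
    ∃ f₁ f₂, D.IsNormalMode r (D.growthRate r) φ ψ f₁ f₂ := by
  have hfix := hD.isFixedRate_growthRate hr
  set s := D.growthRate r with hs_def
  have hs : 0 < s := hfix.1
  -- The fixed-point condition: the multiplier becomes the `-s²` produced by two time derivatives.
  have hmu : D.mu r s = -s ^ 2 := by
    have := (isFixedRate_iff.1 hfix).2
    linarith
  obtain ⟨u, rfl, rfl, hJ⟩ := hD.mem_constraintSet_iff.1 hp
  set F := hD.form hr.1 hs with hF
  have hB : F.B u u = 2 * D.mu r s := by
    rw [hD.energy_eq hr.1 hs] at hE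
    linarith
  have hψ0 := hD.minimizer_ne_zero hr hfix u hB
  have hM := (hD.constraintJ_eq_one_iff hr.1 hs u).1 hJ
  obtain ⟨⟨c₁, h₁⟩, c₂, h₂⟩ := F.euler_lagrange (u := u)
    (fun v => F.weak_euler_lagrange (hD.mu_le_B hr.1 hs) hM hB v)
  obtain ⟨-, -, m₃, m₄⟩ := F.memLp_flux_rhs (D.mu r s) u
  have hlt := hD.neg_lt
  have prim : ∀ {g : ℝ → ℝ}, MemLp g 2 (ivol (-D.m) D.ℓ) →
      IntervalIntegrable g volume (-D.m) D.ℓ ∧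
      ContinuousOn (fun x => ∫ t in (-D.m)..x, g t) (Icc (-D.m) D.ℓ) := by
    intro g hg
    have hgi := (intervalIntegrable_iff_ivol hlt.le g).2 (hg.integrable one_le_two)
    have := (hgi.absolutelyContinuousOnInterval_intervalIntegral left_mem_uIcc).continuousOn
    rw [uIcc_of_le hlt.le] at this
    exact ⟨hgi, this⟩
  obtain ⟨i₃, cont₃⟩ := prim m₃
  obtain ⟨i₄, cont₄⟩ := prim m₄
  -- Moves the base point of a primitive to the bottom of a layer, where the integrand may be
  -- replaced by its layer formula.
  have hint : ∀ (a : Phase) {g g' : ℝ → ℝ}, IntervalIntegrable g volume (-D.m) D.ℓ →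
      (∀ x ∈ D.layerIoo a, g x = g' x) → ∀ x ∈ D.layerIcc a,
      ∫ t in (-D.m)..x, g t = (∫ t in (-D.m)..(D.layerBot a), g t)
        + ∫ t in (D.layerBot a)..x, g' t := by
    intro a g g' hg hgg x hx
    have hb := hD.layerIcc_subset a (left_mem_Icc.2 (hD.layer_lt a).le)
    have hx' := hD.layerIcc_subset a hx
    have k1 : IntervalIntegrable g volume (-D.m) (D.layerBot a) := hg.mono_set (by
      rw [uIcc_of_le hlt.le, uIcc_of_le hb.1]; exact Icc_subset_Icc_right hb.2)
    have k2 : IntervalIntegrable g volume (D.layerBot a) x := hg.mono_set (by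
      rw [uIcc_of_le hlt.le, uIcc_of_le hx.1]; exact Icc_subset_Icc hb.1 hx'.2)
    rw [← intervalIntegral.integral_add_adjacent_intervals k1 k2]
    congr 1
    rw [intervalIntegral_eq_ivol hx.1, intervalIntegral_eq_ivol hx.1]
    refine setIntegral_congr_fun measurableSet_Ioo fun y hy => hgg y ⟨hy.1, hy.2.trans_le hx.2⟩
  have hae : ∀ (a : Phase) {p : ℝ → Prop}, (∀ᵐ x ∂ivol (-D.m) D.ℓ, p x) →
      ∀ᵐ x ∂ivol (D.layerBot a) (D.layerTop a), x ∈ D.layerIoo a ∧ p x := by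
    intro a p h
    have hb := hD.layerIcc_subset a (left_mem_Icc.2 (hD.layer_lt a).le)
    have ht := hD.layerIcc_subset a (right_mem_Icc.2 (hD.layer_lt a).le)
    filter_upwards [ae_mono (Measure.restrict_mono (Ioo_subset_Ioo hb.1 ht.2) le_rfl) h,
      ae_restrict_mem measurableSet_Ioo] with x h1 h2
    exact ⟨h2, h1⟩
  set f₁ : ℝ → ℝ := fun x => c₁ + ∫ t in (-D.m)..x, F.rhs₁ (D.mu r s) u t with hf₁
  -- The vertical flux plus the step is continuous, so the two layer fluxes differ by the constant
  -- `τψ(0)`. The horizontal flux needs no such correction.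
  set off : Phase → ℝ := fun a => match a with
    | .lower => F.τ * u.2.1 0
    | .upper => 0 with hoff
  have hoff' : ∀ a, ∀ x ∈ D.layerIoo a, (if x < 0 then F.τ * u.2.1 0 else 0) = off a := by
    intro a x hx
    cases a
    · exact if_pos hx.2
    · exact if_neg (not_lt.2 (le_of_lt hx.1))
  set f₂ : Phase → ℝ → ℝ := fun a x =>
    c₂ + (∫ t in (-D.m)..x, F.rhs₂ (D.mu r s) u t) - off a with hf₂
  have cφ := H10.continuousOn u.1.2
  have cψ := H10.continuousOn u.2.2
  refine ⟨f₁, f₂, ⟨fun a => ?_, ?_, H10.left u.1.2, H10.left u.2.2, H10.right u.1.2,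
    H10.right u.2.2, hψ0, cφ, cψ⟩⟩
  · have hsub := hD.layerIcc_subset a
    have hb := left_mem_Icc.2 (hD.layer_lt a).le
    have sm1 := hD.contDiffOn_layerDel a
    have sm2 := hD.contDiffOn_layerdP a
    have sm3 := hD.contDiffOn_layerRho a
    have sm4 := hD.contDiffOn_layerEps a
    have hrhs₁ : ∀ x ∈ D.layerIoo a, F.rhs₁ (D.mu r s) u x =
        (s * D.layerDel a x + D.layerdP a x * D.layerRho a x)
          * (r * (deriv u.2.1 x + r * u.1.1 x))
        - D.layerRho a x * (D.g * r * u.2.1 x)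
        - s * D.layerEps a x * (r * (deriv u.2.1 x - r * u.1.1 x))
        + s * D.layerEps a x * (1 / 3 * r * (deriv u.2.1 x + r * u.1.1 x))
        - D.layerRho a x * (-s ^ 2 * u.1.1 x) := by
      intro x hx
      rw [← rho0_eq hx, ← dP0_eq hx, ← eps0_eq hx, ← del0_eq hx, ← hmu]
      rfl
    have hrhs₂ : ∀ x ∈ D.layerIoo a, F.rhs₂ (D.mu r s) u x =
        -(D.layerRho a x * (D.g * r * u.1.1 x))
        - s * D.layerEps a x * (r * (deriv u.1.1 x - r * u.2.1 x))
        - D.layerRho a x * (-s ^ 2 * u.2.1 x) := by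
      intro x hx
      rw [← rho0_eq hx, ← eps0_eq hx, ← hmu]
      rfl
    refine layerSolution_of_integral (hD.layer_lt a)
      ((contDiffOn_const.mul sm1).add (sm2.mul sm3)) (contDiffOn_const.mul sm4) sm3
      (fun x hx => add_nonneg (mul_nonneg hs.le (hD.layerDel_nonneg a hx))
        (mul_nonneg (hD.layerdP_pos a hx).le (hD.layerRho_pos a hx).le))
      (fun x hx => mul_pos hs (hD.layerEps_pos a hx))
      (cφ.mono hsub) (cψ.mono hsub)
      (continuousOn_const.add (cont₃.mono hsub))
      ((continuousOn_const.add (cont₄.mono hsub)).sub continuousOn_const)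
      (fun x hx => ?_) (fun x hx => ?_) (fun x hx => ?_) (fun x hx => ?_) ?_ ?_
    · rw [H10.integral_deriv u.1.2 (hsub hb) (hsub hx)]; ring
    · rw [H10.integral_deriv u.2.2 (hsub hb) (hsub hx)]; ring
    · simp only [hf₁]
      rw [hint a i₃ hrhs₁ x hx, add_assoc]
    · simp only [hf₂]
      rw [hint a i₄ hrhs₂ x hx]
      ring
    · filter_upwards [hae a h₁] with x hx
      simp only [hf₁]
      rw [← hx.2, ← eps0_eq hx.1]
      rfl
    · filter_upwards [hae a h₂] with x hx
      simp only [hf₂]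
      rw [← hx.2, hoff' a x hx.1, add_sub_cancel_right, ← rho0_eq hx.1, ← dP0_eq hx.1,
        ← eps0_eq hx.1, ← del0_eq hx.1]
      rfl
  · simp only [hf₂, hoff]
    have : F.τ = D.σ * r ^ 2 := rfl
    rw [this]
    ring

end Admissible

end FluidData

/-! ### Finite sums of horizontal waves -/

/-- The superposition `∑ⱼ aⱼ(x₃) e^{i x' · ξⱼ}`. -/
noncomputable def modeSum (ξ : Fin 2 → EuclideanSpace ℝ (Fin 2)) (a : Fin 2 → ℝ → ℂ)
    (x : Fin 3 → ℝ) : ℂ := ∑ j, a j (x 2) * wave (ξ j) x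

lemma modeSum_congr {ξ : Fin 2 → EuclideanSpace ℝ (Fin 2)} {a b : Fin 2 → ℝ → ℂ}
    {x : Fin 3 → ℝ} (h : ∀ j, a j (x 2) = b j (x 2)) : modeSum ξ a x = modeSum ξ b x := by
  simp only [modeSum, h]

lemma hasDerivAt_wave_line (ξ : EuclideanSpace ℝ (Fin 2)) (x v : Fin 3 → ℝ) :
    HasDerivAt (fun t : ℝ => wave ξ (x + t • v))
      (Complex.I * ((v 0 * ξ 0 + v 1 * ξ 1 : ℝ) : ℂ) * wave ξ x) 0 := by
  have h1 : HasDerivAt (fun t : ℝ => ((x 0 + t * v 0) * ξ 0 + (x 1 + t * v 1) * ξ 1))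
      (v 0 * ξ 0 + v 1 * ξ 1) 0 :=
    (((((hasDerivAt_id (0 : ℝ)).mul_const (v 0)).const_add (x 0)).mul_const (ξ 0)).fun_add
      ((((hasDerivAt_id (0 : ℝ)).mul_const (v 1)).const_add (x 1)).mul_const (ξ 1))).congr_deriv
      (by ring)
  refine ((h1.ofReal_comp.const_mul Complex.I).cexp).congr_deriv ?_
  simp only [wave, zero_mul, add_zero]
  ring

lemma hasLineDerivAt_modeSum (ξ : Fin 2 → EuclideanSpace ℝ (Fin 2)) {a : Fin 2 → ℝ → ℂ}
    {a' : Fin 2 → ℂ} {x v : Fin 3 → ℝ}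
    (h : ∀ j, HasDerivAt (fun t : ℝ => a j (x 2 + t * v 2)) (a' j) 0) :
    HasLineDerivAt ℝ (modeSum ξ a)
      (∑ j, (a' j + Complex.I * ((v 0 * ξ j 0 + v 1 * ξ j 1 : ℝ) : ℂ) * a j (x 2)) * wave (ξ j) x)
      x v := by
  unfold HasLineDerivAt modeSum
  refine HasDerivAt.fun_sum fun j _ => ?_
  refine ((h j).fun_mul (hasDerivAt_wave_line (ξ j) x v)).congr_deriv ?_
  simp only [zero_mul, add_zero, zero_smul]
  ring

/-- No regularity of the profiles is needed for horizontal derivatives. Indexing by `k.castSucc`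
treats both directions at once. -/
lemma pd_castSucc_modeSum (ξ : Fin 2 → EuclideanSpace ℝ (Fin 2)) (a : Fin 2 → ℝ → ℂ)
    (x : Fin 3 → ℝ) (k : Fin 2) :
    pd k.castSucc (modeSum ξ a) x
      = modeSum ξ (fun j z => Complex.I * (ξ j k : ℂ) * a j z) x := by
  have := (hasLineDerivAt_modeSum ξ (a := a) (a' := 0) (x := x) (v := Pi.single k.castSucc 1)
    (fun j => by
      fin_cases k <;> simpa using hasDerivAt_const (0 : ℝ) (a j (x 2)))).lineDeriv
  rw [pd, this]
  fin_cases k <;> simp [modeSum]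

lemma pd_two_modeSum (ξ : Fin 2 → EuclideanSpace ℝ (Fin 2)) {a : Fin 2 → ℝ → ℂ}
    {a' : Fin 2 → ℂ} {x : Fin 3 → ℝ} (h : ∀ j, HasDerivAt (a j) (a' j) (x 2)) :
    pd 2 (modeSum ξ a) x = ∑ j, a' j * wave (ξ j) x := by
  have := (hasLineDerivAt_modeSum ξ (a := a) (a' := a') (x := x)
    (v := Pi.single 2 1) (fun j => by
      have h0 : HasDerivAt (fun t : ℝ => x 2 + t * (Pi.single 2 1 : Fin 3 → ℝ) 2) 1 0 := by
        simpa using (hasDerivAt_id (0 : ℝ)).const_add (x 2)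
      have h1 : HasDerivAt (a j) (a' j)
          (x 2 + 0 * (Pi.single 2 1 : Fin 3 → ℝ) 2) := by simpa using h j
      exact (h1.scomp (0 : ℝ) h0).congr_deriv (one_smul _ _))).lineDeriv
  rw [pd, this]
  simp

/-- A partial derivative sees only the germ, so inside an open layer a field may be replaced by its
layer formula. -/
lemma pd_congr {f g : (Fin 3 → ℝ) → ℂ} {S : Set ℝ} (hS : IsOpen S) {x : Fin 3 → ℝ}
    (hx : x 2 ∈ S) (h : ∀ y : Fin 3 → ℝ, y 2 ∈ S → f y = g y) (k : Fin 3) :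
    pd k f x = pd k g x := by
  refine Filter.EventuallyEq.lineDeriv_eq ?_
  filter_upwards [(hS.preimage (continuous_apply 2)).mem_nhds hx] with y hy using h y hy

/-! ### The fields as wave sums -/

/-- The vertical derivative of `ŵ`. -/
noncomputable def dwHat (Φ Ψ : ℝ → ℝ → ℝ) (ξ : EuclideanSpace ℝ (Fin 2)) (z : ℝ) : Fin 3 → ℂ :=
  ![-Complex.I * ((ξ 0 / ‖ξ‖ * deriv (Φ ‖ξ‖) z : ℝ) : ℂ),
    -Complex.I * ((ξ 1 / ‖ξ‖ * deriv (Φ ‖ξ‖) z : ℝ) : ℂ), ((deriv (Ψ ‖ξ‖) z : ℝ) : ℂ)]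

lemma hasDerivAt_wHat {Φ Ψ : ℝ → ℝ → ℝ} {ξ : EuclideanSpace ℝ (Fin 2)} {z : ℝ}
    (h1 : DifferentiableAt ℝ (Φ ‖ξ‖) z) (h2 : DifferentiableAt ℝ (Ψ ‖ξ‖) z) (i : Fin 3) :
    HasDerivAt (fun y => wHat Φ Ψ ξ y i) (dwHat Φ Ψ ξ z i) z := by
  have k := fun c : ℝ => ((h1.hasDerivAt.const_mul c).ofReal_comp).const_mul (-Complex.I)
  match i with
  | 0 => exact k (ξ 0 / ‖ξ‖)
  | 1 => exact k (ξ 1 / ‖ξ‖)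
  | 2 => exact h2.hasDerivAt.ofReal_comp

section Fields

variable (Φ Ψ : ℝ → ℝ → ℝ) (Λ : ℝ) (ξ : Fin 2 → EuclideanSpace ℝ (Fin 2)) (t : ℝ)

lemma etaField_eq (i : Fin 3) : (fun x => etaField Φ Ψ Λ ξ t x i) =
    modeSum ξ (fun j z => (Real.exp (Λ * t) : ℂ) * wHat Φ Ψ (ξ j) z i) := by
  ext x
  simp only [etaField, modeSum, Finset.mul_sum, mul_assoc]

lemma vField_eq (i : Fin 3) : (fun x => vField Φ Ψ Λ ξ t x i) =
    modeSum ξ (fun j z => (Λ : ℂ) * (Real.exp (Λ * t) : ℂ) * wHat Φ Ψ (ξ j) z i) := by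
  ext x
  simp only [vField, modeSum, Finset.mul_sum, mul_assoc]

/-- Since `(φ, θ) = (ξ/|ξ|) Φ`, the product `ξ · (φ, θ)` is `rΦ`, and the profile is the same for
both frequencies. -/
lemma qField_eq (D : FluidData) {r : ℝ} (hr0 : r ≠ 0) (hr : ∀ j, ‖ξ j‖ = r) (x : Fin 3 → ℝ) :
    qField D Φ Ψ Λ ξ t x = modeSum ξ (fun _ z => -(Real.exp (Λ * t) : ℂ) *
      ((D.rho0 z * (deriv (Ψ r) z + r * Φ r z) : ℝ) : ℂ)) x := by
  simp only [qField, modeSum, Finset.mul_sum]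
  refine Finset.sum_congr rfl fun j _ => ?_
  have h : ξ j 0 ^ 2 + ξ j 1 ^ 2 = r ^ 2 := by
    rw [← hr j, EuclideanSpace.norm_sq_eq]; simp
  have h2 : ξ j 0 * phi Φ (ξ j) (x 2) + ξ j 1 * theta Φ (ξ j) (x 2) + deriv (psi Ψ (ξ j)) (x 2)
      = deriv (Ψ r) (x 2) + r * Φ r (x 2) := by
    have : psi Ψ (ξ j) = Ψ r := by ext z; simp [psi, hr]
    rw [this]
    simp only [phi, theta, hr]
    field_simp
    linear_combination Φ r (x 2) * h
  rw [h2]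
  push_cast
  ring

end Fields


/-! ### Divergence and viscous stress of the mode. -/

namespace FluidData.IsNormalMode

variable {D : FluidData} {r s : ℝ} {Φ Ψ : ℝ → ℝ → ℝ} {f₁ : ℝ → ℝ} {f₂ : Phase → ℝ → ℝ}

section Stress

variable (hN : D.IsNormalMode r s (Φ r) (Ψ r) f₁ f₂)
  {ξ : Fin 2 → EuclideanSpace ℝ (Fin 2)} (hr : ∀ j, ‖ξ j‖ = r) {a : Phase}

include hN in
lemma differentiableAt_φ {z : ℝ} (hz : z ∈ D.layerIoo a) : DifferentiableAt ℝ (Φ r) z :=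
  ((hN.layer a).smooth_φ.contDiffAt (Icc_mem_nhds hz.1 hz.2)).differentiableAt (by simp)

include hN in
lemma differentiableAt_ψ {z : ℝ} (hz : z ∈ D.layerIoo a) : DifferentiableAt ℝ (Ψ r) z :=
  ((hN.layer a).smooth_ψ.contDiffAt (Icc_mem_nhds hz.1 hz.2)).differentiableAt (by simp)

include hr in
-- `ξ/r` is a unit vector; this is the rotation invariance that reduces everything to the modulus
-- `r`.
lemma sq_add_sq (hr0 : 0 < r) (j : Fin 2) :
    ((ξ j 0 / r : ℝ) : ℂ) ^ 2 + ((ξ j 1 / r : ℝ) : ℂ) ^ 2 = 1 := by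
  have h : ξ j 0 ^ 2 + ξ j 1 ^ 2 = r ^ 2 := by
    rw [← hr j, EuclideanSpace.norm_sq_eq]; simp
  norm_cast
  field_simp
  exact h

lemma coe_eq (hr0 : 0 < r) (j k : Fin 2) : (ξ j k : ℂ) = (r : ℂ) * ((ξ j k / r : ℝ) : ℂ) := by
  norm_cast
  field_simp

include hr in
lemma wHat_castSucc (j k : Fin 2) (z : ℝ) : wHat Φ Ψ (ξ j) z k.castSucc
    = -Complex.I * (((ξ j k / r : ℝ) : ℂ) * (Φ r z : ℂ)) := by
  fin_cases k <;> simp [wHat, phi, theta, hr]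

include hr in
lemma wHat_two (j : Fin 2) (z : ℝ) : wHat Φ Ψ (ξ j) z 2 = (Ψ r z : ℂ) := by
  simp [wHat, psi, hr]

include hr in
lemma dwHat_castSucc (j k : Fin 2) (z : ℝ) : dwHat Φ Ψ (ξ j) z k.castSucc
    = -Complex.I * (((ξ j k / r : ℝ) : ℂ) * ((deriv (Φ r) z : ℝ) : ℂ)) := by
  fin_cases k <;> simp [dwHat, hr]

include hr in
lemma dwHat_two (j : Fin 2) (z : ℝ) : dwHat Φ Ψ (ξ j) z 2 = ((deriv (Ψ r) z : ℝ) : ℂ) := by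
  simp [dwHat, hr]

variable (Φ Ψ ξ) in
lemma pd_castSucc_vField (Λ t : ℝ) (i : Fin 3) (k : Fin 2) (x : Fin 3 → ℝ) :
    pd k.castSucc (fun y => vField Φ Ψ Λ ξ t y i) x = modeSum ξ (fun j z => Complex.I *
      (ξ j k : ℂ) * ((Λ : ℂ) * (Real.exp (Λ * t) : ℂ) * wHat Φ Ψ (ξ j) z i)) x := by
  rw [vField_eq, pd_castSucc_modeSum]

include hN hr in
lemma pd_two_vField (Λ t : ℝ) (i : Fin 3) {x : Fin 3 → ℝ} (hx : x 2 ∈ D.layerIoo a) :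
    pd 2 (fun y => vField Φ Ψ Λ ξ t y i) x = modeSum ξ (fun j z =>
      (Λ : ℂ) * (Real.exp (Λ * t) : ℂ) * dwHat Φ Ψ (ξ j) z i) x := by
  rw [vField_eq]
  refine pd_two_modeSum ξ fun j => ?_
  exact (hasDerivAt_wHat (by rw [hr j]; exact hN.differentiableAt_φ hx)
    (by rw [hr j]; exact hN.differentiableAt_ψ hx) i).const_mul _

include hN hr in
lemma diverge_vField (hr0 : 0 < r) (Λ t : ℝ) {x : Fin 3 → ℝ} (hx : x 2 ∈ D.layerIoo a) :
    diverge (vField Φ Ψ Λ ξ t) x = modeSum ξ (fun _ z => (Λ : ℂ) * (Real.exp (Λ * t) : ℂ) *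
      (((deriv (Ψ r) z : ℝ) : ℂ) + r * (Φ r z : ℂ))) x := by
  unfold diverge
  rw [Fin.sum_univ_castSucc, Fin.sum_univ_two, pd_castSucc_vField, pd_castSucc_vField]
  change _ + pd 2 (fun y => vField Φ Ψ Λ ξ t y 2) x = _
  rw [hN.pd_two_vField hr Λ t 2 hx]
  simp only [modeSum, ← Finset.sum_add_distrib]
  refine Finset.sum_congr rfl fun j _ => ?_
  rw [wHat_castSucc hr, wHat_castSucc hr, dwHat_two hr, coe_eq hr0 j 0, coe_eq hr0 j 1]
  linear_combination (Λ : ℂ) * (Real.exp (Λ * t) : ℂ) * r * (Φ r (x 2) : ℂ) * wave (ξ j) x *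
    (sq_add_sq hr hr0 j - (((ξ j 0 / r : ℝ) : ℂ) ^ 2 + ((ξ j 1 / r : ℝ) : ℂ) ^ 2) * Complex.I_sq)

lemma viscousStress_symm (v : (Fin 3 → ℝ) → Fin 3 → ℂ) (i j : Fin 3) :
    D.viscousStress v i j = D.viscousStress v j i := by
  ext x
  simp only [viscousStress, kron, eq_comm (a := i) (b := j)]
  ring

include hN hr in
lemma viscousStress_castSucc_castSucc (hr0 : 0 < r) (Λ t : ℝ) (k l : Fin 2) {x : Fin 3 → ℝ}
    (hx : x 2 ∈ D.layerIoo a) :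
    D.viscousStress (vField Φ Ψ Λ ξ t) k.castSucc l.castSucc x = modeSum ξ (fun j z =>
      (Λ : ℂ) * (Real.exp (Λ * t) : ℂ) * (2 * (D.layerEps a z : ℂ) * r * ((ξ j k / r : ℝ) : ℂ) *
        ((ξ j l / r : ℝ) : ℂ) * (Φ r z : ℂ) + ((D.layerDel a z : ℂ) - 2 / 3 * (D.layerEps a z : ℂ))
          * (((deriv (Ψ r) z : ℝ) : ℂ) + r * (Φ r z : ℂ)) * (if k = l then 1 else 0))) x := by
  unfold viscousStress
  rw [eps0_eq hx, del0_eq hx, hN.diverge_vField hr hr0 Λ t hx, pd_castSucc_vField,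
    pd_castSucc_vField]
  have hk : kron k.castSucc l.castSucc = if k = l then 1 else 0 := by
    simp [kron]
  rw [hk]
  simp only [modeSum, Finset.mul_sum, Finset.sum_mul, ← Finset.sum_add_distrib,
    ← Finset.sum_sub_distrib]
  refine Finset.sum_congr rfl fun j _ => ?_
  rw [wHat_castSucc hr, wHat_castSucc hr, coe_eq hr0 j k, coe_eq hr0 j l]
  linear_combination -2 * (Λ : ℂ) * (Real.exp (Λ * t) : ℂ) * (D.layerEps a (x 2) : ℂ) * r *
    ((ξ j k / r : ℝ) : ℂ) * ((ξ j l / r : ℝ) : ℂ) * (Φ r (x 2) : ℂ) * wave (ξ j) x * Complex.I_sq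

include hN hr in
-- The velocity is `s` times the displacement, so the true viscosity acts as `s ε₀` and the
-- tangential stress is the horizontal flux of the variational problem.
lemma viscousStress_castSucc_two (hr0 : 0 < r) (t : ℝ) (k : Fin 2) {x : Fin 3 → ℝ}
    (hx : x 2 ∈ D.layerIoo a) :
    D.viscousStress (vField Φ Ψ s ξ t) k.castSucc 2 x = modeSum ξ (fun j z =>
      -Complex.I * (Real.exp (s * t) : ℂ) * ((ξ j k / r : ℝ) : ℂ) * (f₁ z : ℂ)) x := by
  unfold viscousStress
  have hk : kron k.castSucc 2 = 0 := by
    fin_cases k <;> simp [kron]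
  have hf := (hN.layer a).f₁_eq _ hx
  rw [eps0_eq hx, del0_eq hx, pd_castSucc_vField, hN.pd_two_vField hr _ _ _ hx, hk]
  simp only [modeSum, Finset.mul_sum, mul_zero, sub_zero, add_zero,
    ← Finset.sum_add_distrib]
  refine Finset.sum_congr rfl fun j _ => ?_
  rw [wHat_two hr, dwHat_castSucc hr, coe_eq hr0 j k, hf]
  push_cast
  ring

include hN hr in
-- `f₂` also contains the pressure through `κ = s δ₀ + P'(ρ₀) ρ₀`, so that part must be subtracted
-- to isolate the viscous stress.
lemma viscousStress_two_two (hr0 : 0 < r) (t : ℝ) {x : Fin 3 → ℝ}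
    (hx : x 2 ∈ D.layerIoo a) :
    D.viscousStress (vField Φ Ψ s ξ t) 2 2 x = modeSum ξ (fun _ z =>
      (Real.exp (s * t) : ℂ) * ((f₂ a z : ℂ) - ((D.layerdP a z * D.layerRho a z *
        (deriv (Ψ r) z + r * Φ r z) : ℝ) : ℂ))) x := by
  unfold viscousStress
  have hk : kron 2 2 = 1 := by simp [kron]
  have hf := (hN.layer a).f₂_eq _ hx
  rw [eps0_eq hx, del0_eq hx, hN.pd_two_vField hr _ _ _ hx, hk, hN.diverge_vField hr hr0 _ _ hx]
  simp only [modeSum, Finset.mul_sum, mul_one, ← Finset.sum_add_distrib,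
    ← Finset.sum_sub_distrib]
  refine Finset.sum_congr rfl fun j _ => ?_
  rw [dwHat_two hr, hf]
  push_cast
  ring

end Stress

end FluidData.IsNormalMode

lemma mem_layers_iff {D : FluidData} {x : Fin 3 → ℝ} :
    x ∈ D.domainLower ∪ D.domainUpper ↔ ∃ a, x 2 ∈ D.layerIoo a :=
  ⟨fun h => h.elim (fun h => ⟨.lower, h⟩) fun h => ⟨.upper, h⟩, fun ⟨a, h⟩ => by
    cases a
    · exact Or.inl h
    · exact Or.inr h⟩

lemma hasDerivAt_exp_mul (s : ℝ) (c : ℂ) (t : ℝ) :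
    HasDerivAt (fun τ : ℝ => (Real.exp (s * τ) : ℂ) * c) (s * (Real.exp (s * t) * c)) t := by
  have h : HasDerivAt (fun τ : ℝ => Real.exp (s * τ)) (Real.exp (s * t) * (s * 1)) t :=
    ((hasDerivAt_id t).const_mul s).exp
  refine (h.ofReal_comp.mul_const c).congr_deriv ?_
  push_cast
  ring

lemma dt_exp_mul (s : ℝ) (c : ℂ) {t : ℝ} (ht : 0 ≤ t) :
    dt (fun τ : ℝ => (Real.exp (s * τ) : ℂ) * c) t = s * (Real.exp (s * t) * c) :=
  (hasDerivAt_exp_mul s c t).hasDerivWithinAt.derivWithin (uniqueDiffOn_Ici 0 t ht)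

section Fields

variable (Φ Ψ : ℝ → ℝ → ℝ) (s : ℝ) (ξ : Fin 2 → EuclideanSpace ℝ (Fin 2))

lemma dt_etaField {t : ℝ} (ht : 0 ≤ t) (x : Fin 3 → ℝ) (i : Fin 3) :
    dt (fun τ => etaField Φ Ψ s ξ τ x i) t = vField Φ Ψ s ξ t x i := by
  simp only [etaField, vField, mul_assoc]
  exact dt_exp_mul s _ ht

lemma dt_vField {t : ℝ} (ht : 0 ≤ t) (x : Fin 3 → ℝ) (i : Fin 3) :
    dt (fun τ => vField Φ Ψ s ξ τ x i) t = s * vField Φ Ψ s ξ t x i := by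
  have : (fun τ => vField Φ Ψ s ξ τ x i) = fun τ => (Real.exp (s * τ) : ℂ) *
      (s * ∑ j, wHat Φ Ψ (ξ j) (x 2) i * wave (ξ j) x) := by
    ext τ; simp only [vField]; ring
  rw [this, dt_exp_mul s _ ht, vField]
  ring

lemma dt_qField (D : FluidData) {t : ℝ} (ht : 0 ≤ t) (x : Fin 3 → ℝ) :
    dt (fun τ => qField D Φ Ψ s ξ τ x) t = s * qField D Φ Ψ s ξ t x := by
  simp only [qField, neg_mul, mul_assoc]
  simp only [← mul_neg]
  exact dt_exp_mul s _ ht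

end Fields

/-! ### The continuity and momentum equations inside the layers. -/

namespace FluidData.IsNormalMode

variable {D : FluidData} {r s : ℝ} {Φ Ψ : ℝ → ℝ → ℝ} {f₁ : ℝ → ℝ} {f₂ : Phase → ℝ → ℝ}
  {ξ : Fin 2 → EuclideanSpace ℝ (Fin 2)} {a : Phase}
  (hN : D.IsNormalMode r s (Φ r) (Ψ r) f₁ f₂)
  (hr0 : 0 < r) (hr : ∀ j, ‖ξ j‖ = r)

include hN in
lemma contDiffOn_div (a : Phase) :
    ContDiffOn ℝ ∞ (fun z => deriv (Ψ r) z + r * Φ r z) (D.layerIoo a) := by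
  have h1 := (hN.layer a).smooth_φ.mono Ioo_subset_Icc_self
  have h2 := (hN.layer a).smooth_ψ.mono Ioo_subset_Icc_self
  exact (h2.deriv_of_isOpen isOpen_Ioo (by simp)).add (contDiffOn_const.mul h1)

include hN hr0 hr

lemma eq_q {t : ℝ} (ht : 0 ≤ t) {x : Fin 3 → ℝ} (hx : x 2 ∈ D.layerIoo a) :
    dt (fun τ => qField D Φ Ψ s ξ τ x) t
      + (D.rho0 (x 2) : ℂ) * diverge (vField Φ Ψ s ξ t) x = 0 := by
  rw [dt_qField _ _ _ _ _ ht, qField_eq _ _ _ _ _ D hr0.ne' hr, hN.diverge_vField hr hr0 _ _ hx]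
  simp only [modeSum, Finset.mul_sum, ← Finset.sum_add_distrib]
  refine Finset.sum_eq_zero fun j _ => ?_
  push_cast
  ring

omit hN in
lemma dP0_mul_qField (t : ℝ) : (fun y => (D.dP0 (y 2) : ℂ) * qField D Φ Ψ s ξ t y)
    = modeSum ξ (fun _ z => -(Real.exp (s * t) : ℂ) *
      ((D.dP0 z * D.rho0 z * (deriv (Ψ r) z + r * Φ r z) : ℝ) : ℂ)) := by
  ext y
  rw [qField_eq _ _ _ _ _ D hr0.ne' hr]
  simp only [modeSum, Finset.mul_sum]
  refine Finset.sum_congr rfl fun j _ => ?_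
  push_cast
  ring

lemma eq_v_castSucc {t : ℝ} (ht : 0 ≤ t) (k : Fin 2) {x : Fin 3 → ℝ} (hx : x 2 ∈ D.layerIoo a) :
    (D.rho0 (x 2) : ℂ) * dt (fun τ => vField Φ Ψ s ξ τ x k.castSucc) t
        + pd k.castSucc (fun y => (D.dP0 (y 2) : ℂ) * qField D Φ Ψ s ξ t y) x
        + (D.g : ℂ) * qField D Φ Ψ s ξ t x * kron k.castSucc 2
        + (D.g : ℂ) * (D.rho0 (x 2) : ℂ)
          * pd k.castSucc (fun y => etaField Φ Ψ s ξ t y 2) x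
      = ∑ j, pd j (D.viscousStress (vField Φ Ψ s ξ t) k.castSucc j) x := by
  have hk : kron k.castSucc 2 = 0 := by
    fin_cases k <;> simp [kron]
  have hS : IsOpen (D.layerIoo a) := isOpen_Ioo
  rw [Fin.sum_univ_castSucc, Fin.sum_univ_two,
    pd_congr hS hx (fun y hy => hN.viscousStress_castSucc_castSucc hr hr0 s t k 0 hy),
    pd_congr hS hx (fun y hy => hN.viscousStress_castSucc_castSucc hr hr0 s t k 1 hy)]
  change _ = _ + pd 2 (D.viscousStress (vField Φ Ψ s ξ t) k.castSucc 2) x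
  rw [pd_congr hS hx (fun y hy => hN.viscousStress_castSucc_two hr hr0 t k hy),
    pd_two_modeSum ξ (fun j =>
      (((hN.layer a).deriv_f₁ _ hx).differentiableAt.hasDerivAt.ofReal_comp).const_mul _),
    pd_castSucc_modeSum, pd_castSucc_modeSum, dt_vField _ _ _ _ ht,
    dP0_mul_qField hr0 hr, pd_castSucc_modeSum, etaField_eq, pd_castSucc_modeSum, hk,
    congrFun (vField_eq Φ Ψ s ξ t k.castSucc) x]
  simp only [modeSum, Finset.mul_sum, mul_zero, add_zero, ← Finset.sum_add_distrib]
  refine Finset.sum_congr rfl fun j _ => ?_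
  rw [((hN.layer a).deriv_f₁ _ hx).deriv, wHat_two hr, wHat_castSucc hr, rho0_eq hx, dP0_eq hx,
    coe_eq hr0 j 0, coe_eq hr0 j 1, coe_eq hr0 j k]
  have h := sq_add_sq hr hr0 j
  -- The components of the unit vector become opaque atoms, so `push_cast` does not split the
  -- quotients.
  obtain ⟨c, hc⟩ : ∃ c : Fin 2 → ℂ, ∀ l, ((ξ j l / r : ℝ) : ℂ) = c l := ⟨_, fun _ => rfl⟩
  simp only [hc] at h ⊢
  push_cast
  fin_cases k <;>
  · simp only [Fin.zero_eta, Fin.mk_one, Fin.isValue, reduceIte, zero_ne_one, one_ne_zero]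
    linear_combination (-2 * Complex.I * r ^ 2 * c _ * s * Complex.exp (s * t)
      * (D.layerEps a (x 2) : ℂ) * (Φ r (x 2) : ℂ) * wave (ξ j) x) * h

lemma eq_v_two (hD : D.Admissible) {t : ℝ} (ht : 0 ≤ t) {x : Fin 3 → ℝ}
    (hx : x 2 ∈ D.layerIoo a) :
    (D.rho0 (x 2) : ℂ) * dt (fun τ => vField Φ Ψ s ξ τ x 2) t
        + pd 2 (fun y => (D.dP0 (y 2) : ℂ) * qField D Φ Ψ s ξ t y) x
        + (D.g : ℂ) * qField D Φ Ψ s ξ t x * kron 2 2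
        + (D.g : ℂ) * (D.rho0 (x 2) : ℂ) * pd 2 (fun y => etaField Φ Ψ s ξ t y 2) x
      = ∑ j, pd j (D.viscousStress (vField Φ Ψ s ξ t) 2 j) x := by
  have hk : kron 2 2 = 1 := by simp [kron]
  have hS : IsOpen (D.layerIoo a) := isOpen_Ioo
  -- Only differentiability of the pressure profile is needed: its derivative appears on both sides
  -- and cancels.
  have hp : HasDerivAt (fun z => D.layerdP a z * D.layerRho a z * (deriv (Ψ r) z + r * Φ r z))
      (deriv (fun z => D.layerdP a z * D.layerRho a z * (deriv (Ψ r) z + r * Φ r z)) (x 2))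
      (x 2) := by
    have h := (((hD.contDiffOn_layerdP a).mono (layerIoo_subset a)).mul
      ((hD.contDiffOn_layerRho a).mono (layerIoo_subset a))).mul (hN.contDiffOn_div a)
    exact ((h.contDiffAt (hS.mem_nhds hx)).differentiableAt (by simp)).hasDerivAt
  have hq : ∀ y : Fin 3 → ℝ, y 2 ∈ D.layerIoo a → (D.dP0 (y 2) : ℂ) * qField D Φ Ψ s ξ t y
      = modeSum ξ (fun _ z => -(Real.exp (s * t) : ℂ) *
        ((D.layerdP a z * D.layerRho a z * (deriv (Ψ r) z + r * Φ r z) : ℝ) : ℂ)) y :=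
    fun y hy => (congrFun (dP0_mul_qField hr0 hr t) y).trans
      (modeSum_congr fun j => by rw [dP0_eq hy, rho0_eq hy])
  rw [Fin.sum_univ_castSucc, Fin.sum_univ_two, viscousStress_symm _ 2, viscousStress_symm _ 2,
    pd_congr hS hx (fun y hy => hN.viscousStress_castSucc_two hr hr0 t 0 hy),
    pd_congr hS hx (fun y hy => hN.viscousStress_castSucc_two hr hr0 t 1 hy)]
  change _ = _ + pd 2 (D.viscousStress (vField Φ Ψ s ξ t) 2 2) x
  rw [pd_congr hS hx (fun y hy => hN.viscousStress_two_two hr hr0 t hy),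
    pd_two_modeSum ξ (fun j =>
      ((((hN.layer a).deriv_f₂ _ hx).ofReal_comp).fun_sub hp.ofReal_comp).const_mul _),
    pd_castSucc_modeSum, pd_castSucc_modeSum, dt_vField _ _ _ _ ht,
    pd_congr hS hx hq, pd_two_modeSum ξ (fun j => hp.ofReal_comp.const_mul _), etaField_eq,
    pd_two_modeSum ξ (fun j => (hasDerivAt_wHat (by rw [hr j]; exact hN.differentiableAt_φ hx)
    (by rw [hr j]; exact hN.differentiableAt_ψ hx) 2).const_mul _), hk,
    congrFun (vField_eq Φ Ψ s ξ t 2) x, qField_eq _ _ _ _ _ D hr0.ne' hr]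
  simp only [modeSum, Finset.mul_sum, mul_one, ← Finset.sum_add_distrib]
  refine Finset.sum_congr rfl fun j _ => ?_
  rw [wHat_two hr, dwHat_two hr, rho0_eq hx, coe_eq hr0 j 0, coe_eq hr0 j 1]
  have h := sq_add_sq hr hr0 j
  have hf := (hN.layer a).f₁_eq _ hx
  obtain ⟨c, hc⟩ : ∃ c : Fin 2 → ℂ, ∀ l, ((ξ j l / r : ℝ) : ℂ) = c l := ⟨_, fun _ => rfl⟩
  simp only [hc] at h ⊢
  rw [hf]
  push_cast
  linear_combination (r * Complex.exp (s * t) * (s * (D.layerEps a (x 2) : ℂ) *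
    (((deriv (Φ r) (x 2) : ℝ) : ℂ) - r * (Ψ r (x 2) : ℂ))) * wave (ξ j) x) *
    ((c 0 ^ 2 + c 1 ^ 2) * Complex.I_sq - h)

end FluidData.IsNormalMode

lemma eq_castSucc_or_eq_two (i : Fin 3) : (∃ k : Fin 2, i = k.castSucc) ∨ i = 2 :=
  (Fin.eq_castSucc_or_eq_last i).imp (fun ⟨k, hk⟩ => ⟨k, hk⟩) id

section Fields

variable (Φ Ψ : ℝ → ℝ → ℝ) (s : ℝ) (ξ : Fin 2 → EuclideanSpace ℝ (Fin 2))

lemma etaField_eq_exp_mul (t : ℝ) (x : Fin 3 → ℝ) (i : Fin 3) : etaField Φ Ψ s ξ t x i =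
    (Real.exp (s * t) : ℂ) * modeSum ξ (fun j z => wHat Φ Ψ (ξ j) z i) x := rfl

lemma vField_eq_exp_mul (t : ℝ) (x : Fin 3 → ℝ) (i : Fin 3) : vField Φ Ψ s ξ t x i =
    (Real.exp (s * t) : ℂ) * modeSum ξ (fun j z => (s : ℂ) * wHat Φ Ψ (ξ j) z i) x := by
  simp only [vField, modeSum, Finset.mul_sum]
  exact Finset.sum_congr rfl fun j _ => by ring

lemma qField_eq_exp_mul (D : FluidData) {r : ℝ} (hr0 : r ≠ 0) (hr : ∀ j, ‖ξ j‖ = r) (t : ℝ)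
    (x : Fin 3 → ℝ) : qField D Φ Ψ s ξ t x = (Real.exp (s * t) : ℂ) * modeSum ξ (fun _ z =>
      -((D.rho0 z * (deriv (Ψ r) z + r * Φ r z) : ℝ) : ℂ)) x := by
  rw [qField_eq _ _ _ _ _ D hr0 hr]
  simp only [modeSum, Finset.mul_sum]
  exact Finset.sum_congr rfl fun j _ => by ring

end Fields

/-! ### Symmetry and periodicity of the waves -/

lemma conj_wave (ξ : EuclideanSpace ℝ (Fin 2)) (x : Fin 3 → ℝ) :
    (starRingEnd ℂ) (wave ξ x) = wave (-ξ) x := by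
  unfold wave
  rw [← Complex.exp_conj]
  simp
  ring_nf

lemma conj_wHat (Φ Ψ : ℝ → ℝ → ℝ) (ξ : EuclideanSpace ℝ (Fin 2)) (z : ℝ) (i : Fin 3) :
    (starRingEnd ℂ) (wHat Φ Ψ ξ z i) = wHat Φ Ψ (-ξ) z i := by
  fin_cases i <;> simp [wHat, phi, theta, psi] <;> ring

/-- Conjugation exchanges the two opposite waves, so conjugate profiles make the sum equal to its
own conjugate. -/
lemma modeSum_im {ξ : Fin 2 → EuclideanSpace ℝ (Fin 2)} (hξ : ξ 0 = -ξ 1) {a : Fin 2 → ℝ → ℂ}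
    {x : Fin 3 → ℝ} (h : (starRingEnd ℂ) (a 0 (x 2)) = a 1 (x 2)) : (modeSum ξ a x).im = 0 := by
  have h' : (starRingEnd ℂ) (a 1 (x 2)) = a 0 (x 2) := by rw [← h, Complex.conj_conj]
  rw [← Complex.conj_eq_iff_im, modeSum, Fin.sum_univ_two, map_add, map_mul, map_mul, conj_wave,
    conj_wave, h, h', hξ, neg_neg, add_comm]

lemma wave_add_single {L : ℝ} (hL : L ≠ 0) {ξ : EuclideanSpace ℝ (Fin 2)} (hξ : IsLattice L ξ)
    {j : Fin 3} (hj : j ≠ 2) (x : Fin 3 → ℝ) :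
    wave ξ (x + Pi.single j (2 * Real.pi * L)) = wave ξ x := by
  obtain ⟨n, hn⟩ := hξ
  unfold wave
  rw [Complex.exp_eq_exp_iff_exists_int]
  have key : ∀ k : ℤ, (2 * Real.pi * L) * ((k : ℝ) / L) = k * (2 * Real.pi) := fun k => by
    field_simp
  obtain ⟨k, hk⟩ : ∃ k : ℤ, (x + Pi.single j (2 * Real.pi * L) : Fin 3 → ℝ) 0 * ξ 0
      + (x + Pi.single j (2 * Real.pi * L) : Fin 3 → ℝ) 1 * ξ 1
      = x 0 * ξ 0 + x 1 * ξ 1 + k * (2 * Real.pi) := by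
    rcases eq_castSucc_or_eq_two j with ⟨i, rfl⟩ | rfl
    · refine ⟨n i, ?_⟩
      rw [← key]
      fin_cases i <;> simp [hn] <;> ring
    · exact absurd rfl hj
  refine ⟨k, ?_⟩
  rw [hk]
  push_cast
  ring

lemma modeSum_add_single {L : ℝ} (hL : L ≠ 0) {ξ : Fin 2 → EuclideanSpace ℝ (Fin 2)}
    (hξ : ∀ j, IsLattice L (ξ j)) (a : Fin 2 → ℝ → ℂ) {j : Fin 3} (hj : j ≠ 2) (x : Fin 3 → ℝ) :
    modeSum ξ a (x + Pi.single j (2 * Real.pi * L)) = modeSum ξ a x := by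
  have h2 : (x + Pi.single j (2 * Real.pi * L) : Fin 3 → ℝ) 2 = x 2 := by simp [hj]
  simp only [modeSum, wave_add_single hL (hξ _) hj, h2]

/-! ### Regularity of wave sums -/

lemma contDiff_wave (ξ : EuclideanSpace ℝ (Fin 2)) : ContDiff ℝ ∞ (wave ξ) := by
  unfold wave
  have h : ContDiff ℝ ∞ fun x : Fin 3 → ℝ => x 0 * ξ 0 + x 1 * ξ 1 := by fun_prop
  exact (contDiff_const.mul (Complex.ofRealCLM.contDiff.comp h)).cexp

lemma contDiff_exp_mul (s : ℝ) : ContDiff ℝ ∞ (fun t : ℝ => (Real.exp (s * t) : ℂ)) := by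
  have h : ContDiff ℝ ∞ fun t : ℝ => Real.exp (s * t) := by fun_prop
  exact Complex.ofRealCLM.contDiff.comp h

lemma contDiffAt_exp_mul_modeSum (s : ℝ) (ξ : Fin 2 → EuclideanSpace ℝ (Fin 2))
    {a : Fin 2 → ℝ → ℂ} {p : ℝ × (Fin 3 → ℝ)} (h : ∀ j, ContDiffAt ℝ ∞ (a j) (p.2 2)) :
    ContDiffAt ℝ ∞ (fun p : ℝ × (Fin 3 → ℝ) =>
      (Real.exp (s * p.1) : ℂ) * modeSum ξ a p.2) p := by
  refine ((contDiff_exp_mul s).comp contDiff_fst).contDiffAt.mul ?_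
  unfold modeSum
  refine ContDiffAt.sum fun j _ => ContDiffAt.mul ?_ ?_
  · exact ContDiffAt.comp (𝕜 := ℝ) p (g := a j) (f := fun p : ℝ × (Fin 3 → ℝ) => p.2 2) (h j)
      (by fun_prop)
  · exact ((contDiff_wave (ξ j)).comp contDiff_snd).contDiffAt

lemma continuousOn_modeSum (ξ : Fin 2 → EuclideanSpace ℝ (Fin 2)) {a : Fin 2 → ℝ → ℂ}
    {S : Set ℝ} (h : ∀ j, ContinuousOn (a j) S) :
    ContinuousOn (modeSum ξ a) {x | x 2 ∈ S} := by
  unfold modeSum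
  refine continuousOn_finsetSum _ fun j _ => ContinuousOn.mul ?_
    (contDiff_wave (ξ j)).continuous.continuousOn
  exact (h j).comp (continuous_apply 2).continuousOn fun x hx => hx

lemma continuousOn_exp_mul_modeSum (s : ℝ) (ξ : Fin 2 → EuclideanSpace ℝ (Fin 2))
    {a : Fin 2 → ℝ → ℂ} {S : Set ℝ} (h : ∀ j, ContinuousOn (a j) S) :
    ContinuousOn (fun p : ℝ × (Fin 3 → ℝ) =>
      (Real.exp (s * p.1) : ℂ) * modeSum ξ a p.2) (Ici 0 ×ˢ {x | x 2 ∈ S}) :=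
  ((contDiff_exp_mul s).continuous.comp continuous_fst).continuousOn.mul
    ((continuousOn_modeSum ξ h).comp continuousOn_snd fun _ hp => hp.2)

/-- Traces at the interface need only agreement inside the open layer with profiles continuous up to
height `0`. -/
lemma tendsto_modeSum_of_eq {ξ : Fin 2 → EuclideanSpace ℝ (Fin 2)} {b : Fin 2 → ℝ → ℂ}
    {S T : Set ℝ} (hST : S ⊆ T) (h0 : (0 : ℝ) ∈ T) (hb : ∀ j, ContinuousOn (b j) T)
    {f : (Fin 3 → ℝ) → ℂ} (hf : ∀ x : Fin 3 → ℝ, x 2 ∈ S → f x = modeSum ξ b x) (x₁ x₂ : ℝ) :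
    Tendsto f (𝓝[{x | x 2 ∈ S}] ![x₁, x₂, 0]) (𝓝 (modeSum ξ b ![x₁, x₂, 0])) := by
  have hc := (continuousOn_modeSum ξ hb) ![x₁, x₂, 0] (by simpa using h0)
  refine (hc.mono_left (nhdsWithin_mono _ fun x hx => hST hx)).congr' ?_
  filter_upwards [self_mem_nhdsWithin] with x hx using (hf x hx).symm

lemma FluidData.Admissible.hasJump_zero {D : FluidData} (hD : D.Admissible)
    {f : (Fin 3 → ℝ) → ℂ} (hf : ContinuousOn f {x | x 2 ∈ Icc (-D.m) D.ℓ}) (x₁ x₂ : ℝ) :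
    D.HasJump f x₁ x₂ 0 := by
  have h0 := hf ![x₁, x₂, 0] (by simpa using ⟨hD.m_pos.le, hD.ℓ_pos.le⟩)
  refine ⟨_, _, h0.mono_left (nhdsWithin_mono _ fun x hx => ?_),
    h0.mono_left (nhdsWithin_mono _ fun x hx => ?_), sub_self _⟩
  · exact ⟨by linarith [hx.1, hD.m_pos], hx.2.le⟩
  · exact ⟨hx.1.le, by linarith [hx.2, hD.ℓ_pos]⟩

/-! ### Interface conditions and assembly of the linear solution. -/

namespace FluidData.IsNormalMode

variable {D : FluidData} {r s : ℝ} {Φ Ψ : ℝ → ℝ → ℝ} {f₁ : ℝ → ℝ} {f₂ : Phase → ℝ → ℝ}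
  {ξ : Fin 2 → EuclideanSpace ℝ (Fin 2)}
  (hN : D.IsNormalMode r s (Φ r) (Ψ r) f₁ f₂)
  (hr0 : 0 < r) (hr : ∀ j, ‖ξ j‖ = r)

include hN hr

lemma continuousOn_wHat (i : Fin 3) (j : Fin 2) :
    ContinuousOn (fun z => wHat Φ Ψ (ξ j) z i) (Icc (-D.m) D.ℓ) := by
  have h1 := Complex.continuous_ofReal.comp_continuousOn hN.cont_φ
  have h2 := Complex.continuous_ofReal.comp_continuousOn hN.cont_ψ
  rcases eq_castSucc_or_eq_two i with ⟨k, rfl⟩ | rfl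
  · simp only [wHat_castSucc hr]
    exact continuousOn_const.mul (continuousOn_const.mul h1)
  · exact h2.congr fun z _ => wHat_two hr j z

lemma contDiffOn_wHat (a : Phase) (i : Fin 3) (j : Fin 2) :
    ContDiffOn ℝ ∞ (fun z => wHat Φ Ψ (ξ j) z i) (D.layerIcc a) := by
  have h1 := Complex.ofRealCLM.contDiff.comp_contDiffOn (hN.layer a).smooth_φ
  have h2 := Complex.ofRealCLM.contDiff.comp_contDiffOn (hN.layer a).smooth_ψ
  rcases eq_castSucc_or_eq_two i with ⟨k, rfl⟩ | rfl
  · simp only [wHat_castSucc hr]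
    exact contDiffOn_const.mul (contDiffOn_const.mul h1)
  · exact h2.congr fun z _ => wHat_two hr j z

include hr0

/-- The same `f₁` represents the tangential stress in both layers, and its one-sided limits agree.
-/
lemma hasJump_stress_castSucc (hD : D.Admissible) (t x₁ x₂ : ℝ) (k : Fin 2) :
    D.HasJump (fun x => (D.dP0 (x 2) : ℂ) * qField D Φ Ψ s ξ t x * kron k.castSucc 2
      - D.viscousStress (vField Φ Ψ s ξ t) k.castSucc 2 x) x₁ x₂ 0 := by
  have hk : kron k.castSucc 2 = 0 := by
    fin_cases k <;> simp [kron]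
  set b : Fin 2 → ℝ → ℂ := fun j z =>
    Complex.I * (Real.exp (s * t) : ℂ) * ((ξ j k / r : ℝ) : ℂ) * (f₁ z : ℂ) with hb
  have key : ∀ a, Tendsto (fun x => (D.dP0 (x 2) : ℂ) * qField D Φ Ψ s ξ t x * kron k.castSucc 2
      - D.viscousStress (vField Φ Ψ s ξ t) k.castSucc 2 x)
      (𝓝[{x | x 2 ∈ D.layerIoo a}] ![x₁, x₂, 0]) (𝓝 (modeSum ξ b ![x₁, x₂, 0])) := by
    intro a
    refine tendsto_modeSum_of_eq (layerIoo_subset a) ?_ (fun j => ?_) (fun x hx => ?_) x₁ x₂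
    · cases a
      · exact right_mem_Icc.2 (neg_nonpos.2 hD.m_pos.le)
      · exact left_mem_Icc.2 hD.ℓ_pos.le
    · exact continuousOn_const.mul
        (Complex.continuous_ofReal.comp_continuousOn (hN.layer a).smooth_f₁.continuousOn)
    · rw [hk, mul_zero, hN.viscousStress_castSucc_two hr hr0 t k hx]
      simp only [modeSum, hb, zero_sub, ← Finset.sum_neg_distrib]
      exact Finset.sum_congr rfl fun j _ => by ring
  exact ⟨_, _, key .upper, key .lower, sub_self _⟩

/-- Pressure minus normal viscous stress has profile `-e^{st} f₂`. Its jump `-σr²ψ(0)e^{st}` matches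
the horizontal Laplacian, which multiplies each wave by `-r²`. -/
lemma hasJump_stress_two (hD : D.Admissible) (t x₁ x₂ : ℝ) :
    D.HasJump (fun x => (D.dP0 (x 2) : ℂ) * qField D Φ Ψ s ξ t x * kron 2 2
      - D.viscousStress (vField Φ Ψ s ξ t) 2 2 x) x₁ x₂ ((D.σ : ℂ) *
        (pd 0 (pd 0 (fun y => etaField Φ Ψ s ξ t y 2)) ![x₁, x₂, 0]
          + pd 1 (pd 1 (fun y => etaField Φ Ψ s ξ t y 2)) ![x₁, x₂, 0]) * kron 2 2) := by
  have hk : kron 2 2 = 1 := by simp [kron]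
  have key : ∀ a, Tendsto (fun x => (D.dP0 (x 2) : ℂ) * qField D Φ Ψ s ξ t x * kron 2 2
      - D.viscousStress (vField Φ Ψ s ξ t) 2 2 x)
      (𝓝[{x | x 2 ∈ D.layerIoo a}] ![x₁, x₂, 0]) (𝓝 (modeSum ξ (fun _ z =>
        -(Real.exp (s * t) : ℂ) * (f₂ a z : ℂ)) ![x₁, x₂, 0])) := by
    intro a
    refine tendsto_modeSum_of_eq (layerIoo_subset a) ?_ (fun j => ?_) (fun x hx => ?_) x₁ x₂
    · cases a
      · exact right_mem_Icc.2 (neg_nonpos.2 hD.m_pos.le)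
      · exact left_mem_Icc.2 hD.ℓ_pos.le
    · exact continuousOn_const.mul
        (Complex.continuous_ofReal.comp_continuousOn (hN.layer a).smooth_f₂.continuousOn)
    · have h := congrFun (dP0_mul_qField (D := D) (s := s) (Φ := Φ) (Ψ := Ψ) hr0 hr t) x
      rw [hk, mul_one, h, hN.viscousStress_two_two hr hr0 t hx]
      simp only [modeSum, ← Finset.sum_sub_distrib]
      refine Finset.sum_congr rfl fun j _ => ?_
      rw [dP0_eq hx, rho0_eq hx]
      ring
  refine ⟨_, _, key .upper, key .lower, ?_⟩
  have p0 : ∀ b, pd 0 (modeSum ξ b) = _ := fun b => funext fun x => pd_castSucc_modeSum ξ b x 0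
  have p1 : ∀ b, pd 1 (modeSum ξ b) = _ := fun b => funext fun x => pd_castSucc_modeSum ξ b x 1
  rw [etaField_eq, p0, p0, p1, p1, hk]
  simp only [modeSum, ← Finset.sum_sub_distrib, ← Finset.sum_add_distrib, Finset.mul_sum, mul_one]
  refine Finset.sum_congr rfl fun j _ => ?_
  have h := sq_add_sq hr hr0 j
  have hj : (f₂ .upper 0 : ℂ) - (f₂ .lower 0 : ℂ) = D.σ * r ^ 2 * Ψ r 0 := by
    exact_mod_cast hN.jump
  rw [wHat_two hr, coe_eq hr0 j 0, coe_eq hr0 j 1]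
  obtain ⟨c, hc⟩ : ∃ c : Fin 2 → ℂ, ∀ l, ((ξ j l / r : ℝ) : ℂ) = c l := ⟨_, fun _ => rfl⟩
  simp only [hc] at h ⊢
  simp only [Matrix.cons_val]
  linear_combination (-(Real.exp (s * t) : ℂ) * wave (ξ j) ![x₁, x₂, 0]) * hj
    - (D.σ * r ^ 2 * Ψ r 0 * (Real.exp (s * t) : ℂ) * wave (ξ j) ![x₁, x₂, 0]) *
    ((c 0 ^ 2 + c 1 ^ 2) * Complex.I_sq - h)

/-- The growing normal mode solutions solve the linearized problem. -/
theorem isLinearSolution (hD : D.Admissible) {L : ℝ} (hL : L ≠ 0)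
    (hξ : ∀ j, IsLattice L (ξ j)) :
    D.IsLinearSolution L (etaField Φ Ψ s ξ) (vField Φ Ψ s ξ) (qField D Φ Ψ s ξ) where
  periodic t _ x j hj := by
    refine ⟨funext fun i => ?_, funext fun i => ?_, ?_⟩
    · simp only [etaField_eq_exp_mul, modeSum_add_single hL hξ _ hj]
    · simp only [vField_eq_exp_mul, modeSum_add_single hL hξ _ hj]
    · simp only [qField_eq_exp_mul _ _ _ _ D hr0.ne' hr, modeSum_add_single hL hξ _ hj]
  smooth_η i p hp := by
    obtain ⟨a, ha⟩ := mem_layers_iff.1 hp.2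
    exact (contDiffAt_exp_mul_modeSum s ξ fun j =>
      (hN.contDiffOn_wHat hr a i j).contDiffAt (Icc_mem_nhds ha.1 ha.2)).contDiffWithinAt
  smooth_v i p hp := by
    obtain ⟨a, ha⟩ := mem_layers_iff.1 hp.2
    simp only [vField_eq_exp_mul]
    exact (contDiffAt_exp_mul_modeSum s ξ fun j => contDiffAt_const.mul
      ((hN.contDiffOn_wHat hr a i j).contDiffAt (Icc_mem_nhds ha.1 ha.2))).contDiffWithinAt
  smooth_q p hp := by
    obtain ⟨a, ha⟩ := mem_layers_iff.1 hp.2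
    simp only [qField_eq_exp_mul _ _ _ _ D hr0.ne' hr]
    refine (contDiffAt_exp_mul_modeSum s ξ fun j => ?_).contDiffWithinAt
    have h := ((hD.contDiffOn_layerRho a).mono (layerIoo_subset a)).mul (hN.contDiffOn_div a)
    have h' := (Complex.ofRealCLM.contDiff.comp_contDiffOn h).neg.congr (f₁ := fun z =>
      -((D.rho0 z * (deriv (Ψ r) z + r * Φ r z) : ℝ) : ℂ)) fun z hz => by
        rw [rho0_eq hz]; rfl
    exact h'.contDiffAt (isOpen_Ioo.mem_nhds ha)
  continuous_η i := by
    simp only [etaField_eq_exp_mul]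
    exact continuousOn_exp_mul_modeSum s ξ (hN.continuousOn_wHat hr i)
  continuous_v i := by
    simp only [vField_eq_exp_mul]
    exact continuousOn_exp_mul_modeSum s ξ fun j =>
      continuousOn_const.mul (hN.continuousOn_wHat hr i j)
  smooth_interface t _ := by
    have h : ContDiff ℝ ∞ fun y : Fin 2 → ℝ => (![y 0, y 1, 0] : Fin 3 → ℝ) := by
      refine contDiff_pi.2 fun i => ?_
      fin_cases i <;> simp <;> fun_prop
    simp only [etaField_eq_exp_mul, modeSum, Matrix.cons_val]
    refine contDiff_const.mul (ContDiff.sum fun j _ => ?_)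
    exact contDiff_const.mul ((contDiff_wave (ξ j)).comp h)
  eq_η t ht x _ i := dt_etaField Φ Ψ s ξ ht x i
  eq_q t ht x hx := by
    obtain ⟨a, ha⟩ := mem_layers_iff.1 hx
    exact hN.eq_q hr0 hr ht ha
  eq_v t ht x hx i := by
    obtain ⟨a, ha⟩ := mem_layers_iff.1 hx
    rcases eq_castSucc_or_eq_two i with ⟨k, rfl⟩ | rfl
    · exact hN.eq_v_castSucc hr0 hr ht k ha
    · exact hN.eq_v_two hr0 hr hD ht ha
  jump_η t _ x₁ x₂ i := by
    have h : ContinuousOn (fun x => etaField Φ Ψ s ξ t x i) {x | x 2 ∈ Icc (-D.m) D.ℓ} := by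
      simp only [etaField_eq_exp_mul]
      exact continuousOn_const.mul (continuousOn_modeSum ξ (hN.continuousOn_wHat hr i))
    exact hD.hasJump_zero h x₁ x₂
  jump_v t _ x₁ x₂ i := by
    have h : ContinuousOn (fun x => vField Φ Ψ s ξ t x i) {x | x 2 ∈ Icc (-D.m) D.ℓ} := by
      simp only [vField_eq_exp_mul]
      exact continuousOn_const.mul (continuousOn_modeSum ξ fun j =>
        continuousOn_const.mul (hN.continuousOn_wHat hr i j))
    exact hD.hasJump_zero h x₁ x₂
  jump_stress t _ x₁ x₂ i := by
    rcases eq_castSucc_or_eq_two i with ⟨k, rfl⟩ | rfl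
    · have hk : kron k.castSucc 2 = 0 := by
        fin_cases k <;> simp [kron]
      have := hN.hasJump_stress_castSucc hr0 hr hD t x₁ x₂ k
      rwa [← mul_zero ((D.σ : ℂ) * (pd 0 (pd 0 (fun y => etaField Φ Ψ s ξ t y 2)) ![x₁, x₂, 0]
        + pd 1 (pd 1 (fun y => etaField Φ Ψ s ξ t y 2)) ![x₁, x₂, 0])), ← hk] at this
    · exact hN.hasJump_stress_two hr0 hr hD t x₁ x₂
  no_slip t _ x₁ x₂ := by
    have key : ∀ z, Φ r z = 0 → Ψ r z = 0 → vField Φ Ψ s ξ t ![x₁, x₂, z] = 0 := by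
      intro z h1 h2
      ext i
      rw [vField_eq_exp_mul]
      simp only [modeSum, Matrix.cons_val]
      rcases eq_castSucc_or_eq_two i with ⟨k, rfl⟩ | rfl
      · simp [wHat_castSucc hr, h1]
      · simp [wHat_two hr, h2]
    exact ⟨key _ hN.left_φ hN.left_ψ, key _ hN.right_φ hN.right_ψ⟩

end FluidData.IsNormalMode

/-! ### Weak derivatives of functions that are smooth up to the boundary -/

/-- Integration by parts; `χ` vanishes at both endpoints, so no boundary term remains. -/
lemma setIntegral_deriv_mul_eq_neg {a b : ℝ} (hab : a < b) {χ : ℝ → ℝ} (hχ : ContDiff ℝ ∞ χ)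
    (hs : tsupport χ ⊆ Ioo a b) {v : ℝ → ℂ} (hv : ContDiffOn ℝ 1 v (Icc a b)) :
    ∫ x in Ioo a b, ((deriv χ x : ℝ) : ℂ) * v x
      = -∫ x in Ioo a b, (χ x : ℂ) * derivWithin v (Icc a b) x := by
  have hU := uniqueDiffOn_Icc hab
  have h0 : ∀ x, x ∉ Ioo a b → χ x = 0 := fun x hx => image_eq_zero_of_notMem_tsupport
    fun h => hx (hs h)
  have hd : Continuous (deriv χ) := hχ.continuous_deriv (by simp)
  have key := intervalIntegral.integral_deriv_mul_eq_sub_of_hasDerivWithinAt (a := a) (b := b)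
    (u := fun x => (χ x : ℂ)) (u' := fun x => ((deriv χ x : ℝ) : ℂ)) (v := v)
    (v' := derivWithin v (Icc a b))
    (fun x _ => ((hχ.differentiable (by simp)) x).hasDerivAt.ofReal_comp.hasDerivWithinAt)
    (fun x hx => by
      rw [uIcc_of_le hab.le] at hx ⊢
      exact ((hv.differentiableOn one_ne_zero) x hx).hasDerivWithinAt)
    ((Complex.continuous_ofReal.comp hd).intervalIntegrable _ _)
    (ContinuousOn.intervalIntegrable (by
      rw [uIcc_of_le hab.le]; exact hv.continuousOn_derivWithin hU le_rfl))
  rw [h0 b (by simp), h0 a (by simp), Complex.ofReal_zero, zero_mul, zero_mul, sub_zero,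
    intervalIntegral.integral_of_le hab.le, integral_Ioc_eq_integral_Ioo, integral_add] at key
  · exact eq_neg_of_add_eq_zero_left key
  · refine (ContinuousOn.integrableOn_Icc ?_).mono_set Ioo_subset_Icc_self
    exact (Complex.continuous_ofReal.comp hd).continuousOn.mul hv.continuousOn
  · refine (ContinuousOn.integrableOn_Icc ?_).mono_set Ioo_subset_Icc_self
    exact (Complex.continuous_ofReal.comp hχ.continuous).continuousOn.mul
      (hv.continuousOn_derivWithin hU le_rfl)

lemma contDiffOn_iteratedDerivWithin {S : Set ℝ} (hS : UniqueDiffOn ℝ S) {v : ℝ → ℂ}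
    (hv : ContDiffOn ℝ ∞ v S) (j : ℕ) : ContDiffOn ℝ ∞ (iteratedDerivWithin j v S) S := by
  induction j with
  | zero => simpa using hv
  | succ j ih =>
    rw [iteratedDerivWithin_succ]
    exact ((contDiffOn_infty_iff_derivWithin hS).1 ih).2

lemma setIntegral_iteratedDeriv_mul {a b : ℝ} (hab : a < b) (j : ℕ) {χ : ℝ → ℝ}
    (hχ : ContDiff ℝ ∞ χ) (hs : tsupport χ ⊆ Ioo a b) {v : ℝ → ℂ}
    (hv : ContDiffOn ℝ ∞ v (Icc a b)) :
    ∫ x in Ioo a b, ((iteratedDeriv j χ x : ℝ) : ℂ) * v x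
      = (-1) ^ j * ∫ x in Ioo a b, (χ x : ℂ) * iteratedDerivWithin j v (Icc a b) x := by
  have hU := uniqueDiffOn_Icc hab
  induction j generalizing χ with
  | zero => simp
  | succ j ih =>
    have hχ' : ContDiff ℝ ∞ (deriv χ) := (contDiff_infty_iff_deriv.1 hχ).2
    have h1 : ContDiffOn ℝ 1 (iteratedDerivWithin j v (Icc a b)) (Icc a b) :=
      (contDiffOn_iteratedDerivWithin hU hv j).of_le (by exact_mod_cast le_top)
    rw [iteratedDeriv_succ', ih hχ' (tsupport_deriv_subset.trans hs),
      setIntegral_deriv_mul_eq_neg hab hχ hs h1, iteratedDerivWithin_succ]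
    ring

lemma isWeakDeriv_of_contDiffOn {a b : ℝ} (hab : a < b) (j : ℕ) {u v : ℝ → ℂ}
    (hv : ContDiffOn ℝ ∞ v (Icc a b)) (huv : EqOn u v (Ioo a b)) :
    IsWeakDeriv j (Ioo a b) u (iteratedDerivWithin j v (Icc a b)) := by
  have hU := uniqueDiffOn_Icc hab
  have hi : ∀ {w : ℝ → ℂ}, ContinuousOn w (Icc a b) → IntegrableOn w (Ioo a b) := fun hw =>
    hw.integrableOn_Icc.mono_set Ioo_subset_Icc_self
  refine ⟨?_, (hi (hv.continuousOn_iteratedDerivWithin (by exact_mod_cast le_top)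
    hU)).locallyIntegrableOn, fun χ hχ _ hs => ?_⟩
  · exact ((hi hv.continuousOn).congr_fun huv.symm measurableSet_Ioo).locallyIntegrableOn
  · rw [← setIntegral_iteratedDeriv_mul hab j hχ hs hv]
    exact setIntegral_congr_fun measurableSet_Ioo fun x hx => by simp only [huv hx]

/-- One square-integrable competitor bounds the infimum, so uniqueness of weak derivatives is not
needed. -/
lemma weakDerivNormSq_lt_top {a b : ℝ} (hab : a < b) (j : ℕ) {u v : ℝ → ℂ}
    (hv : ContDiffOn ℝ ∞ v (Icc a b)) (huv : EqOn u v (Ioo a b)) :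
    weakDerivNormSq j (Ioo a b) u < ⊤ := by
  refine (iInf₂_le _ (isWeakDeriv_of_contDiffOn hab j hv huv)).trans_lt ?_
  have hc := hv.continuousOn_iteratedDerivWithin (m := j) (by exact_mod_cast le_top)
    (uniqueDiffOn_Icc hab)
  have h := ((hc.norm.pow 2).integrableOn_Icc (μ := volume) |>.mono_set Ioo_subset_Icc_self).2
  simpa [HasFiniteIntegral] using h

lemma weakDerivNormSq_zero (j : ℕ) (S : Set ℝ) : weakDerivNormSq j S (fun _ => 0) = 0 := by
  have h0 : LocallyIntegrableOn (fun _ : ℝ => (0 : ℂ)) S :=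
    (integrable_zero ℝ ℂ volume).integrableOn.locallyIntegrableOn
  have h : IsWeakDeriv j S (fun _ => 0) (fun _ => 0) := ⟨h0, h0, by simp⟩
  exact le_antisymm ((iInf₂_le _ h).trans (by simp)) bot_le

lemma IsWeakDeriv.const_mul {j : ℕ} {S : Set ℝ} {u w : ℝ → ℂ} (h : IsWeakDeriv j S u w) (c : ℂ) :
    IsWeakDeriv j S (fun x => c * u x) (fun x => c * w x) := by
  refine ⟨fun x hx => (h.1 x hx).smul c, fun x hx => (h.2.1 x hx).smul c, fun χ h1 h2 h3 => ?_⟩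
  simp only [mul_left_comm _ c]
  rw [integral_const_mul, integral_const_mul, h.2.2 χ h1 h2 h3]
  ring

lemma weakDerivNormSq_const_mul_le (j : ℕ) (S : Set ℝ) (u : ℝ → ℂ) {c : ℂ} (hc : c ≠ 0) :
    weakDerivNormSq j S (fun x => c * u x) ≤ ‖c‖ₑ ^ 2 * weakDerivNormSq j S u := by
  have h0 : ‖c‖ₑ ^ 2 ≠ 0 := by simpa using hc
  have h1 : ‖c‖ₑ ^ 2 ≠ ⊤ := by simp
  unfold weakDerivNormSq
  simp only [ENNReal.mul_iInf_of_ne h0 h1]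
  refine le_iInf₂ fun w hw => (iInf₂_le _ (hw.const_mul c)).trans (le_of_eq ?_)
  rw [← lintegral_const_mul' _ _ h1]
  simp only [enorm_mul, mul_pow]

/-- The reverse inequality is the first one applied with `c⁻¹`. -/
lemma weakDerivNormSq_const_mul (j : ℕ) (S : Set ℝ) (u : ℝ → ℂ) {c : ℂ} (hc : c ≠ 0) :
    weakDerivNormSq j S (fun x => c * u x) = ‖c‖ₑ ^ 2 * weakDerivNormSq j S u := by
  refine le_antisymm (weakDerivNormSq_const_mul_le j S u hc) ?_
  have h := weakDerivNormSq_const_mul_le j S (fun x => c * u x) (inv_ne_zero hc)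
  simp only [inv_mul_cancel_left₀ hc] at h
  refine (mul_le_mul_right h (‖c‖ₑ ^ 2)).trans (le_of_eq ?_)
  rw [← mul_assoc, ← mul_pow, ← enorm_mul, mul_inv_cancel₀ hc]
  simp

/-! ### Scaling of the Sobolev norms -/

lemma horizFourier_const_mul (L : ℝ) (c : ℂ) (f : (Fin 3 → ℝ) → ℂ)
    (ξ : EuclideanSpace ℝ (Fin 2)) (x₃ : ℝ) :
    horizFourier L (fun x => c * f x) ξ x₃ = c * horizFourier L f ξ x₃ := by
  simp only [horizFourier, mul_assoc, intervalIntegral.integral_const_mul]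

lemma layerNormSq_const_mul (L : ℝ) (k : ℕ) (S : Set ℝ) (f : (Fin 3 → ℝ) → ℂ) {c : ℂ}
    (hc : c ≠ 0) : layerNormSq L k S (fun x => c * f x) = ‖c‖ₑ ^ 2 * layerNormSq L k S f := by
  have h : ∀ ξ, horizFourier L (fun x => c * f x) ξ = fun x₃ => c * horizFourier L f ξ x₃ :=
    fun ξ => funext fun x₃ => horizFourier_const_mul L c f ξ x₃
  simp only [layerNormSq, h, weakDerivNormSq_const_mul _ _ _ hc, mul_left_comm _ (‖c‖ₑ ^ 2),
    ENNReal.tsum_mul_left, Finset.mul_sum]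

namespace FluidData

lemma sobolevNormSq_const_mul (D : FluidData) (L : ℝ) (k : ℕ) (f : (Fin 3 → ℝ) → ℂ) {c : ℂ}
    (hc : c ≠ 0) :
    D.sobolevNormSq L k (fun x => c * f x) = ‖c‖ₑ ^ 2 * D.sobolevNormSq L k f := by
  simp only [sobolevNormSq, layerNormSq_const_mul _ _ _ _ hc, mul_add]

lemma hkNorm_const_mul (D : FluidData) {d : ℕ} (L : ℝ) (k : ℕ) (f : (Fin 3 → ℝ) → Fin d → ℂ)
    {c : ℝ} (hc : 0 < c) :
    D.hkNorm L k (fun x i => (c : ℂ) * f x i) = c * D.hkNorm L k f := by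
  have h : (c : ℂ) ≠ 0 := by exact_mod_cast hc.ne'
  simp only [hkNorm, D.sobolevNormSq_const_mul L k _ h, ENNReal.toReal_mul, ← Finset.mul_sum]
  rw [Real.sqrt_mul (by positivity)]
  simp [Real.sqrt_sq hc.le]

end FluidData

/-! ### Fourier coefficients of wave sums -/

lemma integral_exp_int_mul {L : ℝ} (hL : 0 < L) {k : ℤ} (hk : k ≠ 0) :
    ∫ x in (0 : ℝ)..(2 * Real.pi * L), Complex.exp (Complex.I * ((k / L : ℝ) : ℂ) * x) = 0 := by
  have hk' : (k : ℂ) ≠ 0 := by exact_mod_cast hk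
  have hL' : (L : ℂ) ≠ 0 := by exact_mod_cast hL.ne'
  rw [integral_exp_mul_complex (by push_cast; simp [hk', hL'])]
  have : Complex.I * ((k / L : ℝ) : ℂ) * ((2 * Real.pi * L : ℝ) : ℂ)
      = k * (2 * Real.pi * Complex.I) := by
    push_cast; field_simp
  rw [this, Complex.exp_int_mul_two_pi_mul_I]
  simp

/-- The Fourier coefficient of a wave. -/
noncomputable def waveCoeff (L : ℝ) (ξ ζ : EuclideanSpace ℝ (Fin 2)) : ℂ :=
  (∫ x in (0 : ℝ)..(2 * Real.pi * L), Complex.exp (Complex.I * ((ξ 0 - ζ 0 : ℝ) : ℂ) * x)) *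
    ∫ x in (0 : ℝ)..(2 * Real.pi * L), Complex.exp (Complex.I * ((ξ 1 - ζ 1 : ℝ) : ℂ) * x)

lemma horizFourier_modeSum (L : ℝ) (ξ : Fin 2 → EuclideanSpace ℝ (Fin 2)) (a : Fin 2 → ℝ → ℂ)
    (ζ : EuclideanSpace ℝ (Fin 2)) (x₃ : ℝ) :
    horizFourier L (modeSum ξ a) ζ x₃ = ∑ j, a j x₃ * waveCoeff L (ξ j) ζ := by
  have h : ∀ x₁ x₂ : ℝ, modeSum ξ a ![x₁, x₂, x₃] *
      Complex.exp (-Complex.I * ((x₁ * ζ 0 + x₂ * ζ 1 : ℝ) : ℂ)) = ∑ j, a j x₃ *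
      (Complex.exp (Complex.I * ((ξ j 0 - ζ 0 : ℝ) : ℂ) * x₁) *
        Complex.exp (Complex.I * ((ξ j 1 - ζ 1 : ℝ) : ℂ) * x₂)) := by
    intro x₁ x₂
    simp only [modeSum, Finset.sum_mul, wave, mul_assoc, ← Complex.exp_add]
    refine Finset.sum_congr rfl fun j _ => ?_
    simp only [Matrix.cons_val]
    congr 2
    push_cast
    ring
  unfold horizFourier
  simp only [h]
  have h2 : ∀ x₁ : ℝ, ∫ x₂ in (0 : ℝ)..(2 * Real.pi * L), ∑ j, a j x₃ *
      (Complex.exp (Complex.I * ((ξ j 0 - ζ 0 : ℝ) : ℂ) * x₁) *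
        Complex.exp (Complex.I * ((ξ j 1 - ζ 1 : ℝ) : ℂ) * x₂)) = ∑ j, a j x₃ *
      (Complex.exp (Complex.I * ((ξ j 0 - ζ 0 : ℝ) : ℂ) * x₁) *
        ∫ x in (0 : ℝ)..(2 * Real.pi * L),
          Complex.exp (Complex.I * ((ξ j 1 - ζ 1 : ℝ) : ℂ) * x)) := by
    intro x₁
    rw [intervalIntegral.integral_finsetSum fun j _ =>
      Continuous.intervalIntegrable (by fun_prop) _ _]
    simp only [intervalIntegral.integral_const_mul]
  simp only [h2]
  rw [intervalIntegral.integral_finsetSum fun j _ =>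
    Continuous.intervalIntegrable (by fun_prop) _ _]
  simp only [intervalIntegral.integral_const_mul, intervalIntegral.integral_mul_const, waveCoeff]

/-- Distinct lattice points differ in some coordinate, and the integral of that factor over a full
period vanishes. -/
lemma waveCoeff_eq_zero {L : ℝ} (hL : 0 < L) {m n : Fin 2 → ℤ} (hmn : m ≠ n) :
    waveCoeff L (latticePoint L m) (latticePoint L n) = 0 := by
  have key : ∀ i, m i ≠ n i → ∫ x in (0 : ℝ)..(2 * Real.pi * L), Complex.exp (Complex.I *
      ((latticePoint L m i - latticePoint L n i : ℝ) : ℂ) * x) = 0 := by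
    intro i hi
    rw [← integral_exp_int_mul hL (sub_ne_zero.2 hi)]
    have : latticePoint L m i - latticePoint L n i = ((m i - n i : ℤ) : ℝ) / L := by
      simp [latticePoint, sub_div]
    rw [this]
  by_cases h : m 0 = n 0
  · have h1 : m 1 ≠ n 1 := fun h' => hmn (by ext i; fin_cases i <;> assumption)
    rw [waveCoeff, key 1 h1, mul_zero]
  · rw [waveCoeff, key 0 h, zero_mul]

/-- By orthogonality the lattice sum is supported on the frequencies of the waves, so it reduces to
finitely many finite terms. -/
lemma layerNormSq_modeSum_lt_top {L : ℝ} (hL : 0 < L) (k : ℕ) {c d : ℝ} (hcd : c < d)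
    {ξ : Fin 2 → EuclideanSpace ℝ (Fin 2)} (hξ : ∀ j, IsLattice L (ξ j)) {a b : Fin 2 → ℝ → ℂ}
    (hb : ∀ j, ContDiffOn ℝ ∞ (b j) (Icc c d)) (hab : ∀ j, EqOn (a j) (b j) (Ioo c d)) :
    layerNormSq L k (Ioo c d) (modeSum ξ a) < ⊤ := by
  have hN : ∀ j, ∃ n, ξ j = latticePoint L n := fun j => by
    obtain ⟨n, hn⟩ := hξ j
    exact ⟨n, by ext i; exact hn i⟩
  choose N hN using hN
  refine ENNReal.sum_lt_top.2 fun j _ => ?_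
  rw [tsum_eq_sum (s := Finset.univ.image N)]
  · refine ENNReal.sum_lt_top.2 fun n _ => ENNReal.mul_lt_top ENNReal.ofReal_lt_top ?_
    refine weakDerivNormSq_lt_top hcd j
      (v := fun z => ∑ l, b l z * waveCoeff L (ξ l) (latticePoint L n)) ?_ ?_
    · exact ContDiffOn.sum fun l _ => (hb l).mul contDiffOn_const
    · intro z hz
      rw [horizFourier_modeSum]
      exact Finset.sum_congr rfl fun l _ => by rw [hab l hz]
  · intro n hn
    have h0 : horizFourier L (modeSum ξ a) (latticePoint L n) = fun _ => 0 := by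
      ext z
      rw [horizFourier_modeSum]
      refine Finset.sum_eq_zero fun l _ => ?_
      rw [hN l, waveCoeff_eq_zero hL, mul_zero]
      rintro rfl
      exact hn (Finset.mem_image_of_mem N (Finset.mem_univ l))
    rw [h0, weakDerivNormSq_zero, mul_zero]

/-! ### Sobolev membership and exact growth of the norms. -/

namespace FluidData

variable {D : FluidData}

/-- A vertical profile that agrees in each open layer with a function that is smooth in the closed
layer. -/
def IsLayerSmooth (D : FluidData) (a : ℝ → ℂ) : Prop :=
  ∀ p, ∃ b : ℝ → ℂ, ContDiffOn ℝ ∞ b (D.layerIcc p) ∧ EqOn a b (D.layerIoo p)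

lemma isLayerSmooth_of_contDiffOn {a : ℝ → ℂ} (h : ∀ p, ContDiffOn ℝ ∞ a (D.layerIcc p)) :
    D.IsLayerSmooth a := fun p => ⟨a, h p, fun _ _ => rfl⟩

lemma IsLayerSmooth.const_mul {a : ℝ → ℂ} (h : D.IsLayerSmooth a) (c : ℂ) :
    D.IsLayerSmooth (fun z => c * a z) := fun p => by
  obtain ⟨b, hb, hab⟩ := h p
  exact ⟨fun z => c * b z, contDiffOn_const.mul hb, fun z hz => by simp only [hab hz]⟩

namespace Admissible

variable (hD : D.Admissible)

include hD

lemma sobolevNormSq_modeSum_lt_top {L : ℝ} (hL : 0 < L) (k : ℕ)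
    {ξ : Fin 2 → EuclideanSpace ℝ (Fin 2)} (hξ : ∀ j, IsLattice L (ξ j)) {a : Fin 2 → ℝ → ℂ}
    (ha : ∀ j, D.IsLayerSmooth (a j)) : D.sobolevNormSq L k (modeSum ξ a) < ⊤ := by
  have key : ∀ p, layerNormSq L k (D.layerIoo p) (modeSum ξ a) < ⊤ := fun p => by
    choose b hb hab using fun j => ha j p
    exact layerNormSq_modeSum_lt_top hL k (hD.layer_lt p) hξ hb hab
  exact ENNReal.add_lt_top.2 ⟨key .upper, key .lower⟩

omit hD in
lemma periodCell_inter_layers_ae (L : ℝ) :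
    (D.periodCell L ∩ (D.domainLower ∪ D.domainUpper) : Set (Fin 3 → ℝ))
      =ᵐ[volume] D.periodCell L := by
  have h0 : ∀ᵐ x : Fin 3 → ℝ, x 2 ≠ 0 :=
    compl_mem_ae_iff.2 (Measure.pi_hyperplane (fun _ : Fin 3 => (volume : Measure ℝ)) 2 0)
  filter_upwards [h0] with x hx
  refine propext ⟨fun h => h.1, fun h => ⟨h, ?_⟩⟩
  rcases lt_or_gt_of_ne hx with h1 | h1
  · exact Or.inl ⟨h.2.2.1, h1⟩
  · exact Or.inr ⟨h1, h.2.2.2⟩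

omit hD in
lemma memLp_modeSum (L : ℝ) (ξ : Fin 2 → EuclideanSpace ℝ (Fin 2)) {a : Fin 2 → ℝ → ℂ}
    (ha : ∀ j, D.IsLayerSmooth (a j)) :
    MemLp (modeSum ξ a) 2 (volume.restrict (D.periodCell L)) := by
  have hcell : MeasurableSet (D.periodCell L) :=
    ((measurable_pi_apply 0) measurableSet_Ioo).inter
      (((measurable_pi_apply 1) measurableSet_Ioo).inter
        ((measurable_pi_apply 2) measurableSet_Ioo))
  have hfin : volume (D.periodCell L) < ⊤ := by
    refine (measure_mono (t := Icc ![0, 0, -D.m] ![2 * Real.pi * L, 2 * Real.pi * L, D.ℓ])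
      fun x hx => ⟨fun i => ?_, fun i => ?_⟩).trans_lt isCompact_Icc.measure_lt_top
    · fin_cases i
      · exact hx.1.1.le
      · exact hx.2.1.1.le
      · exact hx.2.2.1.le
    · fin_cases i
      · exact hx.1.2.le
      · exact hx.2.1.2.le
      · exact hx.2.2.2.le
  have hbd : ∀ p, ∃ C, ∀ x : Fin 3 → ℝ, x 2 ∈ D.layerIoo p → ‖modeSum ξ a x‖ ≤ C := by
    intro p
    choose b hb hab using fun j => ha j p
    choose C hC using fun j => isCompact_Icc.exists_bound_of_continuousOn (hb j).continuousOn
    refine ⟨∑ j, C j, fun x hx => ?_⟩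
    refine (norm_sum_le _ _).trans (Finset.sum_le_sum fun j _ => ?_)
    have hw : ‖wave (ξ j) x‖ = 1 := by
      rw [wave, mul_comm, Complex.norm_exp_ofReal_mul_I]
    rw [norm_mul, hw, mul_one, hab j hx]
    exact hC j _ (layerIoo_subset p hx)
  have hcont : ∀ p, ContinuousOn (modeSum ξ a) {x | x 2 ∈ D.layerIoo p} := fun p =>
    continuousOn_modeSum ξ fun j => by
      obtain ⟨b, hb, hab⟩ := ha j p
      exact (hb.continuousOn.mono (layerIoo_subset p)).congr hab
  have hmeas : ∀ p, MeasurableSet {x : Fin 3 → ℝ | x 2 ∈ D.layerIoo p} := fun p =>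
    (measurable_pi_apply 2) measurableSet_Ioo
  rw [← Measure.restrict_congr_set (periodCell_inter_layers_ae L)]
  have hm : MeasurableSet (D.domainLower ∪ D.domainUpper) := (hmeas .lower).union (hmeas .upper)
  have : IsFiniteMeasure (volume.restrict (D.periodCell L ∩ (D.domainLower ∪ D.domainUpper))) :=
    ⟨by rw [Measure.restrict_apply_univ]; exact (measure_mono inter_subset_left).trans_lt hfin⟩
  obtain ⟨C₁, h₁⟩ := hbd .lower
  obtain ⟨C₂, h₂⟩ := hbd .upper
  refine MemLp.of_bound (C := max C₁ C₂) ?_ ?_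
  · refine AEStronglyMeasurable.mono_measure ?_ (Measure.restrict_mono inter_subset_right le_rfl)
    exact aestronglyMeasurable_union_iff.2 ⟨(hcont .lower).aestronglyMeasurable (hmeas .lower),
      (hcont .upper).aestronglyMeasurable (hmeas .upper)⟩
  · filter_upwards [ae_restrict_mem (hcell.inter hm)] with x hx
    rcases hx.2 with h | h
    · exact (h₁ x h).trans (le_max_left _ _)
    · exact (h₂ x h).trans (le_max_right _ _)

/-- An exponentially growing superposition of waves with layerwise smooth profiles lies in every
`H^k`, and its norms grow at the same rate. -/
lemma memHk_and_hkNorm_eq {L : ℝ} (hL : 0 < L) (k : ℕ) {s t : ℝ} {d : ℕ}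
    {ξ : Fin 2 → EuclideanSpace ℝ (Fin 2)} (hξ : ∀ j, IsLattice L (ξ j))
    {a : Fin d → Fin 2 → ℝ → ℂ} (ha : ∀ i j, D.IsLayerSmooth (a i j))
    {f : ℝ → (Fin 3 → ℝ) → Fin d → ℂ}
    (hf : ∀ t x i, f t x i = (Real.exp (s * t) : ℂ) * modeSum ξ (a i) x) :
    D.MemHk L k (f t) ∧ D.hkNorm L k (f t) = Real.exp (t * s) * D.hkNorm L k (f 0) := by
  refine ⟨fun i => ?_, ?_⟩
  · have h : (fun x => f t x i) = modeSum ξ (fun j z => (Real.exp (s * t) : ℂ) * a i j z) := by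
      ext x
      simp only [hf, modeSum, Finset.mul_sum, mul_assoc]
    rw [h]
    exact ⟨memLp_modeSum L ξ fun j => (ha i j).const_mul _,
      hD.sobolevNormSq_modeSum_lt_top hL k hξ fun j => (ha i j).const_mul _⟩
  · have h : f t = fun x i => (Real.exp (t * s) : ℂ) * f 0 x i := by
      ext x i
      rw [hf, hf, mul_comm t s]
      simp
    rw [h, D.hkNorm_const_mul L k (f 0) (Real.exp_pos _)]

end Admissible

/-- `ψ'` can jump at the interface, so the smooth extension to the closed layer uses the one-sided
`derivWithin` instead of `deriv`. -/
lemma IsNormalMode.isLayerSmooth_q {r s : ℝ} {φ ψ f₁ : ℝ → ℝ} {f₂ : Phase → ℝ → ℝ}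
    (hN : D.IsNormalMode r s φ ψ f₁ f₂) (hD : D.Admissible) :
    D.IsLayerSmooth fun z => -((D.rho0 z * (deriv ψ z + r * φ z) : ℝ) : ℂ) := by
  intro p
  refine ⟨fun z => -((D.layerRho p z * (derivWithin ψ (D.layerIcc p) z + r * φ z) : ℝ) : ℂ),
    ?_, fun z hz => ?_⟩
  · have h1 : ContDiffOn ℝ ∞ (derivWithin ψ (D.layerIcc p)) (D.layerIcc p) :=
      ((contDiffOn_infty_iff_derivWithin (uniqueDiffOn_Icc (hD.layer_lt p))).1
        (hN.layer p).smooth_ψ).2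
    exact (Complex.ofRealCLM.contDiff.comp_contDiffOn ((hD.contDiffOn_layerRho p).mul
      (h1.add (contDiffOn_const.mul (hN.layer p).smooth_φ)))).neg
  · have h : derivWithin ψ (D.layerIcc p) z = deriv ψ z :=
      derivWithin_of_mem_nhds (Icc_mem_nhds hz.1 hz.2)
    simp only [h, rho0_eq hz]

end FluidData

end RayleighTaylor

theorem mainTheorem4 (D : FluidData) (hD : D.Admissible) (L : ℝ)
    (hL : √(D.σ / (D.g * D.jumpRho)) < L) :
    -- the growth rate `λ(r)` and the normal modes are well defined for `0 < r < |ξ|_c`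
    (∀ r, D.IsUnstable r → ∃! s, D.IsFixedRate r s) ∧
    (∃ Φ Ψ : ℝ → ℝ → ℝ, D.IsModeFamily Φ Ψ) ∧
    -- `Λ_L` is positive and attained
    0 < D.maxRate L ∧ IsGreatest (D.latticeRates L) (D.maxRate L) ∧
    -- the resulting solutions
    ∀ Φ Ψ : ℝ → ℝ → ℝ, D.IsModeFamily Φ Ψ →
      ∀ ξ : Fin 2 → EuclideanSpace ℝ (Fin 2),
        (∀ j, IsLattice L (ξ j) ∧ D.IsUnstable ‖ξ j‖ ∧ D.growthRate ‖ξ j‖ = D.maxRate L) →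
        ξ 0 = -ξ 1 →
        ∀ (η v : ℝ → (Fin 3 → ℝ) → Fin 3 → ℂ) (q : ℝ → (Fin 3 → ℝ) → ℂ),
          η = etaField Φ Ψ (D.maxRate L) ξ →
          v = vField Φ Ψ (D.maxRate L) ξ →
          q = qField D Φ Ψ (D.maxRate L) ξ →
          (∀ j, psi Ψ (ξ j) 0 ≠ 0) ∧
          (∀ t x, (∀ i, (η t x i).im = 0) ∧ (∀ i, (v t x i).im = 0) ∧ (q t x).im = 0) ∧
          D.IsLinearSolution L η v q ∧
          ∀ t ≥ 0, ∀ k : ℕ,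
            (D.MemHk L k (η t) ∧ D.MemHk L k (v t) ∧ D.MemHk L k (fun x (_ : Fin 1) => q t x)) ∧
            D.hkNorm L k (η t) = Real.exp (t * D.maxRate L) * D.hkNorm L k (η 0) ∧
            D.hkNorm L k (v t) = Real.exp (t * D.maxRate L) * D.hkNorm L k (v 0) ∧
            D.hkNorm L k (fun x (_ : Fin 1) => q t x)
              = Real.exp (t * D.maxRate L) * D.hkNorm L k (fun x (_ : Fin 1) => q 0 x) := by
  have hL0 : 0 < L := (Real.sqrt_nonneg _).trans_lt hL
  obtain ⟨hpos, hgr⟩ := hD.isGreatest_maxRate hL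
  refine ⟨fun r hr => hD.existsUnique_isFixedRate hr, hD.exists_isModeFamily, hpos, hgr, ?_⟩
  rintro Φ Ψ hΦ ξ hξ hneg η v q rfl rfl rfl
  set s := D.maxRate L with hs
  -- Opposite frequencies share their modulus, so a single minimizer serves both waves.
  obtain ⟨r, hr⟩ : ∃ r, ∀ j, ‖ξ j‖ = r := ⟨‖ξ 1‖, fun j => by
    fin_cases j
    · simp [hneg]
    · rfl⟩
  have hun : D.IsUnstable r := hr 0 ▸ (hξ 0).2.1
  have hr0 : 0 < r := hun.1
  have hrate : D.growthRate r = s := hr 0 ▸ (hξ 0).2.2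
  obtain ⟨f₁, f₂, hN⟩ := hD.isNormalMode_of_minimizer hun (hΦ r hun).1 (hΦ r hun).2
  rw [hrate] at hN
  have hlat := fun j => (hξ j).1
  refine ⟨fun j => ?_, fun t x => ⟨fun i => ?_, fun i => ?_, ?_⟩,
    hN.isLinearSolution hr0 hr hD hL0.ne' hlat, fun t _ k => ?_⟩
  · rw [psi, hr]
    exact hN.ψ_ne_zero
  · rw [etaField_eq_exp_mul, Complex.im_ofReal_mul, modeSum_im hneg, mul_zero]
    rw [conj_wHat, hneg, neg_neg]
  · rw [vField_eq_exp_mul, Complex.im_ofReal_mul, modeSum_im hneg, mul_zero]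
    rw [map_mul, conj_wHat, hneg, neg_neg, Complex.conj_ofReal]
  · rw [qField_eq_exp_mul _ _ _ _ D hr0.ne' hr, Complex.im_ofReal_mul, modeSum_im hneg, mul_zero]
    rw [map_neg, Complex.conj_ofReal]
  have hw : ∀ i j, D.IsLayerSmooth fun z => wHat Φ Ψ (ξ j) z i := fun i j =>
    FluidData.isLayerSmooth_of_contDiffOn fun p => hN.contDiffOn_wHat hr p i j
  have h1 := hD.memHk_and_hkNorm_eq hL0 k (s := s) (t := t) hlat hw
    (f := etaField Φ Ψ s ξ) fun t x i => etaField_eq_exp_mul Φ Ψ s ξ t x i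
  have h2 := hD.memHk_and_hkNorm_eq hL0 k (s := s) (t := t) hlat
    (fun i j => (hw i j).const_mul s)
    (f := vField Φ Ψ s ξ) fun t x i => vField_eq_exp_mul Φ Ψ s ξ t x i
  have h3 := hD.memHk_and_hkNorm_eq hL0 k (s := s) (t := t) (d := 1) hlat
    (fun _ _ => hN.isLayerSmooth_q hD) (f := fun t x _ => qField D Φ Ψ s ξ t x)
    fun t x _ => qField_eq_exp_mul Φ Ψ s ξ D hr0.ne' hr t x
  exact ⟨⟨h1.1, h2.1, h3.1⟩, h1.2, h2.2, h3.2⟩
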